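/- Let $n\ge 2$ and let $(M,\omega)$ be a compact Hermitian manifold of complex dimension $n$ with smooth boundary $\partial M$ (which may be empty); the complex structure and $\omega$ are smooth up to $\partial M$. Write $\omega=\frac{\sqrt{-1}}{2}\sum g_{i\bar j}\,dz_i\wedge d\bar z_j$ in local holomorphic coordinates, $\{g^{i\bar j}\}=\{g_{i\bar j}\}^{-1}$, and, for a real function $u$, $$|\nabla u|^2=\sum g^{i\bar j}u_iu_{\bar j},\qquad \Delta u=\sum g^{i\bar j}u_{i\bar j},\qquad u_{i\bar j}=\partial_i\bar\partial_j u .$$ For a smooth real $(1,1)$ form $\chi$ on $M$ put $\chi_u=\chi+\frac{\sqrt{-1}}{2}\partial\bar\partial u$. Fix a $C^2$ norm on $M$, defined by means of a finite cover of $M$ by compact subsets of holomorphic coordinate domains. For all real numbers $C_0$, $B$, $\varepsilon>0$, $c>0$ there are constants $C_1,C_2$, depending only on $C_0,B,\varepsilon,c$ and on $(M,\omega)$ and the chosen $C^2$ norm, with the following property. Let $\chi$ be a smooth real $(1,1)$ form and $\psi\in C^2(M)$ a real function with $\psi\ge c$ and $|\chi|_{C^2(M)}\le B$, $|\psi|_{C^2(M)}\le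 B$. Let $u\in C^4(M)$ satisfy $$\chi_u^n=\psi\,\chi_u^{n-1}\wedge\omega,\qquad \chi_u>0\quad\text{on }M,\qquad \sup_M u-\inf_M u\le C_0,$$ and let $\underline u\in C^2(M)$ satisfy $$\chi_{\underline u}^n\ge\psi\,\chi_{\underline u}^{n-1}\wedge\omega,\qquad \chi_{\underline u}>0\quad\text{on }M,\qquad \chi_{\underline u}\ge\varepsilon\,\omega,\qquad |\underline u|_{C^2(M)}\le B .$$ Then $$\max_M|\nabla u|\le C_1\bigl(1+\max_{\partial M}|\nabla u|\bigr),\qquad |\Delta u|\le C_2\bigl(1+\max_{\partial M}|\Delta u|\bigr)\quad\text{on }M,$$ where a maximum over $\partial M$ is read as $0$ if $\partial M=\emptyset$. (In particular $C_2$ does not depend on any bound for $|\nabla u|$.) -/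

import Mathlib

open Set Topology
open scoped Manifold ContDiff ComplexOrder

noncomputable section

namespace HermitianMA

/-- The tangent space at `x` of a real `2n`-dimensional smooth manifold with boundary, i.e. one
modelled on the closed half-space of `ℝ²ⁿ`. -/
abbrev Tan (n : ℕ) [NeZero n] {M : Type*} [TopologicalSpace M]
    [ChartedSpace (EuclideanHalfSpace (2 * n)) M] (x : M) : Type :=
  TangentSpace (𝓡∂ (2 * n)) x

/-- The boundary `∂M` (possibly empty). -/
abbrev bdry (n : ℕ) [NeZero n] (M : Type*) [TopologicalSpace M]
    [ChartedSpace (EuclideanHalfSpace (2 * n)) M] : Set M :=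
  (𝓡∂ (2 * n)).boundary M

/-- A real function of class `C^k` on `M` (up to the boundary). -/
abbrev IsCk (n : ℕ) [NeZero n] {M : Type*} [TopologicalSpace M]
    [ChartedSpace (EuclideanHalfSpace (2 * n)) M] (k : ℕ∞) (f : M → ℝ) : Prop :=
  ContMDiff (𝓡∂ (2 * n)) 𝓘(ℝ, ℝ) k f

section Coordinates

variable {n : ℕ} [NeZero n] {M : Type*} [TopologicalSpace M]
  [ChartedSpace (EuclideanHalfSpace (2 * n)) M]

/-- The real differential `dz` at `x` of a map `z` to `ℂⁿ`. -/
def dCoord (z : M → Fin n → ℂ) (x : M) : Tan n x →L[ℝ] (Fin n → ℂ) :=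
  mfderiv (𝓡∂ (2 * n)) 𝓘(ℝ, Fin n → ℂ) z x

/-- `z` is a system of holomorphic coordinates on the open set `U`, for the field `J` of
endomorphisms of the tangent spaces: `z` is smooth up to the boundary, one-to-one, its differential
is invertible, and it carries `J` to multiplication by `√-1`. The boundary of `M` is not required
to be flat in these coordinates. -/
structure IsHolCoord (J : ∀ x : M, Tan n x →ₗ[ℝ] Tan n x) (U : Set M) (z : M → Fin n → ℂ) :
    Prop where
  isOpen : IsOpen U
  contMDiffOn : ContMDiffOn (𝓡∂ (2 * n)) 𝓘(ℝ, Fin n → ℂ) ∞ z U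
  injOn : InjOn z U
  bijective : ∀ x ∈ U, Function.Bijective (dCoord z x)
  map_J : ∀ x ∈ U, ∀ v : Tan n x, dCoord z x (J x v) = Complex.I • dCoord z x v

/-- The tangent vector at `x` whose image under `dz` is `a`. -/
def coordVec (z : M → Fin n → ℂ) (x : M) (a : Fin n → ℂ) : Tan n x :=
  (dCoord z x).inverse a

/-- The derivative of `f` at `x` in the constant coordinate direction `a`. -/
def coordDeriv (z : M → Fin n → ℂ) (a : Fin n → ℂ) (f : M → ℂ) (x : M) : ℂ :=
  (mfderiv (𝓡∂ (2 * n)) 𝓘(ℝ, ℂ) f x : Tan n x →L[ℝ] ℂ) (coordVec z x a)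

/-- `∂f/∂zᵢ = ½ (∂f/∂xᵢ - √-1 ∂f/∂yᵢ)`. -/
def partialZ (z : M → Fin n → ℂ) (i : Fin n) (f : M → ℂ) (x : M) : ℂ :=
  (1 / 2) * (coordDeriv z (Pi.single i 1) f x
    - Complex.I * coordDeriv z (Pi.single i Complex.I) f x)

/-- `∂f/∂z̄ᵢ = ½ (∂f/∂xᵢ + √-1 ∂f/∂yᵢ)`. -/
def partialZbar (z : M → Fin n → ℂ) (i : Fin n) (f : M → ℂ) (x : M) : ℂ :=
  (1 / 2) * (coordDeriv z (Pi.single i 1) f x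
    + Complex.I * coordDeriv z (Pi.single i Complex.I) f x)

/-- The matrix `u_{i j̄} = ∂ᵢ ∂̄ⱼ u` at `x`. -/
def complexHessian (z : M → Fin n → ℂ) (u : M → ℝ) (x : M) : Matrix (Fin n) (Fin n) ℂ :=
  Matrix.of fun i j => partialZ z i (partialZbar z j fun y => (u y : ℂ)) x

/-- The components `α_{i j̄}` at `x` of a real `(1,1)` form
`α = (√-1/2) ∑ α_{i j̄} dzᵢ ∧ dz̄ⱼ`. As `α` is invariant under `J`, they are
`α_{i j̄} = -2 √-1 α(∂/∂zᵢ, ∂/∂z̄ⱼ) = α(∂/∂xᵢ, ∂/∂yⱼ) - √-1 α(∂/∂xᵢ, ∂/∂xⱼ)`. -/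
def components (α : ∀ x : M, (Tan n x) [⋀^Fin 2]→ₗ[ℝ] ℝ) (z : M → Fin n → ℂ) (x : M) :
    Matrix (Fin n) (Fin n) ℂ :=
  Matrix.of fun i j =>
    (α x ![coordVec z x (Pi.single i 1), coordVec z x (Pi.single j Complex.I)] : ℂ)
      - Complex.I * (α x ![coordVec z x (Pi.single i 1), coordVec z x (Pi.single j 1)] : ℂ)

/-- The algebra `(Λ* T*ₓM) ⊗ ℂ` of complex exterior forms at `x`; its product is the wedge
product. -/
abbrev Forms (n : ℕ) [NeZero n] {M : Type*} [TopologicalSpace M]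
    [ChartedSpace (EuclideanHalfSpace (2 * n)) M] (x : M) : Type :=
  ExteriorAlgebra ℂ (Tan n x →ₗ[ℝ] ℂ)

/-- The covector `dzᵢ` at `x`. -/
def dz (z : M → Fin n → ℂ) (i : Fin n) (x : M) : Tan n x →ₗ[ℝ] ℂ :=
  (LinearMap.proj i : (Fin n → ℂ) →ₗ[ℝ] ℂ) ∘ₗ (dCoord z x : Tan n x →ₗ[ℝ] (Fin n → ℂ))

/-- The covector `dz̄ᵢ` at `x`. -/
def dzbar (z : M → Fin n → ℂ) (i : Fin n) (x : M) : Tan n x →ₗ[ℝ] ℂ :=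
  (Complex.conjAe.toLinearMap : ℂ →ₗ[ℝ] ℂ) ∘ₗ dz z i x

/-- The exterior form `(√-1/2) ∑ A_{ij} dzᵢ ∧ dz̄ⱼ` at `x`. -/
def formOf (z : M → Fin n → ℂ) (x : M) (A : Matrix (Fin n) (Fin n) ℂ) : Forms n x :=
  (Complex.I / 2) • ∑ i, ∑ j, A i j •
    (ExteriorAlgebra.ι ℂ (dz z i x) * ExteriorAlgebra.ι ℂ (dzbar z j x))

/-- On the set `K`, the function `f` and its first and second derivatives in the coordinates `z`
are bounded by `B` (operator norms of the derivatives with respect to the sup norm of `ℂⁿ`). -/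
def C2BoundOn (z : M → Fin n → ℂ) (K : Set M) (f : M → ℂ) (B : ℝ) : Prop :=
  ∀ x ∈ K, ‖f x‖ ≤ B ∧
    (∀ a : Fin n → ℂ, ‖a‖ ≤ 1 → ‖coordDeriv z a f x‖ ≤ B) ∧
    (∀ a b : Fin n → ℂ, ‖a‖ ≤ 1 → ‖b‖ ≤ 1 → ‖coordDeriv z a (coordDeriv z b f) x‖ ≤ B)

end Coordinates

/-- A complex structure on a smooth manifold with boundary: a field `J` of endomorphisms of the
tangent spaces such that `J`-holomorphic coordinates, smooth up to the boundary, exist near every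
point. -/
structure ComplexStructure (n : ℕ) [NeZero n] (M : Type*) [TopologicalSpace M]
    [ChartedSpace (EuclideanHalfSpace (2 * n)) M] where
  J : ∀ x : M, Tan n x →ₗ[ℝ] Tan n x
  exists_coord : ∀ p : M, ∃ (U : Set M) (z : M → Fin n → ℂ), p ∈ U ∧ IsHolCoord J U z

section Structures

variable {n : ℕ} [NeZero n] {M : Type*} [TopologicalSpace M]
  [ChartedSpace (EuclideanHalfSpace (2 * n)) M]

/-- Some holomorphic coordinates near `p`. They are only used to evaluate at `p` expressions
that do not depend on the choice of holomorphic coordinates. -/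
def ComplexStructure.coordAt (𝒥 : ComplexStructure n M) (p : M) : M → Fin n → ℂ :=
  (𝒥.exists_coord p).choose_spec.choose

theorem ComplexStructure.coordAt_spec (𝒥 : ComplexStructure n M) (p : M) :
    ∃ U : Set M, p ∈ U ∧ IsHolCoord 𝒥.J U (𝒥.coordAt p) :=
  ⟨_, (𝒥.exists_coord p).choose_spec.choose_spec⟩

/-- A smooth real `(1,1)` form on `M`: a real `2`-form that is invariant under `J` and has smooth
components in holomorphic coordinates. -/
structure RealOneOneForm (𝒥 : ComplexStructure n M) where
  form : ∀ x : M, (Tan n x) [⋀^Fin 2]→ₗ[ℝ] ℝ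
  invariant : ∀ (x : M) (v w : Tan n x), form x ![𝒥.J x v, 𝒥.J x w] = form x ![v, w]
  smooth : ∀ (U : Set M) (z : M → Fin n → ℂ), IsHolCoord 𝒥.J U z → ∀ i j : Fin n,
    ContMDiffOn (𝓡∂ (2 * n)) 𝓘(ℝ, ℂ) ∞ (fun x => components form z x i j) U

variable {𝒥 : ComplexStructure n M}

/-- The matrix `α_{i j̄}` at `x` in the coordinates `coordAt x`. -/
def RealOneOneForm.matrixAt (α : RealOneOneForm 𝒥) (x : M) : Matrix (Fin n) (Fin n) ℂ :=
  components α.form (𝒥.coordAt x) x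

/-- A Hermitian metric, given by its fundamental form `ω = (√-1/2) ∑ g_{i j̄} dzᵢ ∧ dz̄ⱼ`: a smooth
real `(1,1)` form that is positive at every point. -/
structure HermitianMetric (𝒥 : ComplexStructure n M) extends RealOneOneForm 𝒥 where
  pos : ∀ x : M, (toRealOneOneForm.matrixAt x).PosDef

/-- The matrix `g_{i j̄}` at `x` in the coordinates `coordAt x`. -/
def HermitianMetric.g (Ω : HermitianMetric 𝒥) (x : M) : Matrix (Fin n) (Fin n) ℂ :=
  Ω.toRealOneOneForm.matrixAt x

/-- The matrix `χ_{i j̄} + u_{i j̄}` at `x`, in the coordinates `coordAt x`, of the form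
`χ_u = χ + (√-1/2) ∂∂̄u`. -/
def chiMatrix (χ : RealOneOneForm 𝒥) (u : M → ℝ) (x : M) : Matrix (Fin n) (Fin n) ℂ :=
  χ.matrixAt x + complexHessian (𝒥.coordAt x) u x

/-- The exterior form `χ_u = χ + (√-1/2) ∂∂̄u` at `x`. -/
def chiForm (χ : RealOneOneForm 𝒥) (u : M → ℝ) (x : M) : Forms n x :=
  formOf (𝒥.coordAt x) x (chiMatrix χ u x)

/-- The exterior form `ω` at `x`. -/
def HermitianMetric.extForm (Ω : HermitianMetric 𝒥) (x : M) : Forms n x :=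
  formOf (𝒥.coordAt x) x (Ω.g x)

/-- `χ_uⁿ = ψ χ_uⁿ⁻¹ ∧ ω` and `χ_u > 0` on `M`. -/
def IsSolution (Ω : HermitianMetric 𝒥) (χ : RealOneOneForm 𝒥) (ψ u : M → ℝ) : Prop :=
  ∀ x : M, (chiMatrix χ u x).PosDef ∧
    chiForm χ u x ^ n = (ψ x : ℂ) • (chiForm χ u x ^ (n - 1) * Ω.extForm x)

/-- `χ_vⁿ ≥ ψ χ_vⁿ⁻¹ ∧ ω` and `χ_v > 0` on `M`. The inequality between real forms of top degree
means that the difference is a nonnegative multiple of the volume form `ωⁿ`. -/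
def IsSubsolution (Ω : HermitianMetric 𝒥) (χ : RealOneOneForm 𝒥) (ψ v : M → ℝ) : Prop :=
  ∀ x : M, (chiMatrix χ v x).PosDef ∧
    ∃ t : ℝ, 0 ≤ t ∧
      chiForm χ v x ^ n - (ψ x : ℂ) • (chiForm χ v x ^ (n - 1) * Ω.extForm x)
        = (t : ℂ) • Ω.extForm x ^ n

/-- `χ_v ≥ ε ω` on `M`. -/
def LowerBound (Ω : HermitianMetric 𝒥) (χ : RealOneOneForm 𝒥) (v : M → ℝ) (ε : ℝ) : Prop :=
  ∀ x : M, (chiMatrix χ v x - (ε : ℂ) • Ω.g x).PosSemidef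

/-- `|∇u| = (∑ g^{i j̄} uᵢ u_j̄)^{1/2}` at `x`, where `g^{i j̄}` is the `(j, i)` entry of the inverse
of the matrix `g_{i j̄}`, so that `∑ⱼ g^{i j̄} g_{k j̄} = δᵢₖ`. -/
def gradNorm (Ω : HermitianMetric 𝒥) (u : M → ℝ) (x : M) : ℝ :=
  Real.sqrt (∑ i, ∑ j, (Ω.g x)⁻¹ j i * partialZ (𝒥.coordAt x) i (fun y => (u y : ℂ)) x
    * partialZbar (𝒥.coordAt x) j (fun y => (u y : ℂ)) x).re

/-- The Laplacian `Δu = ∑ g^{i j̄} u_{i j̄}` of the Chern connection (the sum is a real number). -/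
def laplacian (Ω : HermitianMetric 𝒥) (u : M → ℝ) (x : M) : ℝ :=
  (∑ i, ∑ j, (Ω.g x)⁻¹ j i * complexHessian (𝒥.coordAt x) u x i j).re

/-- A finite cover of `M` by compact sets, each contained in the domain of a system of holomorphic
coordinates. It serves to fix a `C²` norm on `M`. -/
structure CoordCover (𝒥 : ComplexStructure n M) where
  N : ℕ
  K : Fin N → Set M
  U : Fin N → Set M
  z : Fin N → M → Fin n → ℂ
  isCompact : ∀ k, IsCompact (K k)
  subset : ∀ k, K k ⊆ U k
  isHolCoord : ∀ k, IsHolCoord 𝒥.J (U k) (z k)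
  covers : ∀ x : M, ∃ k, x ∈ K k

/-- `|f|_{C²(M)} ≤ B` for a real function, in the norm fixed by the cover. -/
def CoordCover.C2Bound (𝒜 : CoordCover 𝒥) (f : M → ℝ) (B : ℝ) : Prop :=
  ∀ k, C2BoundOn (𝒜.z k) (𝒜.K k) (fun x => (f x : ℂ)) B

/-- `|α|_{C²(M)} ≤ B` for a real `(1,1)` form, in the norm fixed by the cover. -/
def CoordCover.C2BoundForm (𝒜 : CoordCover 𝒥) (α : RealOneOneForm 𝒥) (B : ℝ) : Prop :=
  ∀ k, ∀ i j : Fin n,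
    C2BoundOn (𝒜.z k) (𝒜.K k) (fun x => components α.form (𝒜.z k) x i j) B

end Structures

end HermitianMA

end

open HermitianMA

/-! Write X for the matrix of χ_u and G for that of ω. Diagonalizing X and G simultaneously turns
the equation between forms of top degree into the scalar equation tr(X⁻¹G) = n/ψ, and the
subsolution condition into tr(χ_v⁻¹G) ≤ n/ψ, where v denotes the subsolution. Near a given point p
take holomorphic coordinates with G(p) = 1 and X(p) = diag(λ_i). Then Σ 1/λ_i = n/ψ is bounded, so
the λ_i are bounded below, and up to sign the linearized operator at p is L f = Σ λ_i⁻² f_{i ī}.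

Both estimates come from the maximum principle for w · exp(exp(Aτ)), with τ = v − u + const ≥ 0 and
w = tr_ω χ_u or w = |∇u|². Two facts carry the argument.

(1) With s = w⁻¹ (Σ λ_i⁻² |w_i|²)^{1/2} one has Lw / w ≥ s² − C(1 + s); for w = |∇u|² this holds
where w ≥ 1. For the trace, differentiating the equation twice produces T = Σ |∂_k X_{ab}|² / (λ_a²
λ_b). Up to controlled errors w_i is Σ_k ∂_k X_{ik}, and Cauchy–Schwarz gives Σ λ_i⁻² |w_i|² ≤ wT,
with constant exactly 1. For the gradient, T is replaced by Σ λ_i⁻² |u_{ki}|² and the equation is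
differentiated once. The torsion of ω and the derivatives of χ and ψ enter only the error terms. See
`trace_log_bound`, `grad_log_bound`.

(2) Convexity of X ↦ tr X⁻¹ gives Lτ ≥ Σ 1/λ_i − tr χ_v⁻¹ ≥ 0. Treating a single index m separately
gives Lτ ≥ 1/K − 2/λ_m, where K bounds the diagonal entries of χ_v. Hence Lτ ≥ 1/(2K) as soon as
some λ_m exceeds 4K. See `linearized_lower_bound`.

At an interior maximum the first and second order conditions, combined with (1), leave A²σ² − C(1 +
Aσ) + A Lτ ≤ 0, where σ² = Σ λ_i⁻² |τ_i|² (`linearized_le_of_isLocalMax`). By (2) a large A excludes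
λ_m > 4K and also forces σ ≤ C + 1. The eigenvalue bound controls the trace. The two bounds together
control the gradient, because |τ_i| ≤ λ_i σ. Neither estimate uses the other. The value of w at the
maximum point of the auxiliary function controls w on M, because τ ranges over an interval bounded
in terms of the oscillation of u and the bound for v. -/

noncomputable section

namespace HermitianMA

set_option linter.unusedSectionVars false

/-! ### Linear algebra for coordinate derivatives -/

section Inverse

variable {E E' F G : Type*} [AddCommGroup E] [AddCommGroup E'] [AddCommGroup F] [AddCommGroup G]
  [Module ℝ E] [Module ℝ E'] [Module ℝ F] [Module ℝ G] [TopologicalSpace E] [TopologicalSpace E']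
  [TopologicalSpace F] [TopologicalSpace G]

/-- A coordinate derivative is df ∘ (dz)⁻¹. In a chart df and dz acquire the same right factor, the
differential of the chart, and this factor cancels. -/
theorem comp_apply_inverse_comp_of_right (L : E' →L[ℝ] F) (K : E' →L[ℝ] G) (T : E →L[ℝ] E')
    (hT : T.IsInvertible) (a : G) : (L.comp T) ((K.comp T).inverse a) = L (K.inverse a) := by
  obtain ⟨e, rfl⟩ := hT
  simp

theorem isInvertible_of_comp_right {K : E' →L[ℝ] G} {T : E →L[ℝ] E'}
    (hT : T.IsInvertible) (hKT : (K.comp T).IsInvertible) : K.IsInvertible := by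
  obtain ⟨e, rfl⟩ := hT
  obtain ⟨e2, he2⟩ := hKT
  refine ⟨e.symm.trans e2, ?_⟩
  ext v : 1
  have := congrArg (fun T => T (e.symm v)) he2
  simpa using this

end Inverse

/-! ### Holomorphic coordinates and their derivatives in a boundary chart -/

section CoordinateDerivatives

variable {n : ℕ} [NeZero n] {M : Type*} [TopologicalSpace M]
  [ChartedSpace (EuclideanHalfSpace (2 * n)) M]
  {J : ∀ x : M, Tan n x →ₗ[ℝ] Tan n x} {U : Set M} {z : M → Fin n → ℂ}

/-- A complex function of class `C^k` on the set `U`. -/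
abbrev CkOn (n : ℕ) [NeZero n] {M : Type*} [TopologicalSpace M]
    [ChartedSpace (EuclideanHalfSpace (2 * n)) M] (k : WithTop ℕ∞) (f : M → ℂ) (U : Set M) : Prop :=
  ContMDiffOn (𝓡∂ (2 * n)) 𝓘(ℝ, ℂ) k f U

theorem IsHolCoord.mono (h : IsHolCoord J U z) {V : Set M} (hV : IsOpen V) (hVU : V ⊆ U) :
    IsHolCoord J V z :=
  ⟨hV, h.contMDiffOn.mono hVU, h.injOn.mono hVU, fun x hx => h.bijective x (hVU hx),
    fun x hx => h.map_J x (hVU hx)⟩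

theorem IsHolCoord.mdifferentiableAt (h : IsHolCoord J U z) {x : M} (hx : x ∈ U) :
    MDifferentiableAt (𝓡∂ (2 * n)) 𝓘(ℝ, Fin n → ℂ) z x :=
  (h.contMDiffOn.contMDiffAt (h.isOpen.mem_nhds hx)).mdifferentiableAt (by simp)

theorem CkOn.mdifferentiableAt {k : WithTop ℕ∞} {f : M → ℂ} (h : CkOn n k f U) (hU : IsOpen U)
    (hk : 1 ≤ k) {x : M} (hx : x ∈ U) : MDifferentiableAt (𝓡∂ (2 * n)) 𝓘(ℝ, ℂ) f x :=
  (h.contMDiffAt (hU.mem_nhds hx)).mdifferentiableAt (by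
    rintro rfl; simp at hk)

theorem IsHolCoord.isInvertible (h : IsHolCoord J U z) {x : M} (hx : x ∈ U) :
    (dCoord z x).IsInvertible := by
  have hb := h.bijective x hx
  have : FiniteDimensional ℝ (Tan n x) :=
    inferInstanceAs (FiniteDimensional ℝ (EuclideanSpace ℝ (Fin (2 * n))))
  have : T2Space (Tan n x) := inferInstanceAs (T2Space (EuclideanSpace ℝ (Fin (2 * n))))
  refine ⟨(LinearEquiv.ofBijective (dCoord z x : Tan n x →ₗ[ℝ] (Fin n → ℂ)) hb).toContinuousLinearEquiv, ?_⟩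
  ext v
  rfl

theorem IsHolCoord.dCoord_coordVec (h : IsHolCoord J U z) {x : M} (hx : x ∈ U) (a : Fin n → ℂ) :
    dCoord z x (coordVec z x a) = a := by
  obtain ⟨e, he⟩ := h.isInvertible hx
  rw [coordVec, ← he, ContinuousLinearMap.inverse_equiv]
  simp

theorem IsHolCoord.coordVec_dCoord (h : IsHolCoord J U z) {x : M} (hx : x ∈ U) (v : Tan n x) :
    coordVec z x (dCoord z x v) = v := by
  obtain ⟨e, he⟩ := h.isInvertible hx
  rw [coordVec, ← he, ContinuousLinearMap.inverse_equiv]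
  simp

theorem IsHolCoord.J_coordVec (h : IsHolCoord J U z) {x : M} (hx : x ∈ U) (a : Fin n → ℂ) :
    J x (coordVec z x a) = coordVec z x (Complex.I • a) := by
  rw [← h.coordVec_dCoord hx (J x _), h.map_J x hx, h.dCoord_coordVec hx]

/-- `mfderiv` at `x` refers to the preferred chart at `x`, which varies with `x`. To differentiate a
second time the derivative is needed in the fixed chart at `p`, for all nearby `x`. At boundary
points it is the derivative within the half-space. -/
theorem mfderiv_eq_fderivWithin_chart [IsManifold (𝓡∂ (2 * n)) ∞ M] {F : Type*} [NormedAddCommGroup F] [NormedSpace ℝ F]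
    {f : M → F} {p x : M} (hx : x ∈ (chartAt (EuclideanHalfSpace (2 * n)) p).source)
    (hf : MDifferentiableAt (𝓡∂ (2 * n)) 𝓘(ℝ, F) f x) :
    (mfderiv (𝓡∂ (2 * n)) 𝓘(ℝ, F) f x : Tan n x →L[ℝ] F) =
      (fderivWithin ℝ (f ∘ (extChartAt (𝓡∂ (2 * n)) p).symm) (range (𝓡∂ (2 * n)))
        (extChartAt (𝓡∂ (2 * n)) p x)).comp
      (mfderiv (𝓡∂ (2 * n)) 𝓘(ℝ, EuclideanSpace ℝ (Fin (2 * n))) (extChartAt (𝓡∂ (2 * n)) p) x) := by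
  have hx' : x ∈ (extChartAt (𝓡∂ (2 * n)) p).source := by rwa [extChartAt_source]
  have hsym : MDifferentiableWithinAt 𝓘(ℝ, EuclideanSpace ℝ (Fin (2 * n))) (𝓡∂ (2 * n))
      (extChartAt (𝓡∂ (2 * n)) p).symm (range (𝓡∂ (2 * n))) (extChartAt (𝓡∂ (2 * n)) p x) :=
    mdifferentiableWithinAt_extChartAt_symm ((extChartAt (𝓡∂ (2 * n)) p).map_source hx')
  have hx2 : (extChartAt (𝓡∂ (2 * n)) p).symm (extChartAt (𝓡∂ (2 * n)) p x) = x :=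
    (extChartAt (𝓡∂ (2 * n)) p).left_inv hx'
  have h1 : MDifferentiableWithinAt 𝓘(ℝ, EuclideanSpace ℝ (Fin (2 * n))) 𝓘(ℝ, F)
      (f ∘ (extChartAt (𝓡∂ (2 * n)) p).symm) (range (𝓡∂ (2 * n))) (extChartAt (𝓡∂ (2 * n)) p x) := by
    refine MDifferentiableAt.comp_mdifferentiableWithinAt (I' := 𝓡∂ (2 * n)) _ ?_ hsym
    rw [hx2]; exact hf
  have hφ := mdifferentiableAt_extChartAt (I := 𝓡∂ (2 * n)) hx
  have h2 : HasMFDerivAt (𝓡∂ (2 * n)) 𝓘(ℝ, F)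
      ((f ∘ (extChartAt (𝓡∂ (2 * n)) p).symm) ∘ extChartAt (𝓡∂ (2 * n)) p) x
      ((mfderivWithin 𝓘(ℝ, EuclideanSpace ℝ (Fin (2 * n))) 𝓘(ℝ, F)
        (f ∘ (extChartAt (𝓡∂ (2 * n)) p).symm) (range (𝓡∂ (2 * n))) (extChartAt (𝓡∂ (2 * n)) p x)).comp
      (mfderiv (𝓡∂ (2 * n)) 𝓘(ℝ, EuclideanSpace ℝ (Fin (2 * n))) (extChartAt (𝓡∂ (2 * n)) p) x)) := by
    rw [← hasMFDerivWithinAt_univ]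
    refine HasMFDerivWithinAt.comp (I' := 𝓘(ℝ, EuclideanSpace ℝ (Fin (2 * n)))) (u := range (𝓡∂ (2 * n)))
      x h1.hasMFDerivWithinAt hφ.hasMFDerivAt.hasMFDerivWithinAt ?_
    intro y _
    simp [extChartAt]
  have h3 : (f ∘ (extChartAt (𝓡∂ (2 * n)) p).symm) ∘ extChartAt (𝓡∂ (2 * n)) p =ᶠ[𝓝 x] f := by
    filter_upwards [extChartAt_source_mem_nhds' (I := 𝓡∂ (2 * n)) hx'] with y hy
    exact congrArg f ((extChartAt (𝓡∂ (2 * n)) p).left_inv hy)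
  have h4 := (h2.congr_of_eventuallyEq h3.symm).mfderiv
  rw [mfderivWithin_eq_fderivWithin] at h4
  exact h4

theorem coordDeriv_eq_chart [IsManifold (𝓡∂ (2 * n)) ∞ M] (h : IsHolCoord J U z) {f : M → ℂ} {p x : M}
    (hx : x ∈ (chartAt (EuclideanHalfSpace (2 * n)) p).source) (hxU : x ∈ U)
    (hf : MDifferentiableAt (𝓡∂ (2 * n)) 𝓘(ℝ, ℂ) f x) (a : Fin n → ℂ) :
    coordDeriv z a f x =
      fderivWithin ℝ (f ∘ (extChartAt (𝓡∂ (2 * n)) p).symm) (range (𝓡∂ (2 * n)))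
        (extChartAt (𝓡∂ (2 * n)) p x)
      ((fderivWithin ℝ (z ∘ (extChartAt (𝓡∂ (2 * n)) p).symm) (range (𝓡∂ (2 * n)))
        (extChartAt (𝓡∂ (2 * n)) p x)).inverse a) := by
  have hinv := isInvertible_mfderiv_extChartAt (I := 𝓡∂ (2 * n)) (x := p) (y := x)
    (by rwa [extChartAt_source])
  rw [coordDeriv, coordVec, dCoord, mfderiv_eq_fderivWithin_chart hx hf,
    mfderiv_eq_fderivWithin_chart hx (h.mdifferentiableAt hxU)]
  exact comp_apply_inverse_comp_of_right _ _ _ hinv a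

theorem isInvertible_fderivWithin_chart [IsManifold (𝓡∂ (2 * n)) ∞ M] (h : IsHolCoord J U z) {p x : M}
    (hx : x ∈ (chartAt (EuclideanHalfSpace (2 * n)) p).source) (hxU : x ∈ U) :
    (fderivWithin ℝ (z ∘ (extChartAt (𝓡∂ (2 * n)) p).symm) (range (𝓡∂ (2 * n)))
        (extChartAt (𝓡∂ (2 * n)) p x)).IsInvertible := by
  have hinv := isInvertible_mfderiv_extChartAt (I := 𝓡∂ (2 * n)) (x := p) (y := x)
    (by rwa [extChartAt_source])
  have h2 := h.isInvertible hxU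
  rw [dCoord, mfderiv_eq_fderivWithin_chart hx (h.mdifferentiableAt hxU)] at h2
  exact isInvertible_of_comp_right hinv h2

end CoordinateDerivatives

theorem two_le_infty : (2 : WithTop ℕ∞) ≤ ∞ := by
  have : ((2 : ℕ∞) : WithTop ℕ∞) ≤ ∞ := by exact_mod_cast le_top
  exact this

theorem one_add_one_le_infty : (1 : WithTop ℕ∞) + 1 ≤ ∞ := by
  rw [one_add_one_eq_two]
  exact two_le_infty

theorem fderivWithin_apply_vec {E F : Type*} [NormedAddCommGroup E] [NormedSpace ℝ E]
    [NormedAddCommGroup F] [NormedSpace ℝ F] {D : E → E →L[ℝ] F} {V : E → E} {s : Set E} {q : E}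
    (hu : UniqueDiffWithinAt ℝ s q) (hD : DifferentiableWithinAt ℝ D s q)
    (hV : DifferentiableWithinAt ℝ V s q) (w : E) :
    fderivWithin ℝ (fun y => D y (V y)) s q w =
      fderivWithin ℝ D s q w (V q) + D q (fderivWithin ℝ V s q w) := by
  rw [fderivWithin_clm_apply hu hD hV]
  simp [add_comm]

theorem coordDeriv_const {n : ℕ} [NeZero n] {M : Type*} [TopologicalSpace M]
    [ChartedSpace (EuclideanHalfSpace (2 * n)) M] {z : M → Fin n → ℂ} (a : Fin n → ℂ) (c : ℂ)
    (x : M) : coordDeriv z a (fun _ => c) x = 0 := by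
  unfold coordDeriv
  rw [mfderiv_const]
  rfl

/-! ### Regularity and symmetry of second coordinate derivatives -/

section Chart

variable {n : ℕ} [NeZero n] {M : Type*} [TopologicalSpace M]
  [ChartedSpace (EuclideanHalfSpace (2 * n)) M] [IsManifold (𝓡∂ (2 * n)) ∞ M]
  {J : ∀ x : M, Tan n x →ₗ[ℝ] Tan n x} {U : Set M} {z : M → Fin n → ℂ}

theorem contDiffWithinAt_chart {F : Type*} [NormedAddCommGroup F] [NormedSpace ℝ F] {f : M → F}
    {k : WithTop ℕ∞} (hU : IsOpen U) (hf : ContMDiffOn (𝓡∂ (2 * n)) 𝓘(ℝ, F) k f U) {p : M}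
    (hp : p ∈ U) :
    ContDiffWithinAt ℝ k (f ∘ (extChartAt (𝓡∂ (2 * n)) p).symm) (range (𝓡∂ (2 * n)))
      (extChartAt (𝓡∂ (2 * n)) p p) := by
  have := (contMDiffAt_iff.1 (hf.contMDiffAt (hU.mem_nhds hp))).2
  exact this

/-- In the chart at `p`, the vector field `coordVec z · a`. -/
def chartVec (z : M → Fin n → ℂ) (p : M) (a : Fin n → ℂ) (y : EuclideanSpace ℝ (Fin (2 * n))) :
    EuclideanSpace ℝ (Fin (2 * n)) :=
  (fderivWithin ℝ (z ∘ (extChartAt (𝓡∂ (2 * n)) p).symm) (range (𝓡∂ (2 * n))) y).inverse a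

/-- Differentiating `z` costs one derivative; inversion is smooth on the invertible operators and
costs none. -/
theorem contDiffWithinAt_chartVec (h : IsHolCoord J U z) {p : M} (hp : p ∈ U) (a : Fin n → ℂ)
    {m : WithTop ℕ∞} (hm : m + 1 ≤ ∞) :
    ContDiffWithinAt ℝ m (chartVec z p a) (range (𝓡∂ (2 * n))) (extChartAt (𝓡∂ (2 * n)) p p) := by
  have hz := contDiffWithinAt_chart h.isOpen h.contMDiffOn hp
  have h1 := hz.fderivWithin_right (m := m) (𝓡∂ (2 * n)).uniqueDiffOn hm (mem_range_self _)
  have hi := isInvertible_fderivWithin_chart h (mem_chart_source _ p) hp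
  have h2 : ContDiffWithinAt ℝ m (fun y => (fderivWithin ℝ (z ∘ (extChartAt (𝓡∂ (2 * n)) p).symm)
      (range (𝓡∂ (2 * n))) y).inverse) (range (𝓡∂ (2 * n))) (extChartAt (𝓡∂ (2 * n)) p p) :=
    hi.contDiffAt_map_inverse.comp_contDiffWithinAt _ h1
  exact h2.clm_apply contDiffWithinAt_const

theorem coordDeriv_eventuallyEq_chart (h : IsHolCoord J U z) {f : M → ℂ} {k : WithTop ℕ∞}
    (hf : CkOn n k f U) (hk : 1 ≤ k) {p : M} (hp : p ∈ U) (a : Fin n → ℂ) :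
    coordDeriv z a f =ᶠ[𝓝 p] (fun y => fderivWithin ℝ (f ∘ (extChartAt (𝓡∂ (2 * n)) p).symm)
      (range (𝓡∂ (2 * n))) y (chartVec z p a y)) ∘ extChartAt (𝓡∂ (2 * n)) p := by
  filter_upwards [(chartAt (EuclideanHalfSpace (2 * n)) p).open_source.mem_nhds
    (mem_chart_source _ p), h.isOpen.mem_nhds hp] with x hx hxU
  exact coordDeriv_eq_chart h hx hxU (hf.mdifferentiableAt h.isOpen hk hxU) a

theorem CkOn.coordDeriv (h : IsHolCoord J U z) {f : M → ℂ} {m k : WithTop ℕ∞}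
    (hf : CkOn n k f U) (hmk : m + 1 ≤ k) (hm : m + 1 ≤ ∞) (a : Fin n → ℂ) :
    CkOn n m (coordDeriv z a f) U := by
  intro p hp
  have hk : 1 ≤ k := le_trans (by simp) hmk
  apply ContMDiffAt.contMDiffWithinAt
  refine ContMDiffAt.congr_of_eventuallyEq ?_ (coordDeriv_eventuallyEq_chart h hf hk hp a)
  have h1 := (contDiffWithinAt_chart h.isOpen hf hp).fderivWithin_right (m := m)
    (𝓡∂ (2 * n)).uniqueDiffOn hmk (mem_range_self _)
  have h2 := (h1.clm_apply (contDiffWithinAt_chartVec h hp a hm)).contMDiffWithinAt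
  have h3 : ContMDiffAt (𝓡∂ (2 * n)) 𝓘(ℝ, EuclideanSpace ℝ (Fin (2 * n))) m
      (extChartAt (𝓡∂ (2 * n)) p) p :=
    (contMDiffAt_extChartAt (n := ∞)).of_le (le_trans (by simp) hm)
  refine ContMDiffWithinAt.comp (t := range (𝓡∂ (2 * n))) p h2 h3 ?_
  intro y _
  simp [extChartAt]

theorem coordDeriv_congr {f g : M → ℂ} {x : M} (hfg : f =ᶠ[𝓝 x] g) (z : M → Fin n → ℂ)
    (a : Fin n → ℂ) : HermitianMA.coordDeriv z a f x = HermitianMA.coordDeriv z a g x := by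
  have : (mfderiv (𝓡∂ (2 * n)) 𝓘(ℝ, ℂ) f x : Tan n x →L[ℝ] ℂ) =
    mfderiv (𝓡∂ (2 * n)) 𝓘(ℝ, ℂ) g x := hfg.mfderiv_eq
  exact congrArg (fun T : Tan n x →L[ℝ] ℂ => T (coordVec z x a)) this

/-- The second coordinate derivative in a chart. -/
theorem coordDeriv_coordDeriv_chart (h : IsHolCoord J U z) {f : M → ℂ}
    (hf : CkOn n 2 f U) {p : M} (hp : p ∈ U) (a b : Fin n → ℂ) :
    HermitianMA.coordDeriv z b (HermitianMA.coordDeriv z a f) p =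
      fderivWithin ℝ (fderivWithin ℝ (f ∘ (extChartAt (𝓡∂ (2 * n)) p).symm) (range (𝓡∂ (2 * n))))
        (range (𝓡∂ (2 * n))) (extChartAt (𝓡∂ (2 * n)) p p)
        (chartVec z p b (extChartAt (𝓡∂ (2 * n)) p p))
        (chartVec z p a (extChartAt (𝓡∂ (2 * n)) p p)) +
      fderivWithin ℝ (f ∘ (extChartAt (𝓡∂ (2 * n)) p).symm) (range (𝓡∂ (2 * n)))
        (extChartAt (𝓡∂ (2 * n)) p p)
        (fderivWithin ℝ (chartVec z p a) (range (𝓡∂ (2 * n))) (extChartAt (𝓡∂ (2 * n)) p p)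
          (chartVec z p b (extChartAt (𝓡∂ (2 * n)) p p))) := by
  have hu : UniqueDiffWithinAt ℝ (range (𝓡∂ (2 * n))) (extChartAt (𝓡∂ (2 * n)) p p) :=
    (𝓡∂ (2 * n)).uniqueDiffOn _ (mem_range_self _)
  have h1 := hf.coordDeriv h (m := 1) (by norm_num) one_add_one_le_infty a
  rw [coordDeriv_eq_chart h (mem_chart_source _ p) hp (h1.mdifferentiableAt h.isOpen le_rfl hp) b]
  have h2 := (contDiffWithinAt_chart h.isOpen hf hp).fderivWithin_right (m := 1)
    (𝓡∂ (2 * n)).uniqueDiffOn (by norm_num) (mem_range_self _)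
  have h3 := contDiffWithinAt_chartVec h hp a (m := 1) one_add_one_le_infty
  have h4 : HermitianMA.coordDeriv z a f ∘ (extChartAt (𝓡∂ (2 * n)) p).symm
      =ᶠ[𝓝[range (𝓡∂ (2 * n))] (extChartAt (𝓡∂ (2 * n)) p p)]
      (fun y => fderivWithin ℝ (f ∘ (extChartAt (𝓡∂ (2 * n)) p).symm)
      (range (𝓡∂ (2 * n))) y (chartVec z p a y)) := by
    have h5 := coordDeriv_eventuallyEq_chart h hf (by norm_num) hp a
    have h6 : Filter.Tendsto (extChartAt (𝓡∂ (2 * n)) p).symm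
        (𝓝[range (𝓡∂ (2 * n))] (extChartAt (𝓡∂ (2 * n)) p p)) (𝓝 p) := by
      have := (continuousAt_extChartAt_symm (I := 𝓡∂ (2 * n)) p).tendsto
      rw [(extChartAt (𝓡∂ (2 * n)) p).left_inv (mem_extChartAt_source p)] at this
      exact this.mono_left nhdsWithin_le_nhds
    filter_upwards [h6.eventually h5, extChartAt_target_mem_nhdsWithin (I := 𝓡∂ (2 * n)) p]
      with y hy hyt
    simp only [Function.comp_apply] at hy ⊢
    rw [hy, (extChartAt (𝓡∂ (2 * n)) p).right_inv hyt]
  rw [Filter.EventuallyEq.fderivWithin_eq_of_mem h4 (mem_range_self _)]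
  exact fderivWithin_apply_vec hu (h2.differentiableWithinAt (by norm_num))
    (h3.differentiableWithinAt (by norm_num)) _

theorem CkOn.coord (h : IsHolCoord J U z) (i : Fin n) : CkOn n ∞ (fun x => z x i) U := by
  have := h.contMDiffOn
  rw [contMDiffOn_pi_space] at this
  exact this i

theorem coordDeriv_coord' {z' : M → Fin n → ℂ} {x : M}
    (hz' : MDifferentiableAt (𝓡∂ (2 * n)) 𝓘(ℝ, Fin n → ℂ) z' x) (a : Fin n → ℂ) (i : Fin n) :
    HermitianMA.coordDeriv z a (fun x => z' x i) x = dCoord z' x (coordVec z x a) i := by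
  have h1 : HasMFDerivAt (𝓡∂ (2 * n)) 𝓘(ℝ, ℂ) (fun x => z' x i) x
      ((ContinuousLinearMap.proj (R := ℝ) (φ := fun _ : Fin n => ℂ) i).comp
        (dCoord z' x)) := by
    have h2 : HasMFDerivAt 𝓘(ℝ, Fin n → ℂ) 𝓘(ℝ, ℂ) (fun w : Fin n → ℂ => w i) (z' x)
        (ContinuousLinearMap.proj (R := ℝ) (φ := fun _ : Fin n => ℂ) i) :=
      (ContinuousLinearMap.proj (R := ℝ) (φ := fun _ : Fin n => ℂ) i).hasFDerivAt.hasMFDerivAt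
    exact HasMFDerivAt.comp x h2 hz'.hasMFDerivAt
  unfold HermitianMA.coordDeriv
  rw [h1.mfderiv]
  rfl

theorem coordDeriv_coord (h : IsHolCoord J U z) {x : M} (hx : x ∈ U) (a : Fin n → ℂ) (i : Fin n) :
    HermitianMA.coordDeriv z a (fun x => z x i) x = a i := by
  rw [coordDeriv_coord' (h.mdifferentiableAt hx), h.dCoord_coordVec hx]

theorem fderivWithin_pi_apply_chart (h : IsHolCoord J U z) {p : M} (hp : p ∈ U)
    (w : EuclideanSpace ℝ (Fin (2 * n))) (i : Fin n) :
    fderivWithin ℝ ((fun x => z x i) ∘ (extChartAt (𝓡∂ (2 * n)) p).symm) (range (𝓡∂ (2 * n)))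
      (extChartAt (𝓡∂ (2 * n)) p p) w =
    fderivWithin ℝ (z ∘ (extChartAt (𝓡∂ (2 * n)) p).symm) (range (𝓡∂ (2 * n)))
      (extChartAt (𝓡∂ (2 * n)) p p) w i := by
  have hu : UniqueDiffWithinAt ℝ (range (𝓡∂ (2 * n))) (extChartAt (𝓡∂ (2 * n)) p p) :=
    (𝓡∂ (2 * n)).uniqueDiffOn _ (mem_range_self _)
  have hz := (contDiffWithinAt_chart h.isOpen h.contMDiffOn hp).differentiableWithinAt (by simp)
  have h2 := hasFDerivWithinAt_pi'.1 hz.hasFDerivWithinAt i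
  have h3 := h2.fderivWithin hu
  have : ((fun x => z x i) ∘ (extChartAt (𝓡∂ (2 * n)) p).symm) =
    fun x => (z ∘ (extChartAt (𝓡∂ (2 * n)) p).symm) x i := rfl
  rw [this, h3]
  rfl

/-- In a chart the second coordinate derivative is a Hessian term plus Df applied to the derivative
of one coordinate field along the other. The Hessian is symmetric, also at boundary points, since
the half-space lies in the closure of its interior. The other term is symmetric because coordinate
fields commute. -/
theorem coordDeriv_comm (h : IsHolCoord J U z) {f : M → ℂ} (hf : CkOn n 2 f U) {p : M} (hp : p ∈ U)
    (a b : Fin n → ℂ) :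
    HermitianMA.coordDeriv z a (HermitianMA.coordDeriv z b f) p =
      HermitianMA.coordDeriv z b (HermitianMA.coordDeriv z a f) p := by
  have h2le : (2 : WithTop ℕ∞) ≤ ∞ := two_le_infty
  have hsymm : ∀ {g : M → ℂ}, CkOn n 2 g U → IsSymmSndFDerivWithinAt ℝ
      (g ∘ (extChartAt (𝓡∂ (2 * n)) p).symm) (range (𝓡∂ (2 * n))) (extChartAt (𝓡∂ (2 * n)) p p) := by
    intro g hg
    exact (contDiffWithinAt_chart h.isOpen hg hp).isSymmSndFDerivWithinAt (by simp)
      (𝓡∂ (2 * n)).uniqueDiffOn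
      ((𝓡∂ (2 * n)).range_subset_closure_interior (mem_range_self _)) (mem_range_self _)
  -- The Lie bracket of two coordinate fields vanishes: dz is injective, and the second coordinate
  -- derivatives of each z_i are zero because the first ones are constant.
  have hbr : fderivWithin ℝ (chartVec z p a) (range (𝓡∂ (2 * n))) (extChartAt (𝓡∂ (2 * n)) p p)
          (chartVec z p b (extChartAt (𝓡∂ (2 * n)) p p)) =
      fderivWithin ℝ (chartVec z p b) (range (𝓡∂ (2 * n))) (extChartAt (𝓡∂ (2 * n)) p p)
          (chartVec z p a (extChartAt (𝓡∂ (2 * n)) p p)) := by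
    obtain ⟨e, he⟩ := isInvertible_fderivWithin_chart h (mem_chart_source _ p) hp
    apply e.injective
    have he' : ∀ w, e w = fderivWithin ℝ (z ∘ (extChartAt (𝓡∂ (2 * n)) p).symm)
      (range (𝓡∂ (2 * n))) (extChartAt (𝓡∂ (2 * n)) p p) w := fun w => by rw [← he]; rfl
    rw [he', he']
    funext i
    have hi : CkOn n 2 (fun x => z x i) U := (CkOn.coord h i).of_le h2le
    have h0 : ∀ a b : Fin n → ℂ,
        HermitianMA.coordDeriv z b (HermitianMA.coordDeriv z a (fun x => z x i)) p = 0 := by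
      intro a b
      rw [coordDeriv_congr (g := fun _ => a i), coordDeriv_const]
      filter_upwards [h.isOpen.mem_nhds hp] with x hx
      exact coordDeriv_coord h hx a i
    have h1 := coordDeriv_coordDeriv_chart h hi hp a b
    have h2 := coordDeriv_coordDeriv_chart h hi hp b a
    rw [h0] at h1 h2
    rw [(hsymm hi).eq, fderivWithin_pi_apply_chart h hp] at h1
    rw [fderivWithin_pi_apply_chart h hp] at h2
    exact add_left_cancel (h1.symm.trans h2)
  rw [coordDeriv_coordDeriv_chart h hf hp, coordDeriv_coordDeriv_chart h hf hp, hbr,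
    (hsymm hf).eq]

end Chart

/-! ### First and second derivatives at an interior maximum -/

theorem fderiv_fderiv_nonpos_of_isLocalMax {E : Type*} [NormedAddCommGroup E] [NormedSpace ℝ E]
    {R : E → ℝ} {q : E} (hR : ContDiffAt ℝ 2 R q) (hm : IsLocalMax R q) (V : E) :
    fderiv ℝ (fderiv ℝ R) q V V ≤ 0 := by
  by_contra! hpos
  set ℓ : ℝ → E := fun t => q + t • V with hℓ
  have hℓ0 : ℓ 0 = q := by simp [hℓ]
  have hℓc : Continuous ℓ := by fun_prop
  have hℓd : ∀ t, HasDerivAt ℓ V t := fun t => by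
    have := ((hasDerivAt_id t).smul_const V).const_add q
    rwa [one_smul] at this
  have hdiff : ∀ᶠ y in 𝓝 q, DifferentiableAt ℝ R y :=
    (hR.eventually (by simp)).mono fun y hy => hy.differentiableAt (by norm_num)
  have hev : ∀ᶠ t in 𝓝 (0 : ℝ), DifferentiableAt ℝ R (ℓ t) :=
    hℓc.continuousAt.eventually (by rw [hℓ0]; exact hdiff)
  have hd1 : deriv (R ∘ ℓ) =ᶠ[𝓝 0] fun t => fderiv ℝ R (ℓ t) V := by
    filter_upwards [hev] with t ht
    exact (ht.hasFDerivAt.comp_hasDerivAt t (hℓd t)).deriv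
  have hd2 : DifferentiableAt ℝ (fderiv ℝ R) q :=
    (hR.fderiv_right (m := 1) (by norm_num)).differentiableAt (by norm_num)
  have hdd : deriv (deriv (R ∘ ℓ)) 0 = fderiv ℝ (fderiv ℝ R) q V V := by
    rw [hd1.deriv_eq]
    have h1 : HasDerivAt (fun t => fderiv ℝ R (ℓ t)) (fderiv ℝ (fderiv ℝ R) q V) 0 := by
      have h2 : HasFDerivAt (fderiv ℝ R) (fderiv ℝ (fderiv ℝ R) q) (ℓ 0) := by
        rw [hℓ0]; exact hd2.hasFDerivAt
      exact h2.comp_hasDerivAt 0 (hℓd 0)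
    have h3 := h1.clm_apply (hasDerivAt_const (0 : ℝ) V)
    simpa using h3.deriv
  have hmax : IsLocalMax (R ∘ ℓ) 0 := by
    have := (hℓc.continuousAt (x := 0)).eventually (by rw [hℓ0]; exact hm)
    filter_upwards [this] with t ht
    simpa [hℓ0] using ht
  -- A positive second derivative makes 0 a local minimum of the restriction to the line as well.
  -- The restriction is then locally constant, with second derivative zero, a contradiction.
  have hmin : IsLocalMin (R ∘ ℓ) 0 := by
    refine isLocalMin_of_deriv_deriv_pos (by rw [hdd]; exact hpos) hmax.deriv_eq_zero ?_
    refine ContinuousAt.comp ?_ hℓc.continuousAt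
    rw [hℓ0]; exact hR.continuousAt
  have hconst : R ∘ ℓ =ᶠ[𝓝 0] fun _ => (R ∘ ℓ) 0 := by
    filter_upwards [hmax, hmin] with t h1 h2 using le_antisymm h1 h2
  have h0 : deriv (deriv (R ∘ ℓ)) 0 = 0 := by
    rw [hconst.deriv.deriv_eq]
    simp
  linarith

section MaximumPrinciple

variable {n : ℕ} [NeZero n] {M : Type*} [TopologicalSpace M]
  [ChartedSpace (EuclideanHalfSpace (2 * n)) M] [IsManifold (𝓡∂ (2 * n)) ∞ M]
  {J : ∀ x : M, Tan n x →ₗ[ℝ] Tan n x} {U : Set M} {z : M → Fin n → ℂ}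

/-- At an interior point the half-space is a neighbourhood, so derivatives within it are ordinary
ones. At a critical point the term containing the derivative of the coordinate field drops out, and
a second coordinate derivative is the chart Hessian evaluated on one vector. -/
theorem coordDeriv_of_isLocalMax (h : IsHolCoord J U z) {f : M → ℝ}
    (hf : CkOn n 2 (fun x => (f x : ℂ)) U) {p : M} (hp : p ∈ U)
    (hint : (𝓡∂ (2 * n)).IsInteriorPoint p) (hm : IsLocalMax f p) (a : Fin n → ℂ) :
    coordDeriv z a (fun x => (f x : ℂ)) p = 0 ∧
      (coordDeriv z a (coordDeriv z a fun x => (f x : ℂ)) p).re ≤ 0 := by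
  have hnhds : range (𝓡∂ (2 * n)) ∈ 𝓝 (extChartAt (𝓡∂ (2 * n)) p p) :=
    range_mem_nhds_isInteriorPoint hint
  set q := extChartAt (𝓡∂ (2 * n)) p p with hq
  set F := (fun x => (f x : ℂ)) ∘ (extChartAt (𝓡∂ (2 * n)) p).symm with hF
  set R := f ∘ (extChartAt (𝓡∂ (2 * n)) p).symm with hR
  have hFc : ContDiffAt ℝ 2 F q := (contDiffWithinAt_chart h.isOpen hf hp).contDiffAt hnhds
  have hRc : ContDiffAt ℝ 2 R q := by
    have := Complex.reCLM.contDiff.contDiffAt.comp q hFc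
    exact this
  have hRm : IsLocalMax R q := by
    have h6 : Filter.Tendsto (extChartAt (𝓡∂ (2 * n)) p).symm (𝓝 q) (𝓝 p) := by
      have := (continuousAt_extChartAt_symm (I := 𝓡∂ (2 * n)) p).tendsto
      rwa [(extChartAt (𝓡∂ (2 * n)) p).left_inv (mem_extChartAt_source p)] at this
    filter_upwards [h6.eventually hm] with y hy
    simp only [hR, Function.comp_apply, hq]
    rwa [(extChartAt (𝓡∂ (2 * n)) p).left_inv (mem_extChartAt_source p)]
  have hFR : ∀ᶠ y in 𝓝 q, fderivWithin ℝ F (range (𝓡∂ (2 * n))) y =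
      Complex.ofRealCLM.comp (fderiv ℝ R y) := by
    filter_upwards [hRc.eventually (by simp), eventually_mem_nhds_iff.2 hnhds] with y hy hy2
    rw [fderivWithin_of_mem_nhds hy2]
    exact (Complex.ofRealCLM.hasFDerivAt.comp y
      (hy.differentiableAt (by norm_num)).hasFDerivAt).fderiv
  have h0 : fderivWithin ℝ F (range (𝓡∂ (2 * n))) q = 0 := by
    rw [hFR.self_of_nhds, hRm.fderiv_eq_zero]
    simp
  constructor
  · rw [coordDeriv_eq_chart h (mem_chart_source _ p) hp (hf.mdifferentiableAt h.isOpen (by norm_num) hp)]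
    rw [← hF, ← hq, h0]
    simp
  · rw [coordDeriv_coordDeriv_chart h hf hp, ← hF, ← hq, h0]
    have hd2 : DifferentiableAt ℝ (fderiv ℝ R) q :=
      (hRc.fderiv_right (m := 1) (by norm_num)).differentiableAt (by norm_num)
    have h2 : fderivWithin ℝ (fderivWithin ℝ F (range (𝓡∂ (2 * n)))) (range (𝓡∂ (2 * n))) q =
        fderiv ℝ (fun y => Complex.ofRealCLM.comp (fderiv ℝ R y)) q := by
      rw [fderivWithin_of_mem_nhds hnhds, Filter.EventuallyEq.fderiv_eq hFR]
    have h3 := fderiv_clm_comp (c := fun _ : EuclideanSpace ℝ (Fin (2 * n)) => Complex.ofRealCLM)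
      (differentiableAt_const _) hd2
    rw [h2, h3]
    have := fderiv_fderiv_nonpos_of_isLocalMax hRc hRm (chartVec z p a q)
    simpa using this

end MaximumPrinciple

/-! ### Product, sum, chain and conjugation rules -/

section Rules

variable {n : ℕ} [NeZero n] {M : Type*} [TopologicalSpace M]
  [ChartedSpace (EuclideanHalfSpace (2 * n)) M]
  {U : Set M} {z : M → Fin n → ℂ} {x : M} {f g : M → ℂ}

/-- The differential of a complex function, with values in `ℂ`. -/
def dFun (f : M → ℂ) (x : M) : Tan n x →L[ℝ] ℂ := mfderiv (𝓡∂ (2 * n)) 𝓘(ℝ, ℂ) f x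

theorem coordDeriv_eq_dFun (f : M → ℂ) (x : M) (a : Fin n → ℂ) :
    coordDeriv z a f x = dFun f x (coordVec z x a) := rfl

theorem coordDeriv_comp {F : ℂ → ℂ} {F' : ℂ →L[ℝ] ℂ} (hF : HasFDerivAt F F' (f x))
    (hf : MDifferentiableAt (𝓡∂ (2 * n)) 𝓘(ℝ, ℂ) f x) (a : Fin n → ℂ) :
    coordDeriv z a (fun y => F (f y)) x = F' (coordDeriv z a f x) := by
  have h1 : HasMFDerivAt (𝓡∂ (2 * n)) 𝓘(ℝ, ℂ) (F ∘ f) x (F'.comp _) :=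
    HasMFDerivAt.comp x hF.hasMFDerivAt hf.hasMFDerivAt
  have h2 : dFun (fun y => F (f y)) x =
    F'.comp _ := h1.mfderiv
  exact congrArg (fun T : Tan n x →L[ℝ] ℂ => T (coordVec z x a)) h2

theorem coordDeriv_mul (hf : MDifferentiableAt (𝓡∂ (2 * n)) 𝓘(ℝ, ℂ) f x)
    (hg : MDifferentiableAt (𝓡∂ (2 * n)) 𝓘(ℝ, ℂ) g x) (a : Fin n → ℂ) :
    coordDeriv z a (fun y => f y * g y) x = coordDeriv z a f x * g x + f x * coordDeriv z a g x := by
  have h2 : dFun (fun y => f y * g y) x =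
    f x • dFun g x +
      g x • dFun f x :=
    (hf.hasMFDerivAt.mul hg.hasMFDerivAt).mfderiv
  have := congrArg (fun T : Tan n x →L[ℝ] ℂ => T (coordVec z x a)) h2
  refine Eq.trans this ?_
  change f x * coordDeriv z a g x + g x * coordDeriv z a f x = _
  ring

theorem coordDeriv_add (hf : MDifferentiableAt (𝓡∂ (2 * n)) 𝓘(ℝ, ℂ) f x)
    (hg : MDifferentiableAt (𝓡∂ (2 * n)) 𝓘(ℝ, ℂ) g x) (a : Fin n → ℂ) :
    coordDeriv z a (fun y => f y + g y) x = coordDeriv z a f x + coordDeriv z a g x := by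
  have h2 : dFun (fun y => f y + g y) x =
    dFun f x +
      dFun g x :=
    (hf.hasMFDerivAt.add hg.hasMFDerivAt).mfderiv
  exact congrArg (fun T : Tan n x →L[ℝ] ℂ => T (coordVec z x a)) h2

theorem coordDeriv_smul_dir (r : ℝ) (a : Fin n → ℂ) :
    coordDeriv z (r • a) f x = r * coordDeriv z a f x := by
  simp [coordDeriv_eq_dFun, coordVec]

theorem coordDeriv_conj (hf : MDifferentiableAt (𝓡∂ (2 * n)) 𝓘(ℝ, ℂ) f x) (a : Fin n → ℂ) :
    coordDeriv z a (fun y => (starRingEnd ℂ) (f y)) x = (starRingEnd ℂ) (coordDeriv z a f x) :=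
  coordDeriv_comp (F := starRingEnd ℂ) (F' := Complex.conjCLE) Complex.conjCLE.hasFDerivAt hf a

end Rules

/-! ### Wirtinger operators ∂/∂z_i and ∂/∂z̄_i -/

section Wirtinger

variable {n : ℕ} [NeZero n] {M : Type*} [TopologicalSpace M]
  [ChartedSpace (EuclideanHalfSpace (2 * n)) M]
  {J : ∀ x : M, Tan n x →ₗ[ℝ] Tan n x} {U : Set M} {z : M → Fin n → ℂ} {x : M} {f g : M → ℂ}
  {k : WithTop ℕ∞}

theorem CkOn.mul (hf : CkOn n k f U) (hg : CkOn n k g U) : CkOn n k (fun y => f y * g y) U := by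
  have h : ContDiff ℝ k (fun w : ℂ × ℂ => w.1 * w.2) := contDiff_fst.mul contDiff_snd
  exact h.contMDiff.comp_contMDiffOn (hf.prodMk_space hg)

theorem CkOn.add (hf : CkOn n k f U) (hg : CkOn n k g U) : CkOn n k (fun y => f y + g y) U := by
  have h : ContDiff ℝ k (fun w : ℂ × ℂ => w.1 + w.2) := contDiff_fst.add contDiff_snd
  exact h.contMDiff.comp_contMDiffOn (hf.prodMk_space hg)

theorem CkOn.const (c : ℂ) : CkOn n k (fun _ : M => c) U := contMDiffOn_const

theorem CkOn.sum {ι : Type*} {s : Finset ι} {F : ι → M → ℂ} (h : ∀ i ∈ s, CkOn n k (F i) U) :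
    CkOn n k (fun y => ∑ i ∈ s, F i y) U := by
  classical
  induction s using Finset.induction_on with
  | empty => simpa using CkOn.const 0
  | insert a s ha ih =>
    simp only [Finset.sum_insert ha]
    exact (h a (by simp)).add (ih fun i hi => h i (by simp [hi]))

theorem CkOn.prod {ι : Type*} {s : Finset ι} {F : ι → M → ℂ} (h : ∀ i ∈ s, CkOn n k (F i) U) :
    CkOn n k (fun y => ∏ i ∈ s, F i y) U := by
  classical
  induction s using Finset.induction_on with
  | empty => simpa using CkOn.const 1
  | insert a s ha ih =>
    simp only [Finset.prod_insert ha]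
    exact (h a (by simp)).mul (ih fun i hi => h i (by simp [hi]))

theorem CkOn.conj (hf : CkOn n k f U) : CkOn n k (fun y => (starRingEnd ℂ) (f y)) U :=
  Complex.conjCLE.contDiff.contMDiff.comp_contMDiffOn hf

theorem CkOn.inv (hf : CkOn n k f U) (h0 : ∀ x ∈ U, f x ≠ 0) :
    CkOn n k (fun y => (f y)⁻¹) U := by
  intro x hx
  have h1 : ContMDiffAt 𝓘(ℝ, ℂ) 𝓘(ℝ, ℂ) k (fun w : ℂ => w⁻¹) (f x) :=
    (contDiffAt_inv ℝ (h0 x hx)).contMDiffAt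
  exact h1.comp_contMDiffWithinAt x (hf x hx)

theorem CkOn.comp {F : ℂ → ℂ} (hF : ContDiff ℝ k F) (hf : CkOn n k f U) :
    CkOn n k (fun y => F (f y)) U :=
  hF.contMDiff.comp_contMDiffOn hf

theorem CkOn.congr (hf : CkOn n k f U) (h : ∀ x ∈ U, g x = f x) : CkOn n k g U :=
  ContMDiffOn.congr hf h

/-- `½ (∂f/∂xᵢ + c ∂f/∂yᵢ)`; for `c = ∓√-1` this is `∂f/∂zᵢ`, `∂f/∂z̄ᵢ`. -/
def wirt (z : M → Fin n → ℂ) (c : ℂ) (i : Fin n) (f : M → ℂ) (x : M) : ℂ :=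
  (1 / 2) * (coordDeriv z (Pi.single i 1) f x + c * coordDeriv z (Pi.single i Complex.I) f x)

theorem partialZ_eq_wirt (z : M → Fin n → ℂ) (i : Fin n) : partialZ z i = wirt z (-Complex.I) i := by
  funext f x
  simp only [partialZ, wirt]
  ring

theorem partialZbar_eq_wirt (z : M → Fin n → ℂ) (i : Fin n) :
    partialZbar z i = wirt z Complex.I i := rfl

theorem wirt_mul (hU : IsOpen U) (hf : CkOn n k f U) (hg : CkOn n k g U) (hk : 1 ≤ k) (hx : x ∈ U)
    (c : ℂ) (i : Fin n) :
    wirt z c i (fun y => f y * g y) x = wirt z c i f x * g x + f x * wirt z c i g x := by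
  have h1 := hf.mdifferentiableAt hU hk hx
  have h2 := hg.mdifferentiableAt hU hk hx
  simp only [wirt, coordDeriv_mul h1 h2]
  ring

theorem wirt_add (hU : IsOpen U) (hf : CkOn n k f U) (hg : CkOn n k g U) (hk : 1 ≤ k) (hx : x ∈ U)
    (c : ℂ) (i : Fin n) :
    wirt z c i (fun y => f y + g y) x = wirt z c i f x + wirt z c i g x := by
  have h1 := hf.mdifferentiableAt hU hk hx
  have h2 := hg.mdifferentiableAt hU hk hx
  simp only [wirt, coordDeriv_add h1 h2]
  ring

theorem wirt_const (c' c : ℂ) (i : Fin n) : wirt z c i (fun _ => c') x = 0 := by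
  simp [wirt, coordDeriv_const]

theorem wirt_const_mul (hU : IsOpen U) (hf : CkOn n k f U) (hk : 1 ≤ k) (hx : x ∈ U)
    (a c : ℂ) (i : Fin n) :
    wirt z c i (fun y => a * f y) x = a * wirt z c i f x := by
  rw [wirt_mul hU (CkOn.const a) hf hk hx, wirt_const]
  ring

theorem wirt_sum {ι : Type*} {s : Finset ι} {F : ι → M → ℂ} (hU : IsOpen U)
    (h : ∀ i ∈ s, CkOn n k (F i) U) (hk : 1 ≤ k) (hx : x ∈ U) (c : ℂ) (i : Fin n) :
    wirt z c i (fun y => ∑ l ∈ s, F l y) x = ∑ l ∈ s, wirt z c i (F l) x := by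
  classical
  induction s using Finset.induction_on with
  | empty => simp [wirt_const]
  | insert a s ha ih =>
    simp only [Finset.sum_insert ha]
    rw [wirt_add hU (h a (by simp)) (CkOn.sum fun i hi => h i (by simp [hi])) hk hx,
      ih fun i hi => h i (by simp [hi])]

theorem wirt_conj (hU : IsOpen U) (hf : CkOn n k f U) (hk : 1 ≤ k) (hx : x ∈ U)
    (c : ℂ) (i : Fin n) :
    wirt z c i (fun y => (starRingEnd ℂ) (f y)) x =
      (starRingEnd ℂ) (wirt z ((starRingEnd ℂ) c) i f x) := by
  have h1 := hf.mdifferentiableAt hU hk hx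
  simp only [wirt, coordDeriv_conj h1]
  simp only [map_mul, map_add, map_div₀, map_one, map_ofNat, Complex.conj_conj]

theorem wirt_congr (hfg : ∀ᶠ y in 𝓝 x, f y = g y) (c : ℂ) (i : Fin n) :
    wirt z c i f x = wirt z c i g x := by
  have h : ∀ a : Fin n → ℂ, coordDeriv z a f x = coordDeriv z a g x := by
    intro a
    have : dFun (n := n) f x = dFun g x := Filter.EventuallyEq.mfderiv_eq hfg
    rw [coordDeriv_eq_dFun, coordDeriv_eq_dFun, this]
  simp only [wirt, h]

theorem wirt_congr_on (hU : IsOpen U) (hfg : ∀ y ∈ U, f y = g y) (hx : x ∈ U) (c : ℂ) (i : Fin n) :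
    wirt z c i f x = wirt z c i g x :=
  wirt_congr ((hU.eventually_mem hx).mono fun y hy => hfg y hy) c i

variable [IsManifold (𝓡∂ (2 * n)) ∞ M]

theorem CkOn.wirt (h : IsHolCoord J U z) {m : WithTop ℕ∞} (hf : CkOn n k f U) (hmk : m + 1 ≤ k)
    (hm : m + 1 ≤ ∞) (c : ℂ) (i : Fin n) : CkOn n m (wirt z c i f) U := by
  unfold HermitianMA.wirt
  exact (CkOn.const _).mul ((hf.coordDeriv h hmk hm _).add
    ((CkOn.const _).mul (hf.coordDeriv h hmk hm _)))

theorem CkOn.wirt_two (h : IsHolCoord J U z) (hf : CkOn n 2 f U) (c : ℂ) (i : Fin n) :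
    CkOn n 1 (HermitianMA.wirt z c i f) U :=
  hf.wirt h (by norm_num) one_add_one_le_infty c i

theorem coordDeriv_wirt (h : IsHolCoord J U z) (hf : CkOn n 2 f U) (hx : x ∈ U) (c : ℂ) (i : Fin n)
    (a : Fin n → ℂ) : HermitianMA.coordDeriv z a (HermitianMA.wirt z c i f) x =
      (1 / 2) * (HermitianMA.coordDeriv z a (HermitianMA.coordDeriv z (Pi.single i 1) f) x +
        c * HermitianMA.coordDeriv z a (HermitianMA.coordDeriv z (Pi.single i Complex.I) f) x) := by
  have hd : ∀ b, CkOn n 1 (HermitianMA.coordDeriv z b f) U := fun b =>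
    hf.coordDeriv h (by norm_num) one_add_one_le_infty b
  have hm : ∀ {F : M → ℂ}, CkOn n 1 F U → MDifferentiableAt (𝓡∂ (2 * n)) 𝓘(ℝ, ℂ) F x :=
    fun hF => hF.mdifferentiableAt h.isOpen le_rfl hx
  unfold HermitianMA.wirt
  rw [coordDeriv_mul (hm (CkOn.const _)) (hm ((hd _).add ((CkOn.const _).mul (hd _)))),
    coordDeriv_add (hm (hd _)) (hm ((CkOn.const _).mul (hd _))),
    coordDeriv_mul (hm (CkOn.const _)) (hm (hd _)), coordDeriv_const, coordDeriv_const]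
  ring

theorem wirt_comm (h : IsHolCoord J U z) (hf : CkOn n 2 f U) (hx : x ∈ U) (c c' : ℂ)
    (i j : Fin n) : HermitianMA.wirt z c i (HermitianMA.wirt z c' j f) x =
      HermitianMA.wirt z c' j (HermitianMA.wirt z c i f) x := by
  rw [HermitianMA.wirt, HermitianMA.wirt.eq_def z c' j, coordDeriv_wirt h hf hx, coordDeriv_wirt h hf hx,
    coordDeriv_wirt h hf hx, coordDeriv_wirt h hf hx,
    coordDeriv_comm h hf hx (Pi.single j 1), coordDeriv_comm h hf hx (Pi.single j 1),
    coordDeriv_comm h hf hx (Pi.single j Complex.I) (Pi.single i 1),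
    coordDeriv_comm h hf hx (Pi.single j Complex.I) (Pi.single i Complex.I)]
  ring

theorem wirt_wirt_mul (h : IsHolCoord J U z) (hf : CkOn n 2 f U) (hg : CkOn n 2 g U) (hx : x ∈ U)
    (c c' : ℂ) (i j : Fin n) :
    HermitianMA.wirt z c i (HermitianMA.wirt z c' j fun y => f y * g y) x =
      HermitianMA.wirt z c i (HermitianMA.wirt z c' j f) x * g x
      + HermitianMA.wirt z c' j f x * HermitianMA.wirt z c i g x
      + HermitianMA.wirt z c i f x * HermitianMA.wirt z c' j g x
      + f x * HermitianMA.wirt z c i (HermitianMA.wirt z c' j g) x := by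
  have h1 : (1 : WithTop ℕ∞) ≤ 2 := by norm_num
  rw [wirt_congr_on h.isOpen (fun y hy => wirt_mul h.isOpen hf hg h1 hy c' j) hx]
  have hf1 : CkOn n 1 f U := hf.of_le h1
  have hg1 : CkOn n 1 g U := hg.of_le h1
  rw [wirt_add h.isOpen ((hf.wirt_two h c' j).mul hg1) (hf1.mul (hg.wirt_two h c' j)) le_rfl hx,
    wirt_mul h.isOpen (hf.wirt_two h c' j) hg1 le_rfl hx,
    wirt_mul h.isOpen hf1 (hg.wirt_two h c' j) le_rfl hx]
  ring

theorem wirt_wirt_add (h : IsHolCoord J U z) (hf : CkOn n 2 f U) (hg : CkOn n 2 g U) (hx : x ∈ U)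
    (c c' : ℂ) (i j : Fin n) :
    HermitianMA.wirt z c i (HermitianMA.wirt z c' j fun y => f y + g y) x =
      HermitianMA.wirt z c i (HermitianMA.wirt z c' j f) x
      + HermitianMA.wirt z c i (HermitianMA.wirt z c' j g) x := by
  have h1 : (1 : WithTop ℕ∞) ≤ 2 := by norm_num
  rw [wirt_congr_on h.isOpen (fun y hy => wirt_add h.isOpen hf hg h1 hy c' j) hx,
    wirt_add h.isOpen (hf.wirt_two h c' j) (hg.wirt_two h c' j) le_rfl hx]

theorem wirt_wirt_sum {ι : Type*} {s : Finset ι} {F : ι → M → ℂ} (h : IsHolCoord J U z)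
    (hF : ∀ i ∈ s, CkOn n 2 (F i) U) (hx : x ∈ U) (c c' : ℂ) (i j : Fin n) :
    HermitianMA.wirt z c i (HermitianMA.wirt z c' j fun y => ∑ l ∈ s, F l y) x =
      ∑ l ∈ s, HermitianMA.wirt z c i (HermitianMA.wirt z c' j (F l)) x := by
  have h1 : (1 : WithTop ℕ∞) ≤ 2 := by norm_num
  rw [wirt_congr_on h.isOpen (fun y hy => wirt_sum h.isOpen hF h1 hy c' j) hx,
    wirt_sum h.isOpen (fun l hl => (hF l hl).wirt_two h c' j) le_rfl hx]

theorem wirt_wirt_const (h : IsHolCoord J U z) (a c c' : ℂ) (i j : Fin n) (hx : x ∈ U) :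
    HermitianMA.wirt z c i (HermitianMA.wirt z c' j fun _ => a) x = 0 := by
  rw [wirt_congr_on h.isOpen (fun y _ => wirt_const a c' j) hx, wirt_const]

/-- ∂_i ∂̄_i is a quarter of the sum of the pure second derivatives in x_i and y_i; the mixed
derivatives cancel by symmetry. -/
theorem wirt_of_isLocalMax (h : IsHolCoord J U z) {f : M → ℝ}
    (hf : CkOn n 2 (fun x => (f x : ℂ)) U) {p : M} (hp : p ∈ U)
    (hint : (𝓡∂ (2 * n)).IsInteriorPoint p) (hm : IsLocalMax f p) (i : Fin n) :
    HermitianMA.wirt z (-Complex.I) i (fun x => (f x : ℂ)) p = 0 ∧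
      (HermitianMA.wirt z (-Complex.I) i (HermitianMA.wirt z Complex.I i
        fun x => (f x : ℂ)) p).re ≤ 0 := by
  have hd := coordDeriv_of_isLocalMax h hf hp hint hm
  refine ⟨by simp [HermitianMA.wirt, (hd _).1], ?_⟩
  rw [HermitianMA.wirt, coordDeriv_wirt h hf hp, coordDeriv_wirt h hf hp,
    coordDeriv_comm h hf hp (Pi.single i Complex.I) (Pi.single i 1)]
  have h1 := (hd (Pi.single i 1)).2
  have h2 := (hd (Pi.single i Complex.I)).2
  generalize HermitianMA.coordDeriv z (Pi.single i 1) (HermitianMA.coordDeriv z (Pi.single i 1)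
    fun x => (f x : ℂ)) p = A at *
  generalize HermitianMA.coordDeriv z (Pi.single i Complex.I)
    (HermitianMA.coordDeriv z (Pi.single i Complex.I) fun x => (f x : ℂ)) p = B at *
  generalize HermitianMA.coordDeriv z (Pi.single i 1)
    (HermitianMA.coordDeriv z (Pi.single i Complex.I) fun x => (f x : ℂ)) p = D at *
  have : (1 / 2 : ℂ) * (1 / 2 * (A + Complex.I * D) + -Complex.I * (1 / 2 * (D + Complex.I * B))) =
      (1 / 4) * (A + B) := by
    ring_nf
    rw [Complex.I_sq]
    ring
  rw [this]
  have h4 : ((1 / 4 : ℂ) * (A + B)).re = (1 / 4) * (A.re + B.re) := by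
    have : (1 / 4 : ℂ) = ((1 / 4 : ℝ) : ℂ) := by push_cast; ring
    rw [this, Complex.re_ofReal_mul, Complex.add_re]
  rw [h4]
  linarith

end Wirtinger

/-! ### Transformation under changes of holomorphic coordinates -/

section ChangeOfCoordinates

variable {n : ℕ} [NeZero n] {M : Type*} [TopologicalSpace M]
  [ChartedSpace (EuclideanHalfSpace (2 * n)) M]
  {J : ∀ x : M, Tan n x →ₗ[ℝ] Tan n x} {U : Set M} {z z' : M → Fin n → ℂ} {x : M} {f : M → ℂ}

/-- The complex Jacobian matrix `∂z'ₖ/∂zᵢ`. -/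
def jacobian (z z' : M → Fin n → ℂ) (x : M) : Matrix (Fin n) (Fin n) ℂ :=
  Matrix.of fun k i => dCoord z' x (coordVec z x (Pi.single i 1)) k

theorem coordVec_eq_sum (z : M → Fin n → ℂ) (x : M) (b : Fin n → ℂ) :
    coordVec z x b = ∑ k, ((b k).re • coordVec z x (Pi.single k 1) +
      (b k).im • coordVec z x (Pi.single k Complex.I)) := by
  have hb : b = ∑ k, ((b k).re • (Pi.single k 1 : Fin n → ℂ) +
      (b k).im • (Pi.single k Complex.I : Fin n → ℂ)) := by
    funext j
    rw [Finset.sum_apply, Finset.sum_eq_single j]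
    · simp
    · intro k _ hk
      simp [Pi.single_eq_of_ne hk.symm]
    · simp
  conv_lhs => rw [hb]
  simp [coordVec, map_sum]

theorem coordVec_single_change (h' : IsHolCoord J U z') (hx : x ∈ U)
    (i : Fin n) : coordVec z x (Pi.single i 1) =
      ∑ k, ((jacobian z z' x k i).re • coordVec z' x (Pi.single k 1) +
        (jacobian z z' x k i).im • coordVec z' x (Pi.single k Complex.I)) := by
  conv_lhs => rw [← h'.coordVec_dCoord hx (coordVec z x (Pi.single i 1))]
  rw [coordVec_eq_sum]
  rfl

theorem single_I (i : Fin n) :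
    (Pi.single i Complex.I : Fin n → ℂ) = Complex.I • (Pi.single i 1 : Fin n → ℂ) := by
  rw [← Pi.single_smul]
  simp

theorem coordVec_single_I_change (h : IsHolCoord J U z) (h' : IsHolCoord J U z') (hx : x ∈ U)
    (i : Fin n) : coordVec z x (Pi.single i Complex.I) =
      ∑ k, ((jacobian z z' x k i).re • coordVec z' x (Pi.single k Complex.I) -
        (jacobian z z' x k i).im • coordVec z' x (Pi.single k 1)) := by
  conv_lhs => rw [← h'.coordVec_dCoord hx (coordVec z x (Pi.single i Complex.I))]
  rw [single_I, ← h.J_coordVec hx, h'.map_J x hx, coordVec_eq_sum]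
  refine Finset.sum_congr rfl fun k _ => ?_
  have : (Complex.I • dCoord z' x (coordVec z x (Pi.single i 1))) k =
    Complex.I * jacobian z z' x k i := rfl
  rw [this]
  simp [add_comm, sub_eq_add_neg]

theorem partialZ_change (h : IsHolCoord J U z) (h' : IsHolCoord J U z') (hx : x ∈ U)
    (f : M → ℂ) (i : Fin n) :
    partialZ z i f x = ∑ k, jacobian z z' x k i * partialZ z' k f x := by
  simp only [partialZ, coordDeriv_eq_dFun]
  rw [coordVec_single_change h' hx, coordVec_single_I_change h h' hx, map_sum, map_sum,
    Finset.mul_sum, ← Finset.sum_sub_distrib, Finset.mul_sum]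
  refine Finset.sum_congr rfl fun k _ => ?_
  simp only [map_add, map_sub, map_smul, Complex.real_smul]
  conv_rhs => rw [← Complex.re_add_im (jacobian z z' x k i)]
  linear_combination ((1 / 2) * ((jacobian z z' x k i).im : ℂ) *
    dFun f x (coordVec z' x (Pi.single k Complex.I))) * Complex.I_sq

theorem partialZbar_change (h : IsHolCoord J U z) (h' : IsHolCoord J U z') (hx : x ∈ U)
    (f : M → ℂ) (i : Fin n) :
    partialZbar z i f x =
      ∑ k, (starRingEnd ℂ) (jacobian z z' x k i) * partialZbar z' k f x := by
  simp only [partialZbar, coordDeriv_eq_dFun]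
  rw [coordVec_single_change h' hx, coordVec_single_I_change h h' hx, map_sum, map_sum,
    Finset.mul_sum, ← Finset.sum_add_distrib, Finset.mul_sum]
  refine Finset.sum_congr rfl fun k _ => ?_
  simp only [map_add, map_sub, map_smul, Complex.real_smul]
  conv_rhs => rw [← Complex.re_add_im (jacobian z z' x k i)]
  simp only [map_add, map_mul, Complex.conj_ofReal, Complex.conj_I]
  linear_combination ((1 / 2) * ((jacobian z z' x k i).im : ℂ) *
    dFun f x (coordVec z' x (Pi.single k Complex.I))) * Complex.I_sq

/-- The Hermitian form attached to a real `2`-form invariant under `J`. -/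
def hermForm (α : (Tan n x) [⋀^Fin 2]→ₗ[ℝ] ℝ) (J : Tan n x →ₗ[ℝ] Tan n x) (v w : Tan n x) : ℂ :=
  (α ![v, J w] : ℂ) - Complex.I * (α ![v, w] : ℂ)

theorem alt_swap (α : (Tan n x) [⋀^Fin 2]→ₗ[ℝ] ℝ) (v w : Tan n x) : α ![v, w] = -α ![w, v] := by
  have := α.map_swap ![w, v] (i := 0) (j := 1) (by decide)
  rw [← this]
  congr 1
  funext i
  fin_cases i <;> simp

theorem alt_add_left (α : (Tan n x) [⋀^Fin 2]→ₗ[ℝ] ℝ) (v v' w : Tan n x) :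
    α ![v + v', w] = α ![v, w] + α ![v', w] := by
  have hc : ∀ t, Function.update ![v, w] 0 t = ![t, w] := fun t => by
    funext i; fin_cases i <;> simp
  have h0 := α.map_update_add ![v, w] 0 v v'
  rwa [hc, hc, hc] at h0

theorem alt_smul_left (α : (Tan n x) [⋀^Fin 2]→ₗ[ℝ] ℝ) (r : ℝ) (v w : Tan n x) :
    α ![r • v, w] = r * α ![v, w] := by
  have hc : ∀ t, Function.update ![v, w] 0 t = ![t, w] := fun t => by
    funext i; fin_cases i <;> simp
  have h0 := α.map_update_smul ![v, w] 0 r v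
  rwa [hc, hc] at h0

theorem alt_add_right (α : (Tan n x) [⋀^Fin 2]→ₗ[ℝ] ℝ) (v w w' : Tan n x) :
    α ![v, w + w'] = α ![v, w] + α ![v, w'] := by
  rw [alt_swap, alt_add_left, alt_swap α w, alt_swap α w']
  ring

theorem alt_smul_right (α : (Tan n x) [⋀^Fin 2]→ₗ[ℝ] ℝ) (r : ℝ) (v w : Tan n x) :
    α ![v, r • w] = r * α ![v, w] := by
  rw [alt_swap, alt_smul_left, alt_swap α w]
  ring

/-- `hermForm` as a real bilinear map. -/
def hermFormBilin (α : (Tan n x) [⋀^Fin 2]→ₗ[ℝ] ℝ) (J : Tan n x →ₗ[ℝ] Tan n x) :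
    Tan n x →ₗ[ℝ] Tan n x →ₗ[ℝ] ℂ :=
  LinearMap.mk₂ ℝ (hermForm α J)
    (fun v v' w => by simp only [hermForm, alt_add_left]; push_cast; ring)
    (fun r v w => by simp only [hermForm, alt_smul_left, Complex.real_smul]; push_cast; ring)
    (fun v w w' => by simp only [hermForm, map_add, alt_add_right]; push_cast; ring)
    (fun r v w => by simp only [hermForm, map_smul, alt_smul_right, Complex.real_smul]; push_cast; ring)

theorem IsHolCoord.J_J (h : IsHolCoord J U z) (hx : x ∈ U) (v : Tan n x) : J x (J x v) = -v := by
  apply (h.bijective x hx).1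
  rw [h.map_J x hx, h.map_J x hx, smul_smul, Complex.I_mul_I, map_neg, neg_one_smul]

theorem components_eq_hermForm (h : IsHolCoord J U z) (hx : x ∈ U)
    (α : ∀ x : M, (Tan n x) [⋀^Fin 2]→ₗ[ℝ] ℝ) (i j : Fin n) :
    components α z x i j = hermFormBilin (α x) (J x) (coordVec z x (Pi.single i 1))
      (coordVec z x (Pi.single j 1)) := by
  change _ = hermForm (α x) (J x) _ _
  rw [hermForm, h.J_coordVec hx, ← single_I]
  rfl

/-- Invariance of the 2-form under `J` makes `hermForm` complex linear in the first argument and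
conjugate linear in the second, where √-1 acts as `J`. The rule is then that of a sesquilinear form.
-/
theorem components_change (h : IsHolCoord J U z) (h' : IsHolCoord J U z') (hx : x ∈ U)
    (α : ∀ x : M, (Tan n x) [⋀^Fin 2]→ₗ[ℝ] ℝ)
    (hα : ∀ v w : Tan n x, α x ![J x v, J x w] = α x ![v, w]) :
    components α z x = (jacobian z z' x).transpose * components α z' x *
      (jacobian z z' x).map (starRingEnd ℂ) := by
  have hl : ∀ v w, hermFormBilin (α x) (J x) (J x v) w =
      Complex.I * hermFormBilin (α x) (J x) v w := by
    intro v w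
    change hermForm (α x) (J x) _ _ = _ * hermForm (α x) (J x) _ _
    have h1 : α x ![J x v, w] = - α x ![v, J x w] := by
      rw [← hα, h.J_J hx, ← neg_one_smul ℝ v, alt_smul_left]; ring
    rw [hermForm, hermForm, hα, h1]
    push_cast
    linear_combination (α x ![v, w] : ℂ) * Complex.I_sq
  have hr : ∀ v w, hermFormBilin (α x) (J x) v (J x w) =
      -Complex.I * hermFormBilin (α x) (J x) v w := by
    intro v w
    change hermForm (α x) (J x) _ _ = _ * hermForm (α x) (J x) _ _
    rw [hermForm, hermForm, h.J_J hx, ← neg_one_smul ℝ w, alt_smul_right]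
    push_cast
    linear_combination -(α x ![v, w] : ℂ) * Complex.I_sq
  have hw : ∀ k, coordVec z' x (Pi.single k Complex.I) = J x (coordVec z' x (Pi.single k 1)) := by
    intro k
    rw [h'.J_coordVec hx, ← single_I]
  ext i j
  rw [components_eq_hermForm h hx, coordVec_single_change h' hx, coordVec_single_change h' hx]
  simp only [Matrix.mul_apply, Matrix.transpose_apply, Matrix.map_apply, Finset.sum_mul, map_sum,
    LinearMap.sum_apply]
  refine Finset.sum_congr rfl fun l _ => Finset.sum_congr rfl fun k _ => ?_
  simp only [hw, map_add, map_smul, LinearMap.add_apply, LinearMap.smul_apply, hl, hr,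
    Complex.real_smul, components_eq_hermForm h' hx]
  generalize hermFormBilin (α x) (J x) (coordVec z' x (Pi.single k 1))
    (coordVec z' x (Pi.single l 1)) = H
  conv_rhs => rw [← Complex.re_add_im (jacobian z z' x k i),
    ← Complex.re_add_im (jacobian z z' x l j)]
  simp only [map_add, map_mul, Complex.conj_ofReal, Complex.conj_I]
  ring

variable [IsManifold (𝓡∂ (2 * n)) ∞ M]

theorem jacobian_eq_partialZ (h : IsHolCoord J U z) (h' : IsHolCoord J U z') (hx : x ∈ U)
    (k i : Fin n) : jacobian z z' x k i = partialZ z i (fun y => z' y k) x ∧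
      partialZbar z i (fun y => z' y k) x = 0 := by
  have h1 := h'.mdifferentiableAt hx
  have h2 : ∀ a, coordDeriv z a (fun x => z' x k) x = dCoord z' x (coordVec z x a) k :=
    fun a => coordDeriv_coord' h1 a k
  have h3 : dCoord z' x (coordVec z x (Pi.single i Complex.I)) k =
      Complex.I * jacobian z z' x k i := by
    rw [single_I, ← h.J_coordVec hx, h'.map_J x hx]
    rfl
  have h4 : dCoord z' x (coordVec z x (Pi.single i 1)) k = jacobian z z' x k i := rfl
  simp only [partialZ, partialZbar, h2, h3, h4]
  constructor
  · linear_combination (1 / 2 * jacobian z z' x k i) * Complex.I_sq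
  · linear_combination (1 / 2 * jacobian z z' x k i) * Complex.I_sq

/-- The Jacobian is holomorphic, so ∂_i annihilates its conjugate and no first derivative of `u`
appears. -/
theorem complexHessian_change (h : IsHolCoord J U z) (h' : IsHolCoord J U z') (hx : x ∈ U)
    {u : M → ℝ} (hu : CkOn n 2 (fun y => (u y : ℂ)) U) :
    complexHessian z u x = (jacobian z z' x).transpose * complexHessian z' u x *
      (jacobian z z' x).map (starRingEnd ℂ) := by
  have h1 : (1 : WithTop ℕ∞) ≤ 2 := by norm_num
  have hz2 : ∀ k, CkOn n 2 (fun y => z' y k) U := fun k => (CkOn.coord h' k).of_le two_le_infty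
  have hA : ∀ k i, CkOn n 1 (fun y => jacobian z z' y k i) U := by
    intro k i
    refine CkOn.congr ?_ fun y hy => (jacobian_eq_partialZ h h' hy k i).1
    rw [partialZ_eq_wirt]
    exact (hz2 k).wirt_two h _ _
  -- ∂_i of the conjugate of ∂_j z'_l is the conjugate of ∂̄_i ∂_j z'_l = ∂_j ∂̄_i z'_l = 0.
  have hdA : ∀ i l j, wirt z (-Complex.I) i
      (fun y => (starRingEnd ℂ) (jacobian z z' y l j)) x = 0 := by
    intro i l j
    rw [wirt_conj h.isOpen (hA l j) le_rfl hx, map_neg, Complex.conj_I, neg_neg,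
      wirt_congr_on h.isOpen (fun y hy => (jacobian_eq_partialZ h h' hy l j).1) hx,
      partialZ_eq_wirt, wirt_comm h (hz2 l) hx,
      ← partialZbar_eq_wirt,
      wirt_congr_on h.isOpen (fun y hy => (jacobian_eq_partialZ h h' hy l i).2) hx, wirt_const,
      map_zero]
  ext i j
  simp only [complexHessian, Matrix.of_apply, Matrix.mul_apply, Matrix.transpose_apply,
    Matrix.map_apply]
  rw [partialZ_eq_wirt, wirt_congr_on h.isOpen
    (fun y hy => partialZbar_change h h' hy (fun y => (u y : ℂ)) j) hx]
  have hu' : ∀ k, CkOn n 1 (partialZbar z' k fun y => (u y : ℂ)) U := fun k => hu.wirt_two h' _ _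
  rw [wirt_sum h.isOpen (k := 1) (fun l _ => (hA l j).conj.mul (hu' l)) le_rfl hx]
  refine Finset.sum_congr rfl fun l _ => ?_
  rw [wirt_mul h.isOpen (hA l j).conj (hu' l) le_rfl hx, hdA, ← partialZ_eq_wirt,
    partialZ_change h h' hx, zero_mul, zero_add, mul_comm]

end ChangeOfCoordinates

/-! ### Simultaneous diagonalization of Hermitian forms -/

section SimultaneousDiagonalization

open Matrix

variable {n : ℕ}

open scoped MatrixOrder Matrix.Norms.L2Operator in
theorem exists_eq_conjTranspose_mul_self_of_posDef {G : Matrix (Fin n) (Fin n) ℂ}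
    (hG : G.PosDef) : ∃ C : Matrix (Fin n) (Fin n) ℂ, IsUnit C ∧ G = Cᴴ * C := by
  obtain ⟨C, hC⟩ := CStarAlgebra.nonneg_iff_eq_star_mul_self.mp hG.posSemidef.nonneg
  refine ⟨C, ?_, hC⟩
  have h1 : IsUnit (star C * C) := hC ▸ hG.isUnit
  rw [Matrix.isUnit_iff_isUnit_det, Matrix.det_mul] at h1
  rw [Matrix.isUnit_iff_isUnit_det]
  exact isUnit_of_mul_isUnit_right h1

/-- Simultaneous diagonalization of two positive Hermitian forms. -/
theorem exists_simultaneous_diagonalization {X G : Matrix (Fin n) (Fin n) ℂ} (hX : X.PosDef)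
    (hG : G.PosDef) : ∃ (B : Matrix (Fin n) (Fin n) ℂ) (l : Fin n → ℝ), IsUnit B ∧ (∀ i, 0 < l i) ∧
      X = Bᵀ * diagonal (fun i => (l i : ℂ)) * B.map (starRingEnd ℂ) ∧
      G = Bᵀ * B.map (starRingEnd ℂ) := by
  obtain ⟨C, hC, rfl⟩ := exists_eq_conjTranspose_mul_self_of_posDef hG
  have hCd : IsUnit C.det := (Matrix.isUnit_iff_isUnit_det C).1 hC
  have hCi : IsUnit C⁻¹ := (Matrix.isUnit_nonsing_inv_iff).2 hC
  have hY : ((C⁻¹)ᴴ * X * C⁻¹).PosDef :=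
    hX.conjTranspose_mul_mul_same (mulVec_injective_of_isUnit hCi)
  set Y := (C⁻¹)ᴴ * X * C⁻¹ with hYdef
  have hXY : X = Cᴴ * Y * C := by
    have h2 : Cᴴ * (C⁻¹)ᴴ = 1 := by
      rw [← conjTranspose_mul, nonsing_inv_mul C hCd, conjTranspose_one]
    rw [hYdef]
    calc X = 1 * X * 1 := by simp
      _ = (Cᴴ * (C⁻¹)ᴴ) * X * (C⁻¹ * C) := by rw [h2, nonsing_inv_mul C hCd]
      _ = _ := by simp only [Matrix.mul_assoc]
  set V : Matrix (Fin n) (Fin n) ℂ := (hY.1.eigenvectorUnitary : Matrix (Fin n) (Fin n) ℂ) with hV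
  have hVV : V * Vᴴ = 1 := Unitary.mul_star_self_of_mem hY.1.eigenvectorUnitary.2
  have hVu : IsUnit Vᴴ := by
    rw [Matrix.isUnit_iff_isUnit_det]
    have : (V * Vᴴ).det = 1 := by rw [hVV, det_one]
    rw [det_mul] at this
    exact IsUnit.of_mul_eq_one _ (by rw [mul_comm]; exact this)
  have hspec : Y = V * diagonal (fun i => ((hY.1.eigenvalues i : ℝ) : ℂ)) * Vᴴ := by
    have := hY.1.spectral_theorem
    rw [Unitary.conjStarAlgAut_apply] at this
    exact this
  have hconj : ∀ D : Matrix (Fin n) (Fin n) ℂ, (D.map (starRingEnd ℂ)).map (starRingEnd ℂ) = D := by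
    intro D; ext i j; simp
  have htr : ∀ D : Matrix (Fin n) (Fin n) ℂ, (D.map (starRingEnd ℂ))ᵀ = Dᴴ := by
    intro D; ext i j; simp
  -- With G = CᴴC and C⁻ᴴ X C⁻¹ unitarily diagonalized by V, the matrix VᴴC does both jobs for the
  -- convention BᴴDB. Components a_{i j̄} transform as Bᵀ D B̄ instead, hence the conjugate.
  refine ⟨(Vᴴ * C).map (starRingEnd ℂ), hY.1.eigenvalues, ?_, fun i => hY.eigenvalues_pos i, ?_, ?_⟩
  · have : IsUnit (Vᴴ * C) := hVu.mul hC
    exact this.map (starRingEnd ℂ).mapMatrix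
  · rw [htr, hconj, conjTranspose_mul, conjTranspose_conjTranspose]
    conv_lhs => rw [hXY, hspec]
    simp only [Matrix.mul_assoc]
  · rw [htr, hconj, conjTranspose_mul, conjTranspose_conjTranspose, Matrix.mul_assoc,
      ← Matrix.mul_assoc V, hVV, Matrix.one_mul]

end SimultaneousDiagonalization

/-! ### Powers of sums of commuting elements of square zero -/

section SquareZero

variable {A : Type*} [Ring A] [Algebra ℂ A] {ι : Type*}

theorem commute_add_pow_succ_of_sq_eq_zero {x y : A} (h : Commute x y) (hx : x * x = 0) (k : ℕ) :
    (x + y) ^ (k + 1) = y ^ (k + 1) + ((k + 1 : ℕ) : ℂ) • (x * y ^ k) := by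
  induction k with
  | zero => simp [add_comm]
  | succ k ih =>
    have h1 : y ^ (k + 1) * x = x * y ^ (k + 1) := (h.pow_right (k + 1)).symm.eq
    have h2 : x * y ^ k * x = 0 := by
      rw [mul_assoc, ← (h.pow_right k).eq, ← mul_assoc, hx, zero_mul]
    rw [pow_succ (x + y), ih, add_mul, mul_add, mul_add, smul_mul_assoc, smul_mul_assoc, h1, h2,
      mul_assoc, ← pow_succ, ← pow_succ, smul_zero, zero_add]
    push_cast
    simp only [add_smul, one_smul]
    abel

/-- The sum `∑ λᵢ τᵢ` along a list. -/
def wsum (τ : ι → A) (l : ι → ℂ) (L : List ι) : A := (L.map fun i => l i • τ i).sum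

/-- The elementary symmetric polynomial of degree `|L| - 1`. -/
def esymPred (l : ι → ℂ) : List ι → ℂ
  | [] => 0
  | a :: L => (L.map l).prod + l a * esymPred l L

theorem esymPred_eq {l : ι → ℂ} (hl : ∀ i, l i ≠ 0) (L : List ι) :
    esymPred l L = (L.map l).prod * (L.map fun i => (l i)⁻¹).sum := by
  induction L with
  | nil => simp [esymPred]
  | cons a L ih =>
    simp only [esymPred, ih, List.map_cons, List.prod_cons, List.sum_cons]
    field_simp [hl a]

variable {τ : ι → A} (hc : ∀ i j, τ i * τ j = τ j * τ i) (hs : ∀ i, τ i * τ i = 0)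
include hc

theorem commute_wsum (l m : ι → ℂ) (L : List ι) (a : ι) : Commute (m a • τ a) (wsum τ l L) := by
  induction L with
  | nil => simp [wsum]
  | cons b L ih =>
    have : wsum τ l (b :: L) = l b • τ b + wsum τ l L := by simp [wsum]
    rw [this]
    exact (((show Commute (τ a) (τ b) from hc a b).smul_left _).smul_right _).add_right ih

include hs

/-- Induction on the list: since a new generator has square zero and commutes with the others, only
terms at most linear in it survive in the binomial expansion. -/
theorem wsum_pow (l : ι → ℂ) (L : List ι) :
    wsum τ l L ^ (L.length + 1) = 0 ∧ wsum τ l L ^ L.length =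
      ((L.length.factorial : ℂ) * (L.map l).prod) • (L.map τ).prod := by
  induction L with
  | nil => simp [wsum]
  | cons a L ih =>
    have h0 : wsum τ l (a :: L) = l a • τ a + wsum τ l L := by simp [wsum]
    have hx : (l a • τ a) * (l a • τ a) = 0 := by simp [hs]
    have hcm := commute_wsum hc l l L a
    have hpow := commute_add_pow_succ_of_sq_eq_zero hcm hx
    refine ⟨?_, ?_⟩
    · rw [h0, List.length_cons, hpow, ih.1, pow_succ, ih.1]
      simp
    · rw [h0, List.length_cons, hpow, ih.1, ih.2]
      simp only [List.map_cons, List.prod_cons, zero_add, smul_mul_assoc, mul_smul_comm, smul_smul,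
        Nat.factorial_succ]
      congr 1
      push_cast
      ring

theorem wsum_pow_mul (l : ι → ℂ) (L : List ι) (m : ℕ) (hm : m + 1 = L.length) :
    wsum τ l L ^ m * wsum τ 1 L =
      ((m.factorial : ℂ) * esymPred l L) • (L.map τ).prod := by
  induction L generalizing m with
  | nil => simp at hm
  | cons a L ih =>
    have h0 : ∀ l : ι → ℂ, wsum τ l (a :: L) = l a • τ a + wsum τ l L := fun l => by simp [wsum]
    have hx : (l a • τ a) * (l a • τ a) = 0 := by simp [hs]
    have hcm := commute_wsum hc l l L a
    have hpow := commute_add_pow_succ_of_sq_eq_zero hcm hx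
    have hm' : m = L.length := by simpa using hm
    subst hm'
    -- The product of all generators is annihilated by their sum: with all weights 1, the power of
    -- order |L| is |L|! times that product, and the next power vanishes.
    have hann : wsum τ l L ^ L.length * wsum τ 1 L = 0 := by
      rw [(wsum_pow hc hs l L).2, smul_mul_assoc]
      have : (L.map τ).prod * wsum τ 1 L = 0 := by
        have h1 := (wsum_pow hc hs 1 L)
        have h2 := h1.1
        rw [pow_succ, h1.2, smul_mul_assoc] at h2
        refine (smul_eq_zero.1 h2).resolve_left ?_
        have : (L.map (1 : ι → ℂ)).prod = 1 := by
          apply List.prod_eq_one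
          intro x hx
          obtain ⟨i, _, rfl⟩ := List.mem_map.1 hx
          rfl
        rw [this, mul_one]
        exact_mod_cast Nat.factorial_ne_zero _
      rw [this, smul_zero]
    have hca : wsum τ l L ^ L.length * τ a = τ a * wsum τ l L ^ L.length := by
      have := (commute_wsum hc l 1 L a).pow_right L.length
      simpa using this.eq.symm
    have hone : wsum τ 1 (a :: L) = τ a + wsum τ 1 L := by simp [h0]
    rw [hone]
    rcases Nat.eq_zero_or_pos L.length with hz | hpos
    · obtain rfl := List.length_eq_zero_iff.1 hz
      simp [wsum, esymPred]
    · obtain ⟨k, hk⟩ := Nat.exists_eq_succ_of_ne_zero hpos.ne'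
      have hk1 : L.length = k + 1 := hk
      have hih := ih k hk1.symm
      have h2 : wsum τ l (a :: L) ^ L.length = wsum τ l L ^ L.length +
          ((L.length : ℕ) : ℂ) • ((l a • τ a) * wsum τ l L ^ k) := by
        rw [h0, hk1, hpow]
      have h3 : (l a • τ a) * wsum τ l L ^ k * τ a = 0 := by
        have h4 := (commute_wsum hc l 1 L a).pow_right k
        simp only [Pi.one_apply, one_smul] at h4
        rw [mul_assoc, ← h4.eq, smul_mul_assoc, ← mul_assoc, hs, zero_mul, smul_zero]
      rw [h2, add_mul, mul_add, hann, add_zero, mul_add, smul_mul_assoc, h3, smul_zero, zero_add,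
        smul_mul_assoc, mul_assoc (l a • τ a), hih, hca, (wsum_pow hc hs l L).2]
      simp only [List.map_cons, List.prod_cons, smul_mul_assoc, mul_smul_comm, smul_smul, esymPred,
        ← add_smul]
      congr 1
      rw [hk1, Nat.factorial_succ]
      push_cast
      ring

end SquareZero

/-! ### Nonvanishing of a product of decomposable 2-forms -/

section TopForm

variable {V : Type*} [AddCommGroup V] [Module ℂ V] {ι : Type*}

open ExteriorAlgebra in
theorem contractLeft_prod_eq_zero (d : Module.Dual ℂ V) (a b : ι → V) (L : List ι)
    (ha : ∀ i ∈ L, d (a i) = 0) (hb : ∀ i ∈ L, d (b i) = 0) :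
    CliffordAlgebra.contractLeft (Q := (0 : QuadraticForm ℂ V)) d
      ((L.map fun i => ExteriorAlgebra.ι ℂ (a i) * ExteriorAlgebra.ι ℂ (b i)).prod) = 0 := by
  induction L with
  | nil => exact CliffordAlgebra.contractLeft_one _ d
  | cons i L ih =>
    have h1 := ih (fun j hj => ha j (by simp [hj])) (fun j hj => hb j (by simp [hj]))
    rw [List.map_cons, List.prod_cons, mul_assoc]
    erw [CliffordAlgebra.contractLeft_ι_mul, CliffordAlgebra.contractLeft_ι_mul]
    rw [ha i (by simp), hb i (by simp), h1]
    simp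

/-- Contraction is an antiderivation. Contracting with `da i` and then with `db i` strips the first
pair from the product and kills every other term, which reduces the claim to a shorter list. -/
theorem prod_ι_mul_ι_ne_zero (a b : ι → V) (da db : ι → Module.Dual ℂ V)
    (haa : ∀ i j, i ≠ j → da i (a j) = 0) (hab : ∀ i j, da i (b j) = 0)
    (hba : ∀ i j, db i (a j) = 0) (hbb : ∀ i j, i ≠ j → db i (b j) = 0)
    (h1 : ∀ i, da i (a i) = 1) (h2 : ∀ i, db i (b i) = 1) (L : List ι) (hL : L.Nodup) :
    (L.map fun i => ExteriorAlgebra.ι ℂ (a i) * ExteriorAlgebra.ι ℂ (b i)).prod ≠ 0 := by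
  induction L with
  | nil => simp
  | cons i L ih =>
    rw [List.nodup_cons] at hL
    have hne : ∀ j ∈ L, i ≠ j := fun j hj h => hL.1 (h ▸ hj)
    have ha0 := contractLeft_prod_eq_zero (da i) a b L (fun j hj => haa i j (hne j hj))
      (fun j _ => hab i j)
    have hb0 := contractLeft_prod_eq_zero (db i) a b L (fun j _ => hba i j)
      (fun j hj => hbb i j (hne j hj))
    intro h
    apply ih hL.2
    rw [List.map_cons, List.prod_cons, mul_assoc] at h
    have h3 := congrArg (CliffordAlgebra.contractLeft (Q := (0 : QuadraticForm ℂ V)) (da i)) h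
    erw [CliffordAlgebra.contractLeft_ι_mul, CliffordAlgebra.contractLeft_ι_mul] at h3
    rw [ha0, hab, h1, map_zero, zero_smul, mul_zero, sub_zero, mul_zero, sub_zero, one_smul] at h3
    have h4 := congrArg (CliffordAlgebra.contractLeft (Q := (0 : QuadraticForm ℂ V)) (db i)) h3
    erw [CliffordAlgebra.contractLeft_ι_mul] at h4
    rw [hb0, h2, map_zero, mul_zero, sub_zero, one_smul] at h4
    exact h4

end TopForm

/-! ### From the equation of top-degree forms to tr(X⁻¹G) -/

section TraceEquation

open Matrix

theorem trace_inv_mul_of_diagonalization {n : ℕ} {B : Matrix (Fin n) (Fin n) ℂ} {l : Fin n → ℝ}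
    (hB : IsUnit B) (hl : ∀ i, 0 < l i) :
    ((Bᵀ * diagonal (fun i => (l i : ℂ)) * B.map (starRingEnd ℂ))⁻¹ *
      (Bᵀ * B.map (starRingEnd ℂ))).trace = ∑ i, (l i : ℂ)⁻¹ := by
  have hBd : IsUnit B.det := (Matrix.isUnit_iff_isUnit_det B).1 hB
  have hBc : IsUnit (B.map (starRingEnd ℂ)).det :=
    (Matrix.isUnit_iff_isUnit_det _).1 (hB.map (starRingEnd ℂ).mapMatrix)
  have hBt : IsUnit (Bᵀ).det := by rwa [det_transpose]
  have hD : (diagonal (fun i => (l i : ℂ)))⁻¹ = diagonal (fun i => (l i : ℂ)⁻¹) := by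
    apply inv_eq_left_inv
    rw [diagonal_mul_diagonal, ← diagonal_one]
    congr 1
    funext i
    exact inv_mul_cancel₀ (by exact_mod_cast (hl i).ne')
  rw [Matrix.mul_inv_rev, Matrix.mul_inv_rev, hD, Matrix.mul_assoc, Matrix.mul_assoc, ← Matrix.mul_assoc (Bᵀ)⁻¹,
    nonsing_inv_mul _ hBt, Matrix.one_mul, trace_mul_comm, Matrix.mul_assoc,
    mul_nonsing_inv _ hBc, Matrix.mul_one, trace_diagonal]

variable {n : ℕ} [NeZero n] {M : Type*} [TopologicalSpace M]
  [ChartedSpace (EuclideanHalfSpace (2 * n)) M]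
  {J : ∀ x : M, Tan n x →ₗ[ℝ] Tan n x} {U : Set M} {z : M → Fin n → ℂ} {x : M}

/-- Evaluation of complex covectors at a tangent vector. -/
def evalDual (v : Tan n x) : Module.Dual ℂ (Tan n x →ₗ[ℝ] ℂ) where
  toFun f := f v
  map_add' _ _ := rfl
  map_smul' _ _ := rfl

/-- The covector `∑ Bₖᵢ dzᵢ`. -/
def frameZ (z : M → Fin n → ℂ) (x : M) (B : Matrix (Fin n) (Fin n) ℂ) (k : Fin n) :
    Tan n x →ₗ[ℝ] ℂ := ∑ i, B k i • dz z i x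

/-- The covector `∑ Bₖᵢ dz̄ᵢ`. -/
def frameZbar (z : M → Fin n → ℂ) (x : M) (B : Matrix (Fin n) (Fin n) ℂ) (k : Fin n) :
    Tan n x →ₗ[ℝ] ℂ := ∑ i, (starRingEnd ℂ) (B k i) • dzbar z i x

theorem frameZ_coordVec (h : IsHolCoord J U z) (hx : x ∈ U) (B : Matrix (Fin n) (Fin n) ℂ)
    (k : Fin n) (a : Fin n → ℂ) : frameZ z x B k (coordVec z x a) = (B *ᵥ a) k := by
  have : ∀ i, dz z i x (coordVec z x a) = a i := fun i => by
    change dCoord z x (coordVec z x a) i = a i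
    rw [h.dCoord_coordVec hx]
  simp [frameZ, LinearMap.sum_apply, this, mulVec, dotProduct]

theorem frameZbar_coordVec (h : IsHolCoord J U z) (hx : x ∈ U) (B : Matrix (Fin n) (Fin n) ℂ)
    (k : Fin n) (a : Fin n → ℂ) :
    frameZbar z x B k (coordVec z x a) = (starRingEnd ℂ) ((B *ᵥ a) k) := by
  have : ∀ i, dzbar z i x (coordVec z x a) = (starRingEnd ℂ) (a i) := fun i => by
    change (starRingEnd ℂ) (dCoord z x (coordVec z x a) i) = _
    rw [h.dCoord_coordVec hx]
  simp [frameZbar, LinearMap.sum_apply, this, mulVec, dotProduct]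

/-- The decomposable form `(√-1/2) θₖ ∧ θ̄ₖ` for the coframe `θ = B dz`. -/
def frameForm (z : M → Fin n → ℂ) (x : M) (B : Matrix (Fin n) (Fin n) ℂ) (k : Fin n) : Forms n x :=
  ExteriorAlgebra.ι ℂ ((Complex.I / 2) • frameZ z x B k) * ExteriorAlgebra.ι ℂ (frameZbar z x B k)

/-- The real tangent space has only real vectors, so functionals dual to θ_k and θ̄_k are built as
complex combinations of evaluations at the vectors `w k` dual to θ_k and their images `w' k` under
the complex structure. -/
theorem frameForm_prod_ne_zero (h : IsHolCoord J U z) (hx : x ∈ U) {B : Matrix (Fin n) (Fin n) ℂ}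
    (hB : IsUnit B) : ((List.finRange n).map (frameForm z x B)).prod ≠ 0 := by
  have hBd : IsUnit B.det := (Matrix.isUnit_iff_isUnit_det B).1 hB
  have hBB : ∀ k i, (B *ᵥ fun j => B⁻¹ j k) i = if i = k then 1 else 0 := by
    intro k i
    have := congrFun (congrFun (mul_nonsing_inv B hBd) i) k
    rw [Matrix.one_apply] at this
    rw [← this]
    rfl
  set w : Fin n → Tan n x := fun k => coordVec z x fun j => B⁻¹ j k with hw
  set w' : Fin n → Tan n x := fun k => coordVec z x (Complex.I • fun j => B⁻¹ j k) with hw'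
  have e1 : ∀ j k, frameZ z x B j (w k) = if j = k then 1 else 0 := fun j k => by
    rw [hw, frameZ_coordVec h hx, hBB]
  have e2 : ∀ j k, frameZ z x B j (w' k) = if j = k then Complex.I else 0 := fun j k => by
    rw [hw', frameZ_coordVec h hx, mulVec_smul, Pi.smul_apply, hBB]
    simp
  have e3 : ∀ j k, frameZbar z x B j (w k) = if j = k then 1 else 0 := fun j k => by
    rw [hw, frameZbar_coordVec h hx, hBB]
    split_ifs <;> simp
  have e4 : ∀ j k, frameZbar z x B j (w' k) = if j = k then -Complex.I else 0 := fun j k => by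
    rw [hw', frameZbar_coordVec h hx, mulVec_smul, Pi.smul_apply, hBB]
    split_ifs <;> simp
  have ev : ∀ (c : ℂ) (v v' : Tan n x) (f : Tan n x →ₗ[ℝ] ℂ),
    (evalDual v + c • evalDual v') f = f v + c * f v' := fun c v v' f => rfl
  -- Evaluation at `w k` minus √-1 times evaluation at `w' k` gives 2 on θ_k and 0 on θ̄_k; with the
  -- opposite sign the roles are exchanged. The scalars −√-1 and 1/2 normalize the pairings with
  -- (√-1/2)θ_k and θ̄_k to 1.
  refine prod_ι_mul_ι_ne_zero _ _
    (fun k => (-Complex.I) • (evalDual (w k) + (-Complex.I) • evalDual (w' k)))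
    (fun k => (1 / 2 : ℂ) • (evalDual (w k) + Complex.I • evalDual (w' k)))
    ?_ ?_ ?_ ?_ ?_ ?_ _ (List.nodup_finRange n)
  all_goals intro i
  all_goals try intro j
  all_goals try intro hij
  all_goals simp only [LinearMap.smul_apply, map_smul, ev, e1, e2, e3, e4, smul_eq_mul]
  · simp [hij.symm]
  · split_ifs <;> simp
  · split_ifs <;> simp
  · simp [hij.symm]
  · simp only [if_true]
    linear_combination (Complex.I ^ 2 / 2 - 1) * Complex.I_sq
  · simp only [if_true]
    linear_combination (-1 / 2) * Complex.I_sq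

theorem ι_mul_ι_comm {V : Type*} [AddCommGroup V] [Module ℂ V] (a b : V) :
    ExteriorAlgebra.ι ℂ a * ExteriorAlgebra.ι ℂ b =
      -(ExteriorAlgebra.ι ℂ b * ExteriorAlgebra.ι ℂ a) :=
  eq_neg_of_add_eq_zero_left (ExteriorAlgebra.ι_add_mul_swap a b)

theorem ι_pair_comm {V : Type*} [AddCommGroup V] [Module ℂ V] (a b c d : V) :
    (ExteriorAlgebra.ι ℂ a * ExteriorAlgebra.ι ℂ b) *
      (ExteriorAlgebra.ι ℂ c * ExteriorAlgebra.ι ℂ d) =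
    (ExteriorAlgebra.ι ℂ c * ExteriorAlgebra.ι ℂ d) *
      (ExteriorAlgebra.ι ℂ a * ExteriorAlgebra.ι ℂ b) := by
  have key : ∀ y : V, ExteriorAlgebra.ι ℂ a * ExteriorAlgebra.ι ℂ b * ExteriorAlgebra.ι ℂ y =
      ExteriorAlgebra.ι ℂ y * (ExteriorAlgebra.ι ℂ a * ExteriorAlgebra.ι ℂ b) := by
    intro y
    rw [mul_assoc, ι_mul_ι_comm b y, mul_neg, ← mul_assoc, ι_mul_ι_comm a y, neg_mul, neg_neg,
      mul_assoc]
  rw [← mul_assoc, key c, mul_assoc, key d, ← mul_assoc]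

theorem ι_pair_sq {V : Type*} [AddCommGroup V] [Module ℂ V] (a b : V) :
    (ExteriorAlgebra.ι ℂ a * ExteriorAlgebra.ι ℂ b) *
      (ExteriorAlgebra.ι ℂ a * ExteriorAlgebra.ι ℂ b) = 0 := by
  rw [mul_assoc, ← mul_assoc (ExteriorAlgebra.ι ℂ b), ι_mul_ι_comm b a, neg_mul, mul_neg,
    ← mul_assoc, ← mul_assoc, ExteriorAlgebra.ι_sq_zero]
  simp

theorem formOf_eq_wsum (z : M → Fin n → ℂ) (x : M) (B : Matrix (Fin n) (Fin n) ℂ)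
    (l : Fin n → ℂ) : formOf z x (Bᵀ * diagonal l * B.map (starRingEnd ℂ)) =
      wsum (frameForm z x B) l (List.finRange n) := by
  have hA : ∀ i j, (Bᵀ * diagonal l * B.map (starRingEnd ℂ)) i j =
      ∑ k, B k i * l k * (starRingEnd ℂ) (B k j) := by
    intro i j
    simp [Matrix.mul_apply, diagonal_apply]
  rw [wsum, ← Fin.sum_univ_def, formOf]
  simp only [hA, frameForm, frameZ, frameZbar, map_smul, map_sum, Finset.sum_mul, Finset.mul_sum,
    Finset.smul_sum, Finset.sum_smul, smul_mul_assoc, mul_smul_comm, smul_smul]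
  have h1 : ∀ F : Fin n → Fin n → Fin n → Forms n x,
      (∑ i, ∑ j, ∑ k, F i j k) = ∑ k, ∑ i, ∑ j, F i j k := by
    intro F
    rw [Finset.sum_congr rfl fun i _ => Finset.sum_comm, Finset.sum_comm]
  rw [h1]
  refine Finset.sum_congr rfl fun k _ => ?_
  rw [Finset.sum_comm]
  refine Finset.sum_congr rfl fun i _ => Finset.sum_congr rfl fun j _ => ?_
  congr 1
  ring

/-- The equation between forms of top degree, as an equation for `tr (X⁻¹ G)`. -/
theorem trace_inv_mul_of_form_eq (h : IsHolCoord J U z) (hx : x ∈ U)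
    {X G : Matrix (Fin n) (Fin n) ℂ} (hX : X.PosDef) (hG : G.PosDef) (ψ t : ℂ)
    (heq : formOf z x X ^ n - ψ • (formOf z x X ^ (n - 1) * formOf z x G) = t • formOf z x G ^ n) :
    ∃ κ : ℝ, 0 < κ ∧ (n : ℂ) - ψ * (X⁻¹ * G).trace = t * κ := by
  obtain ⟨B, l, hB, hl, hXB, hGB⟩ := exists_simultaneous_diagonalization hX hG
  have htr := trace_inv_mul_of_diagonalization hB hl
  rw [← hXB, ← hGB] at htr
  have hGB' : G = Bᵀ * diagonal (1 : Fin n → ℂ) * B.map (starRingEnd ℂ) := by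
    rw [hGB]; simp
  have hfX : formOf z x X = wsum (frameForm z x B) (fun i => (l i : ℂ)) (List.finRange n) := by
    rw [hXB, formOf_eq_wsum]
  have hfG : formOf z x G = wsum (frameForm z x B) 1 (List.finRange n) := by
    rw [hGB', formOf_eq_wsum]
  have hc : ∀ i j, frameForm z x B i * frameForm z x B j =
    frameForm z x B j * frameForm z x B i := fun i j => ι_pair_comm _ _ _ _
  have hs : ∀ i, frameForm z x B i * frameForm z x B i = 0 := fun i => ι_pair_sq _ _
  have hl0 : ∀ i, (l i : ℂ) ≠ 0 := fun i => by exact_mod_cast (hl i).ne'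
  have p1 := (wsum_pow hc hs (fun i => (l i : ℂ)) (List.finRange n)).2
  have p2 := (wsum_pow hc hs 1 (List.finRange n)).2
  have hn : 0 < n := Nat.pos_of_ne_zero (NeZero.ne n)
  have p3 := wsum_pow_mul hc hs (fun i => (l i : ℂ)) (List.finRange n) (n - 1) (by simp; omega)
  rw [List.length_finRange] at p1 p2
  rw [esymPred_eq hl0, ← Fin.prod_univ_def, ← Fin.sum_univ_def] at p3
  rw [← Fin.prod_univ_def] at p1 p2
  rw [hfX, hfG, p1, p2, p3, smul_smul, smul_smul, ← sub_smul] at heq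
  -- Both sides are now multiples of one nonzero element, so the coefficients agree: n! ∏λ − ψ
  -- (n−1)! ∏λ Σ 1/λ = t n!.
  have hT := frameForm_prod_ne_zero h hx hB
  have h3 := smul_left_injective ℂ hT heq
  simp only [Pi.one_apply, Finset.prod_const_one] at h3
  have hP : (0 : ℝ) < ∏ i, l i := Finset.prod_pos fun i _ => hl i
  -- κ is what remains of n! after division by (n−1)! ∏λ.
  refine ⟨n / ∏ i, l i, by positivity, ?_⟩
  rw [htr]
  have hf : (n.factorial : ℂ) = n * ((n - 1).factorial : ℂ) := by
    exact_mod_cast (Nat.mul_factorial_pred hn.ne').symm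
  have hf0 : ((n - 1).factorial : ℂ) ≠ 0 := by exact_mod_cast Nat.factorial_ne_zero _
  have hP0 : (∏ i, (l i : ℂ)) ≠ 0 := Finset.prod_ne_zero_iff.2 fun i _ => hl0 i
  push_cast
  rw [hf] at h3
  have h4 : ((n - 1).factorial : ℂ) * (n * (∏ i, (l i : ℂ)) -
      ψ * ((∏ i, (l i : ℂ)) * ∑ i, (l i : ℂ)⁻¹)) = ((n - 1).factorial : ℂ) * (t * n) := by
    linear_combination h3
  have h5 := mul_left_cancel₀ hf0 h4
  generalize (∑ i, (l i : ℂ)⁻¹) = s at *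
  field_simp
  linear_combination h5

end TraceEquation

/-! ### Coordinate-free traces: Laplacian, gradient, χ_u and ω -/

section Invariance

open Matrix

variable {n : ℕ}

/-- Every scalar in the problem is of the form tr(P⁻¹Q) with P, Q transforming by the same Jacobian,
so this one cancellation gives independence of the coordinates for all of them. -/
theorem trace_inv_mul_congr {A : Matrix (Fin n) (Fin n) ℂ} (hA : IsUnit A)
    (P Q : Matrix (Fin n) (Fin n) ℂ) :
    ((Aᵀ * P * A.map (starRingEnd ℂ))⁻¹ * (Aᵀ * Q * A.map (starRingEnd ℂ))).trace =
      (P⁻¹ * Q).trace := by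
  have hAd : IsUnit A.det := (Matrix.isUnit_iff_isUnit_det A).1 hA
  have hAc : IsUnit (A.map (starRingEnd ℂ)).det :=
    (Matrix.isUnit_iff_isUnit_det _).1 (hA.map (starRingEnd ℂ).mapMatrix)
  have hAt : IsUnit (Aᵀ).det := by rwa [det_transpose]
  have h1 : (Aᵀ * P * A.map (starRingEnd ℂ))⁻¹ * (Aᵀ * Q * A.map (starRingEnd ℂ)) =
      (A.map (starRingEnd ℂ))⁻¹ * (P⁻¹ * Q * A.map (starRingEnd ℂ)) := by
    rw [Matrix.mul_inv_rev, Matrix.mul_inv_rev]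
    calc _ = (A.map (starRingEnd ℂ))⁻¹ * (P⁻¹ * (((Aᵀ)⁻¹ * Aᵀ) * Q * A.map (starRingEnd ℂ))) := by
          simp only [Matrix.mul_assoc]
      _ = _ := by rw [nonsing_inv_mul _ hAt, Matrix.one_mul, ← Matrix.mul_assoc P⁻¹]
  rw [h1, trace_mul_comm, Matrix.mul_assoc, mul_nonsing_inv _ hAc, Matrix.mul_one]

theorem posDef_congr {A : Matrix (Fin n) (Fin n) ℂ} (hA : IsUnit A)
    {P : Matrix (Fin n) (Fin n) ℂ} (hP : P.PosDef) : (Aᵀ * P * A.map (starRingEnd ℂ)).PosDef := by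
  have h1 : Aᵀ = (A.map (starRingEnd ℂ))ᴴ := by ext i j; simp
  rw [h1]
  exact hP.conjTranspose_mul_mul_same
    (mulVec_injective_of_isUnit (hA.map (starRingEnd ℂ).mapMatrix))

theorem trace_inv_mul_im {P Q : Matrix (Fin n) (Fin n) ℂ} (hP : P.IsHermitian)
    (hQ : Q.IsHermitian) : (((P⁻¹ * Q).trace.re : ℝ) : ℂ) = (P⁻¹ * Q).trace := by
  apply Complex.conj_eq_iff_re.1
  have h1 : (starRingEnd ℂ) (P⁻¹ * Q).trace = ((P⁻¹ * Q)ᴴ).trace := (trace_conjTranspose _).symm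
  rw [h1, conjTranspose_mul, hQ.eq, hP.inv.eq, trace_mul_comm]

variable [NeZero n] {M : Type*} [TopologicalSpace M]
  [ChartedSpace (EuclideanHalfSpace (2 * n)) M]
  {J : ∀ x : M, Tan n x →ₗ[ℝ] Tan n x} {U : Set M} {z z' : M → Fin n → ℂ} {x : M}
  {k : WithTop ℕ∞}

theorem CkOn.det {A : M → Matrix (Fin n) (Fin n) ℂ} (hA : ∀ i j, CkOn n k (fun x => A x i j) U) :
    CkOn n k (fun x => (A x).det) U := by
  simp only [Matrix.det_apply']
  exact CkOn.sum fun σ _ => (CkOn.const _).mul (CkOn.prod fun i _ => hA _ _)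

theorem CkOn.matrix_inv {A : M → Matrix (Fin n) (Fin n) ℂ}
    (hA : ∀ i j, CkOn n k (fun x => A x i j) U) (hdet : ∀ x ∈ U, (A x).det ≠ 0) (i j : Fin n) :
    CkOn n k (fun x => (A x)⁻¹ i j) U := by
  have h1 : ∀ x, (A x)⁻¹ i j = ((A x).det)⁻¹ * ((A x).updateRow j (Pi.single i 1)).det := by
    intro x
    rw [Matrix.inv_def, Matrix.smul_apply, Matrix.adjugate_apply, Ring.inverse_eq_inv', smul_eq_mul]
  simp only [h1]
  refine ((CkOn.det hA).inv hdet).mul (CkOn.det fun i' j' => ?_)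
  by_cases h : i' = j
  · subst h
    simpa [Matrix.updateRow_self] using CkOn.const _
  · simpa [Matrix.updateRow_ne h] using hA i' j'

theorem CkOn.trace_mul {A C : M → Matrix (Fin n) (Fin n) ℂ}
    (hA : ∀ i j, CkOn n k (fun x => A x i j) U) (hC : ∀ i j, CkOn n k (fun x => C x i j) U) :
    CkOn n k (fun x => (A x * C x).trace) U := by
  simp only [Matrix.trace, Matrix.diag_apply, Matrix.mul_apply]
  exact CkOn.sum fun i _ => CkOn.sum fun j _ => (hA i j).mul (hC j i)

/-- The matrix `uᵢ u_j̄`. -/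
def gradMatrix (z : M → Fin n → ℂ) (u : M → ℝ) (x : M) : Matrix (Fin n) (Fin n) ℂ :=
  Matrix.of fun i j => partialZ z i (fun y => (u y : ℂ)) x * partialZbar z j (fun y => (u y : ℂ)) x

theorem gradMatrix_change (h : IsHolCoord J U z) (h' : IsHolCoord J U z') (hx : x ∈ U)
    (u : M → ℝ) : gradMatrix z u x = (jacobian z z' x)ᵀ * gradMatrix z' u x *
      (jacobian z z' x).map (starRingEnd ℂ) := by
  ext i j
  simp only [gradMatrix, Matrix.of_apply, Matrix.mul_apply, Matrix.transpose_apply,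
    Matrix.map_apply, Finset.sum_mul]
  rw [partialZ_change h h' hx, partialZbar_change h h' hx, Finset.sum_mul_sum, Finset.sum_comm]
  refine Finset.sum_congr rfl fun l _ => Finset.sum_congr rfl fun k _ => ?_
  ring

theorem jacobian_isUnit [IsManifold (𝓡∂ (2 * n)) ∞ M] (h : IsHolCoord J U z)
    (h' : IsHolCoord J U z') (hx : x ∈ U) : IsUnit (jacobian z z' x) := by
  have h1 : jacobian z' z x * jacobian z z' x = 1 := by
    ext j i
    have h2 := partialZ_change h h' hx (fun y => z y j) i
    rw [← (jacobian_eq_partialZ h h hx j i).1] at h2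
    have h3 : jacobian z z x j i = (1 : Matrix (Fin n) (Fin n) ℂ) j i := by
      change dCoord z x (coordVec z x (Pi.single i 1)) j = _
      rw [h.dCoord_coordVec hx, Matrix.one_apply, Pi.single_apply]
    rw [Matrix.mul_apply, ← h3, h2]
    refine Finset.sum_congr rfl fun k _ => ?_
    rw [(jacobian_eq_partialZ h' h hx j k).1, mul_comm]
  rw [Matrix.isUnit_iff_isUnit_det]
  have h4 := congrArg Matrix.det h1
  rw [det_mul, det_one] at h4
  exact IsUnit.of_mul_eq_one _ (by rw [mul_comm]; exact h4)

variable [IsManifold (𝓡∂ (2 * n)) ∞ M] {𝒥 : ComplexStructure n M}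

theorem IsCk.ofReal {k : ℕ∞} {u : M → ℝ} (hu : IsCk n k u) (U : Set M) :
    CkOn n k (fun x => (u x : ℂ)) U :=
  (Complex.ofRealCLM.contDiff.contMDiff.comp hu).contMDiffOn

/-- The components of `χ_u` in the coordinates `z`. -/
def chiComp (χ : RealOneOneForm 𝒥) (u : M → ℝ) (z : M → Fin n → ℂ) (x : M) :
    Matrix (Fin n) (Fin n) ℂ := components χ.form z x + complexHessian z u x

theorem chiComp_change (h : IsHolCoord 𝒥.J U z) (h' : IsHolCoord 𝒥.J U z') (hx : x ∈ U)
    (χ : RealOneOneForm 𝒥) {u : M → ℝ} (hu : CkOn n 2 (fun y => (u y : ℂ)) U) :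
    chiComp χ u z x = (jacobian z z' x)ᵀ * chiComp χ u z' x *
      (jacobian z z' x).map (starRingEnd ℂ) := by
  rw [chiComp, chiComp, components_change h h' hx χ.form (χ.invariant x),
    complexHessian_change h h' hx hu, Matrix.mul_add, Matrix.add_mul]

/-- A common domain on which the transformation rules apply to `z` and to the coordinates chosen at
`x`. -/
theorem exists_isHolCoord_coordAt (h : IsHolCoord 𝒥.J U z) (hx : x ∈ U) :
    ∃ V, x ∈ V ∧ V ⊆ U ∧ IsHolCoord 𝒥.J V z ∧ IsHolCoord 𝒥.J V (𝒥.coordAt x) := by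
  obtain ⟨U₀, hx₀, h₀⟩ := 𝒥.coordAt_spec x
  exact ⟨U ∩ U₀, ⟨hx, hx₀⟩, inter_subset_left,
    h.mono (h.isOpen.inter h₀.isOpen) inter_subset_left,
    h₀.mono (h.isOpen.inter h₀.isOpen) inter_subset_right⟩

theorem metric_posDef (Ω : HermitianMetric 𝒥) (h : IsHolCoord 𝒥.J U z) (hx : x ∈ U) :
    (components Ω.form z x).PosDef := by
  obtain ⟨V, hxV, _, h1, h2⟩ := exists_isHolCoord_coordAt h hx
  rw [components_change h1 h2 hxV Ω.form (Ω.invariant x)]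
  exact posDef_congr (jacobian_isUnit h1 h2 hxV) (Ω.pos x)

theorem chiComp_posDef (χ : RealOneOneForm 𝒥) {u : M → ℝ} (hu : IsCk n 2 u)
    (hpos : (chiMatrix χ u x).PosDef) (h : IsHolCoord 𝒥.J U z) (hx : x ∈ U) :
    (chiComp χ u z x).PosDef := by
  obtain ⟨V, hxV, _, h1, h2⟩ := exists_isHolCoord_coordAt h hx
  rw [chiComp_change h1 h2 hxV χ (IsCk.ofReal hu V)]
  exact posDef_congr (jacobian_isUnit h1 h2 hxV) hpos

theorem trace_chiComp_inv (Ω : HermitianMetric 𝒥) (χ : RealOneOneForm 𝒥) {u : M → ℝ}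
    (hu : IsCk n 2 u) (h : IsHolCoord 𝒥.J U z) (hx : x ∈ U) :
    ((chiComp χ u z x)⁻¹ * components Ω.form z x).trace = ((chiMatrix χ u x)⁻¹ * Ω.g x).trace := by
  obtain ⟨V, hxV, _, h1, h2⟩ := exists_isHolCoord_coordAt h hx
  rw [chiComp_change h1 h2 hxV χ (IsCk.ofReal hu V),
    components_change h1 h2 hxV Ω.form (Ω.invariant x),
    trace_inv_mul_congr (jacobian_isUnit h1 h2 hxV)]
  rfl

/-- The case t = 0 of `trace_inv_mul_of_form_eq`. In fixed coordinates around a point this form of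
the equation can be differentiated. -/
theorem IsSolution.trace_eq {Ω : HermitianMetric 𝒥} {χ : RealOneOneForm 𝒥} {ψ u : M → ℝ}
    (hsol : IsSolution Ω χ ψ u) (hu : IsCk n 2 u) (h : IsHolCoord 𝒥.J U z) (hx : x ∈ U) :
    (ψ x : ℂ) * ((chiComp χ u z x)⁻¹ * components Ω.form z x).trace = n := by
  rw [trace_chiComp_inv Ω χ hu h hx]
  obtain ⟨U₀, hx₀, h₀⟩ := 𝒥.coordAt_spec x
  obtain ⟨κ, _, hκ⟩ := trace_inv_mul_of_form_eq h₀ hx₀ (hsol x).1 (Ω.pos x) (ψ x) 0 (by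
    rw [zero_smul, sub_eq_zero]
    exact (hsol x).2)
  change (ψ x : ℂ) * ((chiMatrix χ u x)⁻¹ * Ω.matrixAt x).trace = n
  linear_combination -hκ

theorem IsSubsolution.trace_le {Ω : HermitianMetric 𝒥} {χ : RealOneOneForm 𝒥} {ψ v : M → ℝ}
    (hsub : IsSubsolution Ω χ ψ v) (hv : IsCk n 2 v) (h : IsHolCoord 𝒥.J U z) (hx : x ∈ U) :
    ψ x * ((chiComp χ v z x)⁻¹ * components Ω.form z x).trace.re ≤ n := by
  rw [trace_chiComp_inv Ω χ hv h hx]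
  obtain ⟨U₀, hx₀, h₀⟩ := 𝒥.coordAt_spec x
  obtain ⟨hpos, t, ht, heq⟩ := hsub x
  obtain ⟨κ, hκ0, hκ⟩ := trace_inv_mul_of_form_eq h₀ hx₀ hpos (Ω.pos x) (ψ x) t heq
  have h1 := congrArg Complex.re hκ
  rw [Complex.sub_re, Complex.re_ofReal_mul, ← Complex.ofReal_mul, Complex.ofReal_re,
    Complex.natCast_re] at h1
  have h2 : 0 ≤ t * κ := mul_nonneg ht hκ0.le
  change ψ x * ((chiMatrix χ v x)⁻¹ * Ω.matrixAt x).trace.re ≤ n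
  linarith

theorem laplacian_eq (Ω : HermitianMetric 𝒥) {u : M → ℝ} (hu : IsCk n 2 u)
    (h : IsHolCoord 𝒥.J U z) (hx : x ∈ U) :
    laplacian Ω u x = ((components Ω.form z x)⁻¹ * complexHessian z u x).trace.re := by
  obtain ⟨V, hxV, _, h1, h2⟩ := exists_isHolCoord_coordAt h hx
  rw [complexHessian_change h1 h2 hxV (IsCk.ofReal hu V),
    components_change h1 h2 hxV Ω.form (Ω.invariant x),
    trace_inv_mul_congr (jacobian_isUnit h1 h2 hxV), laplacian]
  congr 1
  simp only [Matrix.trace, Matrix.diag_apply, Matrix.mul_apply]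
  rw [Finset.sum_comm]
  rfl

theorem gradNorm_eq (Ω : HermitianMetric 𝒥) (u : M → ℝ)
    (h : IsHolCoord 𝒥.J U z) (hx : x ∈ U) :
    gradNorm Ω u x = Real.sqrt ((components Ω.form z x)⁻¹ * gradMatrix z u x).trace.re := by
  obtain ⟨V, hxV, _, h1, h2⟩ := exists_isHolCoord_coordAt h hx
  rw [gradMatrix_change h1 h2 hxV u,
    components_change h1 h2 hxV Ω.form (Ω.invariant x),
    trace_inv_mul_congr (jacobian_isUnit h1 h2 hxV), gradNorm]
  congr 2
  simp only [Matrix.trace, Matrix.diag_apply, Matrix.mul_apply, gradMatrix, Matrix.of_apply]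
  rw [Finset.sum_comm]
  refine Finset.sum_congr rfl fun i _ => Finset.sum_congr rfl fun j _ => ?_
  rw [mul_assoc]
  rfl

/-- The trace of a real `(1,1)` form with respect to the metric. -/
def metricTrace (Ω : HermitianMetric 𝒥) (χ : RealOneOneForm 𝒥) (x : M) : ℝ :=
  ((Ω.g x)⁻¹ * χ.matrixAt x).trace.re

theorem metricTrace_eq (Ω : HermitianMetric 𝒥) (χ : RealOneOneForm 𝒥)
    (h : IsHolCoord 𝒥.J U z) (hx : x ∈ U) :
    metricTrace Ω χ x = ((components Ω.form z x)⁻¹ * components χ.form z x).trace.re := by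
  obtain ⟨V, hxV, _, h1, h2⟩ := exists_isHolCoord_coordAt h hx
  rw [components_change h1 h2 hxV χ.form (χ.invariant x),
    components_change h1 h2 hxV Ω.form (Ω.invariant x),
    trace_inv_mul_congr (jacobian_isUnit h1 h2 hxV)]
  rfl

/-- The squared length of the gradient. -/
def gradSq (Ω : HermitianMetric 𝒥) (u : M → ℝ) (x : M) : ℝ :=
  ((Ω.g x)⁻¹ * gradMatrix (𝒥.coordAt x) u x).trace.re

theorem gradSq_eq (Ω : HermitianMetric 𝒥) (u : M → ℝ)
    (h : IsHolCoord 𝒥.J U z) (hx : x ∈ U) :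
    gradSq Ω u x = ((components Ω.form z x)⁻¹ * gradMatrix z u x).trace.re := by
  obtain ⟨V, hxV, _, h1, h2⟩ := exists_isHolCoord_coordAt h hx
  rw [gradMatrix_change h1 h2 hxV u,
    components_change h1 h2 hxV Ω.form (Ω.invariant x),
    trace_inv_mul_congr (jacobian_isUnit h1 h2 hxV)]
  rfl

theorem gradNorm_eq_sqrt (Ω : HermitianMetric 𝒥) (u : M → ℝ) (x : M) :
    gradNorm Ω u x = Real.sqrt (gradSq Ω u x) := by
  obtain ⟨U₀, hx₀, h₀⟩ := 𝒥.coordAt_spec x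
  rw [gradNorm_eq Ω u h₀ hx₀, gradSq_eq Ω u h₀ hx₀]

theorem CkOn.metric (Ω : HermitianMetric 𝒥) (h : IsHolCoord 𝒥.J U z) (i j : Fin n) :
    CkOn n ∞ (fun x => components Ω.form z x i j) U := Ω.smooth U z h i j

theorem CkOn.metric_inv (Ω : HermitianMetric 𝒥) (h : IsHolCoord 𝒥.J U z) (i j : Fin n) :
    CkOn n ∞ (fun x => (components Ω.form z x)⁻¹ i j) U :=
  CkOn.matrix_inv (fun i j => CkOn.metric Ω h i j)
    (fun _ hx => ((Matrix.isUnit_iff_isUnit_det _).1 (metric_posDef Ω h hx).isUnit).ne_zero) i j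

theorem CkOn.partial {m : WithTop ℕ∞} (h : IsHolCoord J U z) {f : M → ℂ} (hf : CkOn n k f U)
    (hmk : m + 1 ≤ k) (hm : m + 1 ≤ ∞) (i : Fin n) :
    CkOn n m (partialZ z i f) U ∧ CkOn n m (partialZbar z i f) U := by
  rw [partialZ_eq_wirt, partialZbar_eq_wirt]
  exact ⟨hf.wirt h hmk hm _ i, hf.wirt h hmk hm _ i⟩

theorem CkOn.complexHessian {m : WithTop ℕ∞} (h : IsHolCoord J U z) {u : M → ℝ}
    (hu : CkOn n k (fun x => (u x : ℂ)) U) (hmk : m + 2 ≤ k) (hm : m + 2 ≤ ∞) (i j : Fin n) :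
    CkOn n m (fun x => HermitianMA.complexHessian z u x i j) U := by
  have e : m + 1 + 1 = m + 2 := by rw [add_assoc, one_add_one_eq_two]
  have h1 : m + 1 ≤ ∞ := le_trans (by rw [← e]; exact le_self_add) hm
  exact ((hu.partial h (m := m + 1) (by rwa [e]) (by rwa [e]) j).2.partial h le_rfl h1 i).1

theorem CkOn.gradMatrix {m : WithTop ℕ∞} (h : IsHolCoord J U z) {u : M → ℝ}
    (hu : CkOn n k (fun x => (u x : ℂ)) U) (hmk : m + 1 ≤ k) (hm : m + 1 ≤ ∞) (i j : Fin n) :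
    CkOn n m (fun x => HermitianMA.gradMatrix z u x i j) U :=
  (hu.partial h hmk hm i).1.mul (hu.partial h hmk hm j).2

/-- Scalars are defined through `coordAt x`, chosen separately at each point without any regularity
in `x`. Continuity is read off locally from the same trace in fixed coordinates. -/
theorem continuous_of_locally {F : M → ℝ} (h : ∀ x, ∃ (U : Set M) (f : M → ℂ), IsOpen U ∧ x ∈ U ∧
    CkOn n 0 f U ∧ ∀ y ∈ U, F y = (f y).re) : Continuous F := by
  rw [continuous_iff_continuousAt]
  intro x
  obtain ⟨U, f, hU, hx, hf, he⟩ := h x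
  have h1 : ContinuousAt (fun y => (f y).re) x :=
    Complex.continuous_re.continuousAt.comp (hf.continuousOn.continuousAt (hU.mem_nhds hx))
  refine h1.congr ?_
  filter_upwards [hU.mem_nhds hx] with y hy using (he y hy).symm

theorem continuous_laplacian (Ω : HermitianMetric 𝒥) {u : M → ℝ} (hu : IsCk n 2 u) :
    Continuous (laplacian Ω u) := by
  refine continuous_of_locally (n := n) fun x => ?_
  obtain ⟨U₀, hx₀, h₀⟩ := 𝒥.coordAt_spec x
  refine ⟨U₀, _, h₀.isOpen, hx₀, ?_, fun y hy => laplacian_eq Ω hu h₀ hy⟩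
  exact CkOn.trace_mul (fun i j => (CkOn.metric_inv Ω h₀ i j).of_le (by simp))
    (fun i j => (IsCk.ofReal hu U₀).complexHessian h₀ (by simp) (by simpa using two_le_infty) i j)

theorem continuous_metricTrace (Ω : HermitianMetric 𝒥) (χ : RealOneOneForm 𝒥) :
    Continuous (metricTrace Ω χ) := by
  refine continuous_of_locally (n := n) fun x => ?_
  obtain ⟨U₀, hx₀, h₀⟩ := 𝒥.coordAt_spec x
  refine ⟨U₀, _, h₀.isOpen, hx₀, ?_, fun y hy => metricTrace_eq Ω χ h₀ hy⟩
  exact CkOn.trace_mul (fun i j => (CkOn.metric_inv Ω h₀ i j).of_le (by simp))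
    (fun i j => (χ.smooth U₀ _ h₀ i j : CkOn n ∞ _ U₀).of_le (by simp))

theorem continuous_gradSq (Ω : HermitianMetric 𝒥) {u : M → ℝ} (hu : IsCk n 2 u) :
    Continuous (gradSq Ω u) := by
  refine continuous_of_locally (n := n) fun x => ?_
  obtain ⟨U₀, hx₀, h₀⟩ := 𝒥.coordAt_spec x
  refine ⟨U₀, _, h₀.isOpen, hx₀, ?_, fun y hy => gradSq_eq Ω u h₀ hy⟩
  exact CkOn.trace_mul (fun i j => (CkOn.metric_inv Ω h₀ i j).of_le (by simp))
    (fun i j => (IsCk.ofReal hu U₀).gradMatrix h₀ (by norm_num) (by simp) i j)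

end Invariance

/-! ### Linear changes of coordinates and C² bounds at a point -/

section LinearCoordinates

open Matrix

variable {n : ℕ} [NeZero n] {M : Type*} [TopologicalSpace M]
  [ChartedSpace (EuclideanHalfSpace (2 * n)) M]
  {J : ∀ x : M, Tan n x →ₗ[ℝ] Tan n x} {U : Set M} {z z' : M → Fin n → ℂ} {x : M}
  {B : Matrix (Fin n) (Fin n) ℂ}

/-- The coordinates `B z`. -/
def linCoord (B : Matrix (Fin n) (Fin n) ℂ) (z : M → Fin n → ℂ) : M → Fin n → ℂ :=
  fun x => B *ᵥ z x

/-- Multiplication by a complex matrix, as a real continuous linear map. -/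
def mulVecReal (B : Matrix (Fin n) (Fin n) ℂ) : (Fin n → ℂ) →L[ℝ] (Fin n → ℂ) :=
  LinearMap.toContinuousLinearMap (B.mulVecLin.restrictScalars ℝ)

theorem dCoord_linCoord (h : IsHolCoord J U z) (hx : x ∈ U) (v : Tan n x) :
    dCoord (linCoord B z) x v = B *ᵥ dCoord z x v := by
  have h1 : HasMFDerivAt (𝓡∂ (2 * n)) 𝓘(ℝ, Fin n → ℂ) (mulVecReal B ∘ z) x
      ((mulVecReal B).comp (dCoord z x)) :=
    HasMFDerivAt.comp x (mulVecReal B).hasFDerivAt.hasMFDerivAt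
      (h.mdifferentiableAt hx).hasMFDerivAt
  have h2 : dCoord (linCoord B z) x = (mulVecReal B).comp (dCoord z x) := h1.mfderiv
  rw [h2]
  rfl

theorem IsHolCoord.linear (h : IsHolCoord J U z) (hB : IsUnit B) :
    IsHolCoord J U (linCoord B z) := by
  have hinj : Function.Injective B.mulVec := mulVec_injective_of_isUnit hB
  have hsurj : Function.Surjective B.mulVec := by
    intro y
    refine ⟨B⁻¹ *ᵥ y, ?_⟩
    rw [mulVec_mulVec, mul_nonsing_inv _ ((Matrix.isUnit_iff_isUnit_det B).1 hB), one_mulVec]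
  refine ⟨h.isOpen, ?_, ?_, ?_, ?_⟩
  · exact (mulVecReal B).contDiff.contMDiff.comp_contMDiffOn h.contMDiffOn
  · intro x hx y hy hxy
    exact h.injOn hx hy (hinj hxy)
  · intro x hx
    have : (dCoord (linCoord B z) x : Tan n x → Fin n → ℂ) = B.mulVec ∘ dCoord z x := by
      funext v
      exact dCoord_linCoord h hx v
    rw [this]
    exact Function.Bijective.comp ⟨hinj, hsurj⟩ (h.bijective x hx)
  · intro x hx v
    rw [dCoord_linCoord h hx, dCoord_linCoord h hx, h.map_J x hx, mulVec_smul]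

theorem coordVec_linCoord (h : IsHolCoord J U z) (hB : IsUnit B) (hx : x ∈ U) (a : Fin n → ℂ) :
    coordVec (linCoord B z) x a = coordVec z x (B⁻¹ *ᵥ a) := by
  apply ((h.linear hB).bijective x hx).1
  rw [(h.linear hB).dCoord_coordVec hx, dCoord_linCoord h hx, h.dCoord_coordVec hx, mulVec_mulVec,
    mul_nonsing_inv _ ((Matrix.isUnit_iff_isUnit_det B).1 hB), one_mulVec]

theorem coordDeriv_linCoord (h : IsHolCoord J U z) (hB : IsUnit B) (hx : x ∈ U) (a : Fin n → ℂ)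
    (f : M → ℂ) : coordDeriv (linCoord B z) a f x = coordDeriv z (B⁻¹ *ᵥ a) f x := by
  rw [coordDeriv_eq_dFun, coordDeriv_eq_dFun, coordVec_linCoord h hB hx]

theorem jacobian_linCoord_left (h : IsHolCoord J U z) (hB : IsUnit B) (hx : x ∈ U) :
    jacobian (linCoord B z) z x = B⁻¹ := by
  ext k i
  change dCoord z x (coordVec (linCoord B z) x (Pi.single i 1)) k = _
  rw [coordVec_linCoord h hB hx, h.dCoord_coordVec hx]
  simp

/-- `C2BoundOn` at a single point. -/
def C2At (z : M → Fin n → ℂ) (x : M) (f : M → ℂ) (b : ℝ) : Prop := C2BoundOn z {x} f b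

theorem C2BoundOn.c2At {K : Set M} {f : M → ℂ} {b : ℝ} (h : C2BoundOn z K f b) (hx : x ∈ K) :
    C2At z x f b := by
  intro y hy
  rw [mem_singleton_iff.1 hy]
  exact h x hx

theorem c2At_iff {f : M → ℂ} {b : ℝ} : C2At z x f b ↔ ‖f x‖ ≤ b ∧
    (∀ a : Fin n → ℂ, ‖a‖ ≤ 1 → ‖coordDeriv z a f x‖ ≤ b) ∧
    (∀ a b' : Fin n → ℂ, ‖a‖ ≤ 1 → ‖b'‖ ≤ 1 → ‖coordDeriv z a (coordDeriv z b' f) x‖ ≤ b) := by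
  simp [C2At, C2BoundOn]

theorem C2At.nonneg {f : M → ℂ} {b : ℝ} (h : C2At z x f b) : 0 ≤ b :=
  (norm_nonneg _).trans (c2At_iff.1 h).1

theorem C2At.mono {f : M → ℂ} {b b' : ℝ} (h : C2At z x f b) (hb : b ≤ b') : C2At z x f b' := by
  rw [c2At_iff] at h ⊢
  exact ⟨h.1.trans hb, fun a ha => (h.2.1 a ha).trans hb, fun a c ha hc => (h.2.2 a c ha hc).trans hb⟩

variable [IsManifold (𝓡∂ (2 * n)) ∞ M]

theorem C2At.congr (h : IsHolCoord J U z) (hx : x ∈ U) {f g : M → ℂ} {b : ℝ} (hf : C2At z x f b)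
    (hfg : ∀ y ∈ U, g y = f y) : C2At z x g b := by
  rw [c2At_iff] at hf ⊢
  have h1 : ∀ a, ∀ y ∈ U, coordDeriv z a g y = coordDeriv z a f y := fun a y hy =>
    coordDeriv_congr (by filter_upwards [h.isOpen.mem_nhds hy] with w hw using hfg w hw) z a
  refine ⟨by rw [hfg x hx]; exact hf.1, fun a ha => by rw [h1 a x hx]; exact hf.2.1 a ha,
    fun a c ha hc => ?_⟩
  rw [coordDeriv_congr (g := coordDeriv z c f)
    (by filter_upwards [h.isOpen.mem_nhds hx] with w hw using h1 c w hw) z a]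
  exact hf.2.2 a c ha hc

theorem coordDeriv_const_mul (h : IsHolCoord J U z) (hx : x ∈ U) {f : M → ℂ} (hf : CkOn n 1 f U)
    (c : ℂ) (a : Fin n → ℂ) : coordDeriv z a (fun y => c * f y) x = c * coordDeriv z a f x := by
  rw [coordDeriv_mul ((CkOn.const c : CkOn n 1 _ U).mdifferentiableAt h.isOpen le_rfl hx)
    (hf.mdifferentiableAt h.isOpen le_rfl hx), coordDeriv_const]
  ring

theorem C2At.const_mul (h : IsHolCoord J U z) (hx : x ∈ U) {f : M → ℂ} {b : ℝ} (hf : C2At z x f b)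
    (hfs : CkOn n 2 f U) (c : ℂ) : C2At z x (fun y => c * f y) (‖c‖ * b) := by
  have h12 : (1 : WithTop ℕ∞) ≤ 2 := by norm_num
  have hf1 : CkOn n 1 f U := hfs.of_le h12
  rw [c2At_iff] at hf ⊢
  refine ⟨?_, fun a ha => ?_, fun a d ha hd => ?_⟩
  · rw [norm_mul]
    exact mul_le_mul_of_nonneg_left hf.1 (norm_nonneg _)
  · rw [coordDeriv_const_mul h hx hf1, norm_mul]
    exact mul_le_mul_of_nonneg_left (hf.2.1 a ha) (norm_nonneg _)
  · rw [coordDeriv_congr (g := fun y => c * coordDeriv z d f y) (by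
      filter_upwards [h.isOpen.mem_nhds hx] with y hy using coordDeriv_const_mul h hy hf1 c d) z a,
      coordDeriv_const_mul h hx (hfs.coordDeriv h (by norm_num) one_add_one_le_infty d), norm_mul]
    exact mul_le_mul_of_nonneg_left (hf.2.2 a d ha hd) (norm_nonneg _)

theorem C2At.add (h : IsHolCoord J U z) (hx : x ∈ U) {f g : M → ℂ} {b c : ℝ} (hf : C2At z x f b)
    (hg : C2At z x g c) (hfs : CkOn n 2 f U) (hgs : CkOn n 2 g U) :
    C2At z x (fun y => f y + g y) (b + c) := by
  have h12 : (1 : WithTop ℕ∞) ≤ 2 := by norm_num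
  have hd : ∀ a, ∀ y ∈ U, coordDeriv z a (fun y => f y + g y) y =
      coordDeriv z a f y + coordDeriv z a g y := fun a y hy =>
    coordDeriv_add (hfs.mdifferentiableAt h.isOpen h12 hy) (hgs.mdifferentiableAt h.isOpen h12 hy) a
  rw [c2At_iff] at hf hg ⊢
  refine ⟨(norm_add_le _ _).trans (add_le_add hf.1 hg.1), fun a ha => ?_, fun a d ha hd' => ?_⟩
  · rw [hd a x hx]
    exact (norm_add_le _ _).trans (add_le_add (hf.2.1 a ha) (hg.2.1 a ha))
  · rw [coordDeriv_congr (g := fun y => coordDeriv z d f y + coordDeriv z d g y) (by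
      filter_upwards [h.isOpen.mem_nhds hx] with y hy using hd d y hy) z a,
      coordDeriv_add
        ((hfs.coordDeriv h (m := 1) (by norm_num) one_add_one_le_infty d).mdifferentiableAt
          h.isOpen le_rfl hx)
        ((hgs.coordDeriv h (m := 1) (by norm_num) one_add_one_le_infty d).mdifferentiableAt
          h.isOpen le_rfl hx)]
    exact (norm_add_le _ _).trans (add_le_add (hf.2.2 a d ha hd') (hg.2.2 a d ha hd'))

theorem C2At.zero (h : IsHolCoord J U z) (hx : x ∈ U) : C2At z x (fun _ => 0) 0 := by
  rw [c2At_iff]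
  refine ⟨by simp, fun a _ => by simp [coordDeriv_const], fun a d _ _ => ?_⟩
  rw [coordDeriv_congr (g := fun _ => 0) (by
      filter_upwards [h.isOpen.mem_nhds hx] with y hy using coordDeriv_const (z := z) d 0 y) z a,
      coordDeriv_const]
  simp

theorem C2At.lincomb {ι : Type*} (h : IsHolCoord J U z) (hx : x ∈ U) {F : ι → M → ℂ} {b q : ℝ}
    {c : ι → ℂ} (hF : ∀ s, C2At z x (F s) b) (hFs : ∀ s, CkOn n 2 (F s) U) (hc : ∀ s, ‖c s‖ ≤ q)
    (S : Finset ι) : C2At z x (fun y => ∑ s ∈ S, c s * F s y) (S.card * (q * b)) := by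
  classical
  induction S using Finset.induction_on with
  | empty => simpa using C2At.zero h hx
  | insert s S hs ih =>
    simp only [Finset.sum_insert hs, Finset.card_insert_of_notMem hs]
    refine (((hF s).const_mul h hx (hFs s) (c s)).add h hx ih ((CkOn.const _).mul (hFs s))
      (CkOn.sum fun t _ => (CkOn.const _).mul (hFs t))).mono ?_
    have : ‖c s‖ * b ≤ q * b := mul_le_mul_of_nonneg_right (hc s) (hF s).nonneg
    push_cast
    linarith

/-- The coordinate change is constant, so directions are merely mapped by B⁻¹: each of the at most
two derivatives costs a factor r, and no derivative of the change of coordinates enters. -/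
theorem C2At.linCoord (h : IsHolCoord J U z) (hB : IsUnit B) (hx : x ∈ U) {f : M → ℂ} {b r : ℝ}
    (hf : C2At z x f b) (hfs : CkOn n 2 f U) (hr : 1 ≤ r)
    (hBr : ∀ a : Fin n → ℂ, ‖a‖ ≤ 1 → ‖B⁻¹ *ᵥ a‖ ≤ r) :
    C2At (linCoord B z) x f (r ^ 2 * b) := by
  have h12 : (1 : WithTop ℕ∞) ≤ 2 := by norm_num
  have hr0 : 0 < r := by linarith
  have hb := hf.nonneg
  rw [c2At_iff] at hf ⊢
  have hscale : ∀ a : Fin n → ℂ, ‖a‖ ≤ 1 → ∃ a' : Fin n → ℂ, ‖a'‖ ≤ 1 ∧ B⁻¹ *ᵥ a = r • a' := by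
    intro a ha
    refine ⟨r⁻¹ • (B⁻¹ *ᵥ a), ?_, by rw [smul_smul, mul_inv_cancel₀ hr0.ne', one_smul]⟩
    rw [norm_smul, norm_inv, Real.norm_of_nonneg hr0.le, inv_mul_le_iff₀ hr0, mul_one]
    exact hBr a ha
  refine ⟨?_, fun a ha => ?_, fun a d ha hd => ?_⟩
  · nlinarith [hf.1, one_le_pow₀ hr (n := 2)]
  · obtain ⟨a', ha', he⟩ := hscale a ha
    rw [coordDeriv_linCoord h hB hx, he, coordDeriv_smul_dir, norm_mul, Complex.norm_real,
      Real.norm_of_nonneg hr0.le]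
    have := hf.2.1 a' ha'
    nlinarith [norm_nonneg (coordDeriv z a' f x), mul_nonneg hr0.le hb]
  · obtain ⟨a', ha', he⟩ := hscale a ha
    obtain ⟨d', hd', he'⟩ := hscale d hd
    rw [coordDeriv_congr (g := fun y => (r : ℂ) * coordDeriv z d' f y) (by
      filter_upwards [h.isOpen.mem_nhds hx] with y hy
      rw [coordDeriv_linCoord h hB hy, he', coordDeriv_smul_dir]) _ a,
      coordDeriv_linCoord h hB hx, he, coordDeriv_smul_dir,
      coordDeriv_const_mul h hx (hfs.coordDeriv h (by norm_num) one_add_one_le_infty d'), norm_mul,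
      norm_mul, Complex.norm_real, Real.norm_of_nonneg hr0.le]
    have := hf.2.2 a' d' ha' hd'
    calc r * (r * ‖_‖) ≤ r * (r * b) := by gcongr
      _ = _ := by ring

theorem norm_single_le_one {c : ℂ} (hc : ‖c‖ = 1) (i : Fin n) :
    ‖(Pi.single i c : Fin n → ℂ)‖ ≤ 1 := by
  rw [Pi.norm_single, hc]

theorem half_norm_add_le {a b c : ℂ} {r : ℝ} (hc : ‖c‖ = 1) (ha : ‖a‖ ≤ r) (hb : ‖b‖ ≤ r) :
    ‖(1 / 2 : ℂ) * (a + c * b)‖ ≤ r := by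
  rw [norm_mul]
  have h1 : ‖a + c * b‖ ≤ r + r := by
    refine (norm_add_le _ _).trans (add_le_add ha ?_)
    rw [norm_mul, hc, one_mul]
    exact hb
  have h2 : ‖(1 / 2 : ℂ)‖ = 1 / 2 := by norm_num
  rw [h2]
  linarith

theorem C2At.norm_wirt {f : M → ℂ} {b : ℝ} (hf : C2At z x f b) {c : ℂ} (hc : ‖c‖ = 1) (i : Fin n) :
    ‖wirt z c i f x‖ ≤ b := by
  rw [c2At_iff] at hf
  exact half_norm_add_le hc (hf.2.1 _ (norm_single_le_one (by simp) i))
    (hf.2.1 _ (norm_single_le_one (by simp) i))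

theorem C2At.norm_wirt_wirt (h : IsHolCoord J U z) (hx : x ∈ U) {f : M → ℂ} {b : ℝ}
    (hf : C2At z x f b) (hfs : CkOn n 2 f U) {c c' : ℂ} (hc : ‖c‖ = 1) (hc' : ‖c'‖ = 1)
    (i j : Fin n) : ‖wirt z c i (wirt z c' j f) x‖ ≤ b := by
  rw [c2At_iff] at hf
  rw [wirt, coordDeriv_wirt h hfs hx, coordDeriv_wirt h hfs hx]
  have h1 : ∀ k l : Fin n, ∀ d e : ℂ, ‖d‖ = 1 → ‖e‖ = 1 →
      ‖coordDeriv z (Pi.single k d) (coordDeriv z (Pi.single l e) f) x‖ ≤ b := fun k l d e hd he =>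
    hf.2.2 _ _ (norm_single_le_one hd k) (norm_single_le_one he l)
  have hI := Complex.norm_I
  have h11 : ‖(1 : ℂ)‖ = 1 := norm_one
  exact half_norm_add_le hc
    (half_norm_add_le hc' (h1 _ _ _ _ h11 h11) (h1 _ _ _ _ h11 hI))
    (half_norm_add_le hc' (h1 _ _ _ _ hI h11) (h1 _ _ _ _ hI hI))

theorem coordDeriv_eq_sum (a : Fin n → ℂ) (f : M → ℂ) (x : M) : coordDeriv z a f x =
    ∑ k, (((a k).re : ℂ) * coordDeriv z (Pi.single k 1) f x +
      ((a k).im : ℂ) * coordDeriv z (Pi.single k Complex.I) f x) := by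
  simp only [coordDeriv_eq_dFun]
  rw [coordVec_eq_sum, map_sum]
  simp [map_add]

theorem norm_coordDeriv_le {a : Fin n → ℂ} (ha : ‖a‖ ≤ 1) {f : M → ℂ} {b : ℝ}
    (h1 : ∀ k, ‖coordDeriv z (Pi.single k 1) f x‖ ≤ b)
    (h2 : ∀ k, ‖coordDeriv z (Pi.single k Complex.I) f x‖ ≤ b) :
    ‖coordDeriv z a f x‖ ≤ n * (2 * b) := by
  rw [coordDeriv_eq_sum]
  have : ∀ k ∈ (Finset.univ : Finset (Fin n)), ‖(((a k).re : ℂ) * coordDeriv z (Pi.single k 1) f x +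
      ((a k).im : ℂ) * coordDeriv z (Pi.single k Complex.I) f x)‖ ≤ 2 * b := by
    intro k _
    have hk : ‖a k‖ ≤ 1 := (norm_le_pi_norm a k).trans ha
    have hre : ‖((a k).re : ℂ)‖ ≤ 1 := by
      rw [Complex.norm_real]; exact (Complex.abs_re_le_norm _).trans hk
    have him : ‖((a k).im : ℂ)‖ ≤ 1 := by
      rw [Complex.norm_real]; exact (Complex.abs_im_le_norm _).trans hk
    refine (norm_add_le _ _).trans ?_
    rw [norm_mul, norm_mul, two_mul]
    exact add_le_add
      ((mul_le_of_le_one_left (norm_nonneg _) hre).trans (h1 k))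
      ((mul_le_of_le_one_left (norm_nonneg _) him).trans (h2 k))
  refine (norm_sum_le_of_le _ this).trans ?_
  simp

theorem CkOn.exists_norm_le {k : WithTop ℕ∞} {f : M → ℂ} (hf : CkOn n k f U) {K : Set M}
    (hK : IsCompact K) (hKU : K ⊆ U) : ∃ b, ∀ x ∈ K, ‖f x‖ ≤ b :=
  hK.exists_bound_of_continuousOn (hf.continuousOn.mono hKU)

/-- A smooth function has bounded `C²` norm on compact sets. -/
theorem exists_c2BoundOn (h : IsHolCoord J U z) {f : M → ℂ} (hf : CkOn n 2 f U) {K : Set M}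
    (hK : IsCompact K) (hKU : K ⊆ U) : ∃ b, C2BoundOn z K f b := by
  have hd : ∀ a, CkOn n 1 (coordDeriv z a f) U := fun a =>
    hf.coordDeriv h (by norm_num) one_add_one_le_infty a
  have hdd : ∀ a c, CkOn n 0 (coordDeriv z c (coordDeriv z a f)) U := fun a c =>
    (hd a).coordDeriv h (by norm_num) (by simp) c
  obtain ⟨b0, h0⟩ := hf.exists_norm_le hK hKU
  -- The 2n real coordinate directions. Continuity bounds finitely many derivatives along them on
  -- the compact set, and real linearity extends the bounds to all directions of norm at most 1.
  set e : Fin n × Bool → Fin n → ℂ := fun s => Pi.single s.1 (if s.2 then Complex.I else 1) with he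
  choose b1 h1 using fun s => (hd (e s)).exists_norm_le hK hKU
  choose b2 h2 using fun s t => (hdd (e s) (e t)).exists_norm_le hK hKU
  set β := |b0| + ∑ s, |b1 s| + ∑ s, ∑ t, |b2 s t| with hβ
  have hb1 : ∀ s, |b1 s| ≤ ∑ s, |b1 s| := fun s =>
    Finset.single_le_sum (f := fun s => |b1 s|) (fun _ _ => abs_nonneg _) (Finset.mem_univ s)
  have hb2 : ∀ s t, |b2 s t| ≤ ∑ s, ∑ t, |b2 s t| := fun s t =>
    (Finset.single_le_sum (f := fun t => |b2 s t|) (fun _ _ => abs_nonneg _)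
      (Finset.mem_univ t)).trans (Finset.single_le_sum (f := fun s => ∑ t, |b2 s t|)
        (fun _ _ => Finset.sum_nonneg fun _ _ => abs_nonneg _) (Finset.mem_univ s))
  have p1 : 0 ≤ ∑ s, |b1 s| := Finset.sum_nonneg fun _ _ => abs_nonneg _
  have p2 : 0 ≤ ∑ s, ∑ t, |b2 s t| := Finset.sum_nonneg fun _ _ =>
    Finset.sum_nonneg fun _ _ => abs_nonneg _
  have k1 : ∀ x ∈ K, ∀ s, ‖coordDeriv z (e s) f x‖ ≤ β := fun x hx s => by
    have := (h1 s x hx).trans (le_abs_self _)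
    linarith [hb1 s, abs_nonneg b0]
  have k2 : ∀ x ∈ K, ∀ s t, ‖coordDeriv z (e t) (coordDeriv z (e s) f) x‖ ≤ β := fun x hx s t => by
    have := (h2 s t x hx).trans (le_abs_self _)
    linarith [hb2 s t, abs_nonneg b0]
  have hn1 : (1 : ℝ) ≤ n := by exact_mod_cast Nat.pos_of_ne_zero (NeZero.ne n)
  have hβ0 : 0 ≤ β := by positivity
  have e1 : ∀ k, e (k, false) = Pi.single k 1 := fun k => by simp [he]
  have e2 : ∀ k, e (k, true) = Pi.single k Complex.I := fun k => by simp [he]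
  have hle : (n : ℝ) * (2 * β) ≤ n * (2 * (n * (2 * β))) := by
    have : β ≤ n * (2 * β) := by nlinarith
    gcongr
  refine ⟨n * (2 * (n * (2 * β))), fun x hx => ⟨?_, fun a ha => ?_, fun a c ha hc => ?_⟩⟩
  · have := (h0 x hx).trans (le_abs_self _)
    have h3 : |b0| ≤ β := by linarith
    nlinarith
  · refine (norm_coordDeriv_le ha (fun k => ?_) (fun k => ?_)).trans hle
    · rw [← e1]; exact k1 x hx _
    · rw [← e2]; exact k1 x hx _
  · have hxU := hKU hx
    refine norm_coordDeriv_le ha (fun k => ?_) (fun k => ?_)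
    -- The linear expansion acts on the outer direction only; exchanging the two derivatives lets it
    -- act on the other direction too.
    · rw [coordDeriv_comm h hf hxU]
      refine norm_coordDeriv_le hc (fun l => ?_) (fun l => ?_)
      · rw [← e1, ← e1]; exact k2 x hx _ _
      · rw [← e1, ← e2]; exact k2 x hx _ _
    · rw [coordDeriv_comm h hf hxU]
      refine norm_coordDeriv_le hc (fun l => ?_) (fun l => ?_)
      · rw [← e1, ← e2]; exact k2 x hx _ _
      · rw [← e2, ← e2]; exact k2 x hx _ _

end LinearCoordinates

/-! ### Algebraic inequalities behind the estimates -/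

section Inequalities

variable {n : ℕ}

/-- A quadratic lower bound in t is inherited by s, with loss only in the linear part: t ≥ s − C,
and t² has coefficient exactly 1. In the applications s = |∂w|/w and t² = T/w, with T the good term.
-/
theorem quadratic_core {C s t S : ℝ} (hC : 0 ≤ C) (hs : 0 ≤ s) (h1 : s ≤ t + C)
    (h2 : t ^ 2 - C * t - C ≤ S) : s ^ 2 - (3 * C + 2 * C ^ 2) * (1 + s) ≤ S := by
  rcases le_total C s with h | h
  · nlinarith [sq_nonneg (t - s + C - C / 2), mul_nonneg (sub_nonneg.2 h) (sub_nonneg.2 h1),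
      mul_nonneg hC hs, sq_nonneg C, mul_nonneg (sq_nonneg C) hs]
  · nlinarith [sq_nonneg (t - C / 2), mul_nonneg hC hs, sq_nonneg C, mul_nonneg (sq_nonneg C) hs,
      mul_nonneg (sub_nonneg.2 h) hs, mul_nonneg (sub_nonneg.2 h) hC]

theorem sqrt_sum_add_sq_le (p q : Fin n → ℝ) :
    √(∑ i, (p i + q i) ^ 2) ≤ √(∑ i, p i ^ 2) + √(∑ i, q i ^ 2) := by
  have := norm_add_le (WithLp.toLp 2 p : EuclideanSpace ℝ (Fin n)) (WithLp.toLp 2 q)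
  simpa [EuclideanSpace.norm_eq] using this

theorem triple_sum_sq_le {R F G : Fin n → Fin n → Fin n → ℝ} (hF : ∀ i j k, 0 ≤ F i j k)
    (hG : ∀ i j k, 0 ≤ G i j k) (h : ∀ i j k, R i j k ^ 2 = F i j k * G i j k) :
    (∑ i, ∑ j, ∑ k, R i j k) ^ 2 ≤ (∑ i, ∑ j, ∑ k, F i j k) * ∑ i, ∑ j, ∑ k, G i j k := by
  have := Finset.sum_sq_le_sum_mul_sum_of_sq_le_mul (Finset.univ : Finset (Fin n × Fin n × Fin n))
    (r := fun s => R s.1 s.2.1 s.2.2) (f := fun s => F s.1 s.2.1 s.2.2)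
    (g := fun s => G s.1 s.2.1 s.2.2) (fun s _ => hF _ _ _) (fun s _ => hG _ _ _)
    (fun s _ => (h _ _ _).le)
  simpa only [Fintype.sum_prod_type] using this

theorem sum_inv_sq_le {l : Fin n → ℝ} (hl : ∀ i, 0 < l i) {h₀ : ℝ} (hsum : ∑ i, (l i)⁻¹ ≤ h₀) :
    ∑ i, ((l i) ^ 2)⁻¹ ≤ h₀ ^ 2 := by
  have h0 : ∀ i, 0 ≤ (l i)⁻¹ := fun i => (inv_pos.2 (hl i)).le
  calc ∑ i, ((l i) ^ 2)⁻¹ = ∑ i, ((l i)⁻¹) ^ 2 := by simp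
    _ ≤ (∑ i, (l i)⁻¹) ^ 2 := Finset.sum_sq_le_sq_sum_of_nonneg fun i _ => h0 i
    _ ≤ h₀ ^ 2 := by
      have := Finset.sum_nonneg fun i (_ : i ∈ Finset.univ) => h0 i
      gcongr

/-- From bounds on `dw` and `Lw` to a bound for `L log w`. -/
theorem log_bound_of_split {l : Fin n → ℝ} {C w T S : ℝ} (hC : 0 ≤ C)
    (hw : 0 < w) (hT : 0 ≤ T) {a b wi : Fin n → ℂ} (hwi : ∀ i, wi i = a i + b i)
    (ha : ∑ i, ‖a i‖ ^ 2 * ((l i) ^ 2)⁻¹ ≤ w * T)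
    (hb : ∑ i, ‖b i‖ ^ 2 * ((l i) ^ 2)⁻¹ ≤ (C * w) ^ 2)
    (hS : T - C * √(T / w) * w - C * w ≤ S) :
    (√(∑ i, ‖wi i‖ ^ 2 * ((l i) ^ 2)⁻¹) / w) ^ 2 -
      (3 * C + 2 * C ^ 2) * (1 + √(∑ i, ‖wi i‖ ^ 2 * ((l i) ^ 2)⁻¹) / w) ≤ S / w := by
  have ht2 : √(T / w) ^ 2 = T / w := Real.sq_sqrt (by positivity)
  -- In the weighted norm ∂w splits into `a`, of size at most tw by Cauchy–Schwarz, and an error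
  -- `b`, of size at most Cw.
  refine quadratic_core (t := √(T / w)) hC (by positivity) ?_ ?_
  · rw [div_le_iff₀ hw]
    have h1 : √(∑ i, ‖wi i‖ ^ 2 * ((l i) ^ 2)⁻¹) ≤
        √(∑ i, (‖a i‖ * |(l i)⁻¹| + ‖b i‖ * |(l i)⁻¹|) ^ 2) := by
      apply Real.sqrt_le_sqrt
      refine Finset.sum_le_sum fun i _ => ?_
      have : ‖wi i‖ ≤ ‖a i‖ + ‖b i‖ := by rw [hwi]; exact norm_add_le _ _
      rw [← add_mul, mul_pow, sq_abs, inv_pow]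
      gcongr
    have h2 := sqrt_sum_add_sq_le (fun i => ‖a i‖ * |(l i)⁻¹|) (fun i => ‖b i‖ * |(l i)⁻¹|)
    simp only [mul_pow, sq_abs, inv_pow] at h2
    have h3 : √(∑ i, ‖a i‖ ^ 2 * ((l i) ^ 2)⁻¹) ≤ √(T / w) * w := by
      apply Real.sqrt_le_iff.2 ⟨by positivity, ?_⟩
      rw [mul_pow, ht2]
      refine ha.trans (le_of_eq ?_)
      field_simp
    have h4 : √(∑ i, ‖b i‖ ^ 2 * ((l i) ^ 2)⁻¹) ≤ C * w :=
      Real.sqrt_le_iff.2 ⟨by positivity, hb⟩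
    linarith
  · rw [ht2, le_div_iff₀ hw]
    have : (T / w - C * √(T / w) - C) * w = T - C * √(T / w) * w - C * w := by
      field_simp
    linarith

/-- The inequality behind the second order estimate. -/
theorem laplacian_log_bound (hn : 0 < n) {l : Fin n → ℝ} (hl : ∀ i, 0 < l i) {h₀ K : ℝ} (hK : 0 ≤ K)
    (hsum : ∑ i, (l i)⁻¹ ≤ h₀) (x : Fin n → Fin n → Fin n → ℂ) (wi : Fin n → ℂ) (S : ℝ)
    (hwi : ∀ i, ‖wi i - ∑ k, x i k k‖ ≤ K * ∑ i, l i)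
    (hS : (∑ a, ∑ b, ∑ k, ‖x a b k‖ ^ 2 * ((l a) ^ 2 * l b)⁻¹)
      - K * (∑ a, ∑ b, ∑ k, ‖x a b k‖ * (l a * l b)⁻¹)
      - K * (∑ a, ∑ b, ∑ k, ‖x a b k‖ * ((l a) ^ 2)⁻¹) - K * ∑ i, l i ≤ S) :
    (√(∑ i, ‖wi i‖ ^ 2 * ((l i) ^ 2)⁻¹) / ∑ i, l i) ^ 2 -
      (3 * (K * (1 + h₀ + 2 * n * h₀)) + 2 * (K * (1 + h₀ + 2 * n * h₀)) ^ 2) *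
        (1 + √(∑ i, ‖wi i‖ ^ 2 * ((l i) ^ 2)⁻¹) / ∑ i, l i) ≤ S / ∑ i, l i := by
  have hi0 : ∀ i, 0 < (l i)⁻¹ := fun i => inv_pos.2 (hl i)
  set w := ∑ i, l i with hw
  set T := ∑ a, ∑ b, ∑ k, ‖x a b k‖ ^ 2 * ((l a) ^ 2 * l b)⁻¹ with hT
  have hle : ∀ i, (l i)⁻¹ ≤ h₀ := fun i =>
    (Finset.single_le_sum (f := fun i => (l i)⁻¹) (fun i _ => (hi0 i).le) (Finset.mem_univ i)).trans
      hsum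
  have hlw : ∀ i, l i ≤ w := fun i =>
    Finset.single_le_sum (f := l) (fun i _ => (hl i).le) (Finset.mem_univ i)
  have hw0 : 0 < w := (hl ⟨0, hn⟩).trans_le (hlw ⟨0, hn⟩)
  have hh0 : 0 < h₀ := (hi0 ⟨0, hn⟩).trans_le (hle ⟨0, hn⟩)
  -- Each λ_i is at least 1/h₀, so w is bounded below and additive constants can be absorbed into
  -- multiples of w.
  have hwh : 1 ≤ h₀ * w := by
    have h1 := hle ⟨0, hn⟩
    have h2 := hlw ⟨0, hn⟩
    have h3 := hl ⟨0, hn⟩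
    calc (1 : ℝ) = (l ⟨0, hn⟩)⁻¹ * l ⟨0, hn⟩ := (inv_mul_cancel₀ h3.ne').symm
      _ ≤ h₀ * w := by gcongr
  have hn1 : (1 : ℝ) ≤ n := by exact_mod_cast hn
  have hT0 : 0 ≤ T := Finset.sum_nonneg fun a _ => Finset.sum_nonneg fun b _ =>
    Finset.sum_nonneg fun k _ => by have := hl a; have := hl b; positivity
  have hsq := sum_inv_sq_le hl hsum
  have ht2 : √(T / w) ^ 2 = T / w := Real.sq_sqrt (by positivity)
  have hTt : T = √(T / w) ^ 2 * w := by rw [ht2]; field_simp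
  have ht0 := Real.sqrt_nonneg (T / w)
  clear_value w T
  -- Cauchy–Schwarz against T: the complementary weights 1/λ_b sum to at most n²h₀, and one factor
  -- h₀w ≥ 1 is inserted to restore homogeneity in w.
  have r1 : (∑ a, ∑ b, ∑ k, ‖x a b k‖ * (l a * l b)⁻¹) ≤ √(T / w) * w * (n * h₀) := by
    have h1 := triple_sum_sq_le (R := fun a b k => ‖x a b k‖ * (l a * l b)⁻¹)
      (F := fun a b k => ‖x a b k‖ ^ 2 * ((l a) ^ 2 * l b)⁻¹) (G := fun _ b _ => (l b)⁻¹)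
      (fun a b k => by have := hl a; have := hl b; positivity) (fun a b k => (hi0 b).le)
      (fun a b k => by have := (hl a).ne'; have := (hl b).ne'; field_simp)
    have h2 : (∑ _a : Fin n, ∑ b, ∑ _k : Fin n, (l b)⁻¹) ≤ n * n * h₀ := by
      simp only [Finset.sum_const, Finset.card_univ, Fintype.card_fin, nsmul_eq_mul,
        ← Finset.mul_sum]
      rw [← mul_assoc]
      gcongr
    refine abs_le_of_sq_le_sq' ?_ (by positivity) |>.2
    calc _ ≤ T * ∑ _a : Fin n, ∑ b, ∑ _k : Fin n, (l b)⁻¹ := by rw [hT]; exact h1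
      _ ≤ T * (n * n * h₀ * (h₀ * w)) := by
        refine mul_le_mul_of_nonneg_left (h2.trans ?_) hT0
        exact le_mul_of_one_le_right (by positivity) hwh
      _ = _ := by
        conv_lhs => rw [hTt]
        ring
  -- Here the complementary weights are λ_b/λ_a², whose sum already contains the factor w.
  have r2 : (∑ a, ∑ b, ∑ k, ‖x a b k‖ * ((l a) ^ 2)⁻¹) ≤ √(T / w) * w * (n * h₀) := by
    have h1 := triple_sum_sq_le (R := fun a b k => ‖x a b k‖ * ((l a) ^ 2)⁻¹)
      (F := fun a b k => ‖x a b k‖ ^ 2 * ((l a) ^ 2 * l b)⁻¹)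
      (G := fun a b _ => ((l a) ^ 2)⁻¹ * l b)
      (fun a b k => by have := hl a; have := hl b; positivity)
      (fun a b k => by have := hl a; have := hl b; positivity)
      (fun a b k => by have := (hl a).ne'; have := (hl b).ne'; field_simp)
    have h2 : (∑ a : Fin n, ∑ b, ∑ _k : Fin n, ((l a) ^ 2)⁻¹ * l b) ≤ n * w * h₀ ^ 2 := by
      simp only [Finset.sum_const, Finset.card_univ, Fintype.card_fin, nsmul_eq_mul,
        ← Finset.mul_sum, ← Finset.sum_mul]
      rw [← hw, mul_assoc, mul_comm _ w]
      gcongr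
    refine abs_le_of_sq_le_sq' ?_ (by positivity) |>.2
    calc _ ≤ T * ∑ a : Fin n, ∑ b, ∑ _k : Fin n, ((l a) ^ 2)⁻¹ * l b := by rw [hT]; exact h1
      _ ≤ T * (n * w * h₀ ^ 2 * n) := by
        refine mul_le_mul_of_nonneg_left (h2.trans ?_) hT0
        exact le_mul_of_one_le_right (by positivity) hn1
      _ = _ := by
        conv_lhs => rw [hTt]
        ring
  refine log_bound_of_split (l := l) (a := fun i => ∑ k, x i k k) (b := fun i => wi i - ∑ k, x i k k)
    (T := T) (by positivity) hw0 hT0 (fun i => by ring) ?_ ?_ ?_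
  · rw [hT, Finset.mul_sum]
    refine Finset.sum_le_sum fun i _ => ?_
    -- The decisive Cauchy–Schwarz, with weights 1/λ_k and λ_k. Its constant must be exactly 1,
    -- because s² has to be dominated by T/w with coefficient 1.
    have h1 : ‖∑ k, x i k k‖ ^ 2 ≤ (∑ k, ‖x i k k‖ ^ 2 * (l k)⁻¹) * w := by
      have h2 : ‖∑ k, x i k k‖ ≤ ∑ k, ‖x i k k‖ := norm_sum_le _ _
      refine (pow_le_pow_left₀ (norm_nonneg _) h2 2).trans ?_
      rw [hw]
      refine Finset.sum_sq_le_sum_mul_sum_of_sq_le_mul _ (fun k _ => ?_) (fun k _ => (hl k).le)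
        (fun k _ => ?_)
      · have := hl k; positivity
      · have := (hl k).ne'; apply le_of_eq; field_simp
    have h3 : ∑ k, ‖x i k k‖ ^ 2 * (l k)⁻¹ ≤ ∑ b, ∑ k, ‖x i b k‖ ^ 2 * (l b)⁻¹ := by
      refine Finset.sum_le_sum fun b _ => ?_
      exact Finset.single_le_sum (f := fun k => ‖x i b k‖ ^ 2 * (l b)⁻¹)
        (fun k _ => by have := hl b; positivity) (Finset.mem_univ b)
    calc _ ≤ ((∑ b, ∑ k, ‖x i b k‖ ^ 2 * (l b)⁻¹) * w) * ((l i) ^ 2)⁻¹ := by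
          refine mul_le_mul_of_nonneg_right (h1.trans ?_) (by have := hl i; positivity)
          exact mul_le_mul_of_nonneg_right h3 hw0.le
      _ = _ := by
        rw [mul_comm _ w, mul_assoc]
        congr 1
        rw [Finset.sum_mul]
        refine Finset.sum_congr rfl fun b _ => ?_
        rw [Finset.sum_mul]
        refine Finset.sum_congr rfl fun k _ => ?_
        rw [mul_inv]
        ring
  · calc _ ≤ ∑ i, (K * w) ^ 2 * ((l i) ^ 2)⁻¹ := by
          refine Finset.sum_le_sum fun i _ => ?_
          refine mul_le_mul_of_nonneg_right ?_ (by have := hl i; positivity)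
          exact pow_le_pow_left₀ (norm_nonneg _) (hwi i) 2
      _ = (K * w) ^ 2 * ∑ i, ((l i) ^ 2)⁻¹ := by rw [Finset.mul_sum]
      _ ≤ (K * w) ^ 2 * h₀ ^ 2 := by gcongr
      _ = (K * h₀ * w) ^ 2 := by ring
      _ ≤ _ := by
        refine pow_le_pow_left₀ (by positivity) ?_ 2
        refine mul_le_mul_of_nonneg_right (mul_le_mul_of_nonneg_left ?_ hK) hw0.le
        nlinarith [mul_pos (by linarith : (0 : ℝ) < n) hh0]
  · refine le_trans ?_ hS
    have h1 := mul_le_mul_of_nonneg_left r1 hK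
    have h2 := mul_le_mul_of_nonneg_left r2 hK
    have h3 : 0 ≤ K * (1 + h₀) * (√(T / w) * w) := by positivity
    have h4 : 0 ≤ K * (h₀ + 2 * n * h₀) * w := by positivity
    have h5 : K * (1 + h₀ + 2 * n * h₀) * √(T / w) * w =
      K * (1 + h₀) * (√(T / w) * w) + 2 * (K * (√(T / w) * w * (n * h₀))) := by ring
    have h6 : K * (1 + h₀ + 2 * n * h₀) * w = K * w + K * (h₀ + 2 * n * h₀) * w := by ring
    rw [h5, h6]
    linarith

/-- The inequality behind the gradient estimate. -/
theorem gradient_log_bound (hn : 0 < n) {l : Fin n → ℝ} (hl : ∀ i, 0 < l i) {h₀ K : ℝ} (hK : 0 ≤ K)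
    (hsum : ∑ i, (l i)⁻¹ ≤ h₀) (a : Fin n → Fin n → ℂ) (g wi : Fin n → ℂ) {w S : ℝ}
    (hw : w = ∑ k, ‖g k‖ ^ 2) (hw0 : 0 < w)
    (hwi : ∀ i, ‖wi i - ∑ k, a k i * (starRingEnd ℂ) (g k)‖ ≤ K * w * (1 + l i))
    (hS : (∑ i, ∑ k, ‖a k i‖ ^ 2 * ((l i) ^ 2)⁻¹)
      - K * (∑ i, ∑ k, ∑ m, ‖a k i‖ * ‖g m‖ * ((l i) ^ 2)⁻¹) - K * w ≤ S) :
    (√(∑ i, ‖wi i‖ ^ 2 * ((l i) ^ 2)⁻¹) / w) ^ 2 -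
      (3 * (K * (1 + n * h₀ + n * (1 + h₀))) + 2 * (K * (1 + n * h₀ + n * (1 + h₀))) ^ 2) *
        (1 + √(∑ i, ‖wi i‖ ^ 2 * ((l i) ^ 2)⁻¹) / w) ≤ S / w := by
  have hi0 : ∀ i, 0 < (l i)⁻¹ := fun i => inv_pos.2 (hl i)
  set T := ∑ i, ∑ k, ‖a k i‖ ^ 2 * ((l i) ^ 2)⁻¹ with hT
  have hle : ∀ i, (l i)⁻¹ ≤ h₀ := fun i =>
    (Finset.single_le_sum (f := fun i => (l i)⁻¹) (fun i _ => (hi0 i).le) (Finset.mem_univ i)).trans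
      hsum
  have hh0 : 0 < h₀ := (hi0 ⟨0, hn⟩).trans_le (hle ⟨0, hn⟩)
  have hn1 : (1 : ℝ) ≤ n := by exact_mod_cast hn
  have hT0 : 0 ≤ T := Finset.sum_nonneg fun i _ => Finset.sum_nonneg fun k _ => by
    have := hl i; positivity
  have hsq := sum_inv_sq_le hl hsum
  have ht2 : √(T / w) ^ 2 = T / w := Real.sq_sqrt (by positivity)
  have hTt : T = √(T / w) ^ 2 * w := by rw [ht2]; field_simp
  have ht0 := Real.sqrt_nonneg (T / w)
  clear_value T
  -- Cauchy–Schwarz against T; the complementary sum of |g_m|²/λ_i² is at most n w h₀².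
  have r : (∑ i, ∑ k, ∑ m, ‖a k i‖ * ‖g m‖ * ((l i) ^ 2)⁻¹) ≤ √(T / w) * w * (n * h₀) := by
    have h1 := triple_sum_sq_le (R := fun i k m => ‖a k i‖ * ‖g m‖ * ((l i) ^ 2)⁻¹)
      (F := fun i k _ => ‖a k i‖ ^ 2 * ((l i) ^ 2)⁻¹)
      (G := fun i _ m => ‖g m‖ ^ 2 * ((l i) ^ 2)⁻¹)
      (fun i k m => by have := hl i; positivity) (fun i k m => by have := hl i; positivity)
      (fun i k m => by have := (hl i).ne'; field_simp)
    have h2 : (∑ i, ∑ k, ∑ _m : Fin n, ‖a k i‖ ^ 2 * ((l i) ^ 2)⁻¹) = n * T := by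
      rw [hT]
      simp only [Finset.sum_const, Finset.card_univ, Fintype.card_fin, nsmul_eq_mul,
        ← Finset.mul_sum]
    have h3 : (∑ i : Fin n, ∑ _k : Fin n, ∑ m, ‖g m‖ ^ 2 * ((l i) ^ 2)⁻¹) ≤ n * w * h₀ ^ 2 := by
      simp only [Finset.sum_const, Finset.card_univ, Fintype.card_fin, nsmul_eq_mul,
        ← Finset.mul_sum, ← Finset.sum_mul]
      rw [← hw, mul_assoc]
      gcongr
    refine abs_le_of_sq_le_sq' ?_ (by positivity) |>.2
    calc _ ≤ (n * T) * ∑ i : Fin n, ∑ _k : Fin n, ∑ m, ‖g m‖ ^ 2 * ((l i) ^ 2)⁻¹ := by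
          rw [← h2]; exact h1
      _ ≤ (n * T) * (n * w * h₀ ^ 2) := mul_le_mul_of_nonneg_left h3 (by positivity)
      _ = _ := by
        conv_lhs => rw [hTt]
        ring
  refine log_bound_of_split (l := l) (a := fun i => ∑ k, a k i * (starRingEnd ℂ) (g k))
    (b := fun i => wi i - ∑ k, a k i * (starRingEnd ℂ) (g k))
    (T := T) (by positivity) hw0 hT0 (fun i => by ring) ?_ ?_ ?_
  · rw [hT, Finset.mul_sum]
    refine Finset.sum_le_sum fun i _ => ?_
    -- As for the trace, the constant in this Cauchy–Schwarz inequality must be 1; now w itself is Σ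
    -- |g_k|².
    have h1 : ‖∑ k, a k i * (starRingEnd ℂ) (g k)‖ ^ 2 ≤ (∑ k, ‖a k i‖ ^ 2) * w := by
      have h2 : ‖∑ k, a k i * (starRingEnd ℂ) (g k)‖ ≤ ∑ k, ‖a k i‖ * ‖g k‖ := by
        refine (norm_sum_le _ _).trans (le_of_eq ?_)
        simp
      refine (pow_le_pow_left₀ (norm_nonneg _) h2 2).trans ?_
      rw [hw]
      refine Finset.sum_sq_le_sum_mul_sum_of_sq_le_mul _ (fun k _ => sq_nonneg ‖a k i‖)
        (fun k _ => sq_nonneg ‖g k‖) (fun k _ => (mul_pow _ _ _).le)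
    calc _ ≤ ((∑ k, ‖a k i‖ ^ 2) * w) * ((l i) ^ 2)⁻¹ :=
          mul_le_mul_of_nonneg_right h1 (by have := hl i; positivity)
      _ = _ := by
        rw [← Finset.sum_mul]
        ring
  · have h1 : ∀ i, ‖wi i - ∑ k, a k i * (starRingEnd ℂ) (g k)‖ ^ 2 * ((l i) ^ 2)⁻¹ ≤
        (K * w * (1 + h₀)) ^ 2 := by
      intro i
      have h2 : (1 + l i) * (l i)⁻¹ ≤ 1 + h₀ := by
        rw [add_mul, one_mul, mul_inv_cancel₀ (hl i).ne']
        linarith [hle i]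
      calc _ ≤ (K * w * (1 + l i)) ^ 2 * ((l i) ^ 2)⁻¹ := by
            refine mul_le_mul_of_nonneg_right ?_ (by have := hl i; positivity)
            exact pow_le_pow_left₀ (norm_nonneg _) (hwi i) 2
        _ = (K * w * ((1 + l i) * (l i)⁻¹)) ^ 2 := by rw [← inv_pow]; ring
        _ ≤ _ := by
          have := hl i
          gcongr
    calc _ ≤ ∑ _i : Fin n, (K * w * (1 + h₀)) ^ 2 := Finset.sum_le_sum fun i _ => h1 i
      _ = n * (K * w * (1 + h₀)) ^ 2 := by simp
      _ ≤ (n * (K * w * (1 + h₀))) ^ 2 := by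
        rw [mul_pow (n : ℝ)]
        exact mul_le_mul_of_nonneg_right (by nlinarith) (sq_nonneg _)
      _ ≤ _ := by
        refine pow_le_pow_left₀ (by positivity) ?_ 2
        have : 0 ≤ K * (1 + n * h₀) * w := by positivity
        linarith
  · refine le_trans ?_ hS
    have h1 := mul_le_mul_of_nonneg_left r hK
    have h3 : 0 ≤ K * (1 + n * (1 + h₀)) * (√(T / w) * w) := by positivity
    have h4 : 0 ≤ K * (n * h₀ + n * (1 + h₀)) * w := by positivity
    have h5 : K * (1 + n * h₀ + n * (1 + h₀)) * √(T / w) * w =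
      K * (1 + n * (1 + h₀)) * (√(T / w) * w) + K * (√(T / w) * w * (n * h₀)) := by ring
    have h6 : K * (1 + n * h₀ + n * (1 + h₀)) * w = K * w + K * (n * h₀ + n * (1 + h₀)) * w := by
      ring
    rw [h5, h6]
    linarith

open Matrix in
/-- For a positive definite matrix `A`: `A_ii - 2 λ + λ² (A⁻¹)_ii ≥ 0`. -/
theorem posDef_diag_inv {A : Matrix (Fin n) (Fin n) ℂ} (hA : A.PosDef) (i : Fin n) (r : ℝ) :
    0 ≤ (A i i).re - 2 * r + r ^ 2 * (A⁻¹ i i).re := by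
  have hAd : IsUnit A.det := (Matrix.isUnit_iff_isUnit_det A).1 hA.isUnit
  set e : Fin n → ℂ := Pi.single i 1 with he
  -- The claim is nonnegativity of the form A on e − r A⁻¹e.
  set v : Fin n → ℂ := e - (r : ℂ) • (A⁻¹ *ᵥ e) with hv
  have h1 := hA.posSemidef.re_dotProduct_nonneg v
  have h2 : A *ᵥ v = A *ᵥ e - (r : ℂ) • e := by
    rw [hv, mulVec_sub, mulVec_smul, mulVec_mulVec, mul_nonsing_inv _ hAd, one_mulVec]
  have hinv : (A⁻¹)ᴴ = A⁻¹ := hA.1.inv.eq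
  have h3 : star v = star e - (r : ℂ) • (star e ᵥ* A⁻¹) := by
    rw [hv, star_sub, star_smul, star_mulVec, hinv]
    simp
  have hse : star e = e := by
    rw [he]; funext j
    by_cases h : j = i
    · subst h; simp
    · simp [Pi.single_eq_of_ne h]
  have h4 : star v ⬝ᵥ (A *ᵥ v) = A i i - (r : ℂ) - (r : ℂ) * (1 - (r : ℂ) * A⁻¹ i i) := by
    rw [h2, h3, hse, sub_dotProduct, dotProduct_sub, smul_dotProduct, dotProduct_sub,
      ← dotProduct_mulVec, mulVec_mulVec, nonsing_inv_mul _ hAd, one_mulVec, dotProduct_smul,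
      dotProduct_smul, ← dotProduct_mulVec, he]
    simp [single_dotProduct]
  rw [h4] at h1
  have h5 : RCLike.re (A i i - (r : ℂ) - (r : ℂ) * (1 - (r : ℂ) * A⁻¹ i i)) =
      (A i i).re - 2 * r + r ^ 2 * (A⁻¹ i i).re := by
    simp
    ring
  rw [h5] at h1
  exact h1

/-- The strict positivity of the linearized operator on `v - u`. -/
theorem linearized_lower_bound {l : Fin n → ℝ} (hl : ∀ i, 0 < l i)
    {A : Matrix (Fin n) (Fin n) ℂ} (hA : A.PosDef) (htr : (A⁻¹).trace.re ≤ ∑ i, (l i)⁻¹) :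
    0 ≤ ∑ i, ((A i i).re - l i) * ((l i) ^ 2)⁻¹ ∧
      ∀ m, ∀ K : ℝ, (A m m).re ≤ K →
        K⁻¹ - 2 * (l m)⁻¹ ≤ ∑ i, ((A i i).re - l i) * ((l i) ^ 2)⁻¹ := by
  -- `posDef_diag_inv` with r = λ_i, divided by λ_i²: the tangent inequality for the convex function
  -- X ↦ tr X⁻¹ at diag(λ_i), one index at a time.
  have hterm : ∀ i, (l i)⁻¹ - (A⁻¹ i i).re ≤ ((A i i).re - l i) * ((l i) ^ 2)⁻¹ := by
    intro i
    have h1 := posDef_diag_inv hA i (l i)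
    have h2 : 0 < ((l i) ^ 2)⁻¹ := by have := hl i; positivity
    have h3 := mul_nonneg h1 h2.le
    have h4 : (l i)⁻¹ = l i * ((l i) ^ 2)⁻¹ := by have := (hl i).ne'; field_simp
    have h5 : (l i) ^ 2 * ((l i) ^ 2)⁻¹ = 1 := mul_inv_cancel₀ (by have := hl i; positivity)
    rw [h4]
    have h6 : ((A i i).re - 2 * l i + l i ^ 2 * (A⁻¹ i i).re) * ((l i) ^ 2)⁻¹ =
      ((A i i).re - l i) * ((l i) ^ 2)⁻¹ - l i * ((l i) ^ 2)⁻¹ +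
        (l i) ^ 2 * ((l i) ^ 2)⁻¹ * (A⁻¹ i i).re := by ring
    rw [h6, h5] at h3
    linarith
  have htr' : ∑ i, (A⁻¹ i i).re ≤ ∑ i, (l i)⁻¹ := by
    simpa [Matrix.trace] using htr
  constructor
  · have h1 := Finset.sum_le_sum fun i (_ : i ∈ Finset.univ) => hterm i
    rw [Finset.sum_sub_distrib] at h1
    linarith
  · intro m K hmK
    have hApos : 0 < (A m m).re := (Complex.pos_iff.1 hA.diag_pos).1
    have hK : 0 < K := hApos.trans_le hmK
    have h1 := Finset.sum_le_sum fun i (_ : i ∈ Finset.univ.erase m) => hterm i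
    rw [Finset.sum_sub_distrib] at h1
    have e1 := Finset.add_sum_erase Finset.univ (fun i => ((A i i).re - l i) * ((l i) ^ 2)⁻¹)
      (Finset.mem_univ m)
    have e2 := Finset.add_sum_erase Finset.univ (fun i => (l i)⁻¹) (Finset.mem_univ m)
    have e3 := Finset.add_sum_erase Finset.univ (fun i => (A⁻¹ i i).re) (Finset.mem_univ m)
    -- `posDef_diag_inv` with r = K: since A_mm ≤ K, it leaves K ≤ K² (A⁻¹)_mm.
    have h2 : K⁻¹ ≤ (A⁻¹ m m).re := by
      have h3 := posDef_diag_inv hA m K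
      have h4 : K ≤ K ^ 2 * (A⁻¹ m m).re := by linarith
      rw [inv_eq_one_div, div_le_iff₀ hK]
      nlinarith
    -- For the index m the tangent inequality is replaced by the crude bound A_mm > 0. The term
    -- (A⁻¹)_mm ≥ 1/K is thereby gained, at the price of 2/λ_m.
    have h3 : -(l m)⁻¹ ≤ ((A m m).re - l m) * ((l m) ^ 2)⁻¹ := by
      have h4 : (l m)⁻¹ = l m * ((l m) ^ 2)⁻¹ := by have := (hl m).ne'; field_simp
      have h5 : 0 ≤ (A m m).re * ((l m) ^ 2)⁻¹ := by positivity
      rw [h4]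
      linarith
    linarith

end Inequalities

/-! ### The equation differentiated once and twice -/

section Identities

open Matrix

variable {n : ℕ} [NeZero n] {M : Type*} [TopologicalSpace M]
  [ChartedSpace (EuclideanHalfSpace (2 * n)) M] [IsManifold (𝓡∂ (2 * n)) ∞ M]
  {J : ∀ x : M, Tan n x →ₗ[ℝ] Tan n x} {U : Set M} {z : M → Fin n → ℂ} {p : M}
  {X Y G : M → Matrix (Fin n) (Fin n) ℂ} {h : M → ℂ} {l : Fin n → ℝ}

theorem inv_eq_diagonal (hl : ∀ i, 0 < l i) (hXp : X p = diagonal fun i => (l i : ℂ))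
    (hXY : X p * Y p = 1) : Y p = diagonal fun i => ((l i : ℂ))⁻¹ := by
  have h1 : diagonal (fun i => ((l i : ℂ))⁻¹) * X p = 1 := by
    rw [hXp, diagonal_mul_diagonal, ← diagonal_one]
    congr 1
    funext i
    exact inv_mul_cancel₀ (by exact_mod_cast (hl i).ne')
  calc Y p = (diagonal (fun i => ((l i : ℂ))⁻¹) * X p) * Y p := by rw [h1, Matrix.one_mul]
    _ = _ := by rw [Matrix.mul_assoc, hXY, Matrix.mul_one]

/-- The first derivatives of the inverse matrix. -/
theorem wirt_inv (hz : IsHolCoord J U z) (hp : p ∈ U) (hl : ∀ i, 0 < l i)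
    (hX : ∀ i j, CkOn n 1 (fun x => X x i j) U) (hY : ∀ i j, CkOn n 1 (fun x => Y x i j) U)
    (hXY : ∀ x ∈ U, X x * Y x = 1) (hXp : X p = diagonal fun i => (l i : ℂ)) (c : ℂ)
    (k a b : Fin n) : wirt z c k (fun x => Y x a b) p =
      -(wirt z c k (fun x => X x a b) p * ((l a : ℂ)⁻¹ * (l b : ℂ)⁻¹)) := by
  have hYp := inv_eq_diagonal hl hXp (hXY p hp)
  have h1 : wirt z c k (fun x => ∑ m, X x a m * Y x m b) p = 0 := by
    rw [wirt_congr_on hz.isOpen (g := fun _ => (1 : Matrix (Fin n) (Fin n) ℂ) a b) (fun y hy => by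
      rw [← hXY y hy, Matrix.mul_apply]) hp, wirt_const]
  rw [wirt_sum hz.isOpen (fun m _ => (hX a m).mul (hY m b)) le_rfl hp] at h1
  simp only [wirt_mul hz.isOpen (hX _ _) (hY _ _) le_rfl hp, hXp, hYp, diagonal_apply] at h1
  rw [Finset.sum_add_distrib] at h1
  simp only [mul_ite, mul_zero, ite_mul, zero_mul, Finset.sum_ite_eq, Finset.sum_ite_eq',
    Finset.mem_univ, if_true] at h1
  have hla : (l a : ℂ) ≠ 0 := by exact_mod_cast (hl a).ne'
  field_simp at h1 ⊢
  linear_combination h1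

/-- The once differentiated equation `tr (X⁻¹ G) = h`. -/
theorem wirt_trace_eq (hz : IsHolCoord J U z) (hp : p ∈ U) (hl : ∀ i, 0 < l i)
    (hX : ∀ i j, CkOn n 1 (fun x => X x i j) U) (hY : ∀ i j, CkOn n 1 (fun x => Y x i j) U)
    (hG : ∀ i j, CkOn n 1 (fun x => G x i j) U)
    (hXY : ∀ x ∈ U, X x * Y x = 1) (hXp : X p = diagonal fun i => (l i : ℂ)) (hGp : G p = 1)
    (hh : ∀ x ∈ U, (Y x * G x).trace = h x) (c : ℂ) (k : Fin n) :
    ∑ a, wirt z c k (fun x => X x a a) p * ((l a : ℂ) ^ 2)⁻¹ =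
      ∑ a, wirt z c k (fun x => G x a a) p * (l a : ℂ)⁻¹ - wirt z c k h p := by
  have hYp := inv_eq_diagonal hl hXp (hXY p hp)
  have h1 : wirt z c k (fun x => ∑ a, ∑ b, Y x a b * G x b a) p = wirt z c k h p :=
    wirt_congr_on hz.isOpen (fun y hy => by
      rw [← hh y hy]; simp [Matrix.trace, Matrix.mul_apply]) hp c k
  rw [wirt_sum hz.isOpen (fun a _ => CkOn.sum fun b _ => (hY a b).mul (hG b a)) le_rfl hp] at h1
  simp only [wirt_sum hz.isOpen (fun b _ => (hY _ b).mul (hG b _)) le_rfl hp,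
    wirt_mul hz.isOpen (hY _ _) (hG _ _) le_rfl hp, wirt_inv hz hp hl hX hY hXY hXp, hGp, hYp,
    diagonal_apply, Matrix.one_apply] at h1
  simp only [mul_ite, mul_zero, ite_mul, zero_mul, mul_one, Finset.sum_add_distrib,
    Finset.sum_ite_eq, Finset.sum_ite_eq', Finset.mem_univ, if_true] at h1
  rw [← h1, Finset.sum_neg_distrib]
  have h2 : ∀ a, ((l a : ℂ) ^ 2)⁻¹ = (l a : ℂ)⁻¹ * (l a : ℂ)⁻¹ := fun a => by
    rw [pow_two, mul_inv]
  simp only [h2, mul_comm _ (l _ : ℂ)⁻¹]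
  ring

/-- The twice differentiated equation `tr (X⁻¹ G) = h`. -/
theorem wirt_wirt_trace_eq (hz : IsHolCoord J U z) (hp : p ∈ U) (hl : ∀ i, 0 < l i)
    (hX : ∀ i j, CkOn n 2 (fun x => X x i j) U) (hY : ∀ i j, CkOn n 2 (fun x => Y x i j) U)
    (hG : ∀ i j, CkOn n 2 (fun x => G x i j) U)
    (hXY : ∀ x ∈ U, X x * Y x = 1) (hXp : X p = diagonal fun i => (l i : ℂ)) (hGp : G p = 1)
    (hh : ∀ x ∈ U, (Y x * G x).trace = h x) (c c' : ℂ) (k : Fin n) :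
    ∑ a, wirt z c k (wirt z c' k fun x => X x a a) p * ((l a : ℂ) ^ 2)⁻¹ =
      ∑ a, ∑ b, (wirt z c' k (fun x => X x a b) p * wirt z c k (fun x => X x b a) p +
        wirt z c k (fun x => X x a b) p * wirt z c' k (fun x => X x b a) p) *
          ((l a : ℂ) ^ 2 * l b)⁻¹
      - ∑ a, ∑ b, (wirt z c' k (fun x => X x a b) p * wirt z c k (fun x => G x b a) p +
        wirt z c k (fun x => X x a b) p * wirt z c' k (fun x => G x b a) p) * ((l a : ℂ) * l b)⁻¹
      + ∑ a, wirt z c k (wirt z c' k fun x => G x a a) p * (l a : ℂ)⁻¹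
      - wirt z c k (wirt z c' k h) p := by
  have hYp := inv_eq_diagonal hl hXp (hXY p hp)
  have h12 : (1 : WithTop ℕ∞) ≤ 2 := by norm_num
  have hX1 : ∀ i j, CkOn n 1 (fun x => X x i j) U := fun i j => (hX i j).of_le h12
  have hY1 : ∀ i j, CkOn n 1 (fun x => Y x i j) U := fun i j => (hY i j).of_le h12
  have hinv := fun c => wirt_inv (z := z) hz hp hl hX1 hY1 hXY hXp c
  -- second derivatives of the diagonal entries of the inverse
  have hY2 : ∀ a, wirt z c k (wirt z c' k fun x => Y x a a) p =
      ∑ b, (wirt z c' k (fun x => X x a b) p * wirt z c k (fun x => X x b a) p +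
        wirt z c k (fun x => X x a b) p * wirt z c' k (fun x => X x b a) p) *
          ((l a : ℂ) ^ 2 * l b)⁻¹
      - wirt z c k (wirt z c' k fun x => X x a a) p * ((l a : ℂ) ^ 2)⁻¹ := by
    intro a
    -- Differentiating XY = 1 twice and evaluating where both matrices are diagonal expresses the
    -- second derivatives of the inverse by those of X and quadratic terms in its first derivatives.
    have h1 : wirt z c k (wirt z c' k fun x => ∑ m, X x a m * Y x m a) p = 0 := by
      rw [wirt_congr_on hz.isOpen (g := fun _ => (0 : ℂ)) (fun y hy => ?_) hp, wirt_const]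
      rw [wirt_congr_on hz.isOpen (g := fun _ => (1 : Matrix (Fin n) (Fin n) ℂ) a a) (fun y hy => by
        rw [← hXY y hy, Matrix.mul_apply]) hy, wirt_const]
    rw [wirt_wirt_sum hz (fun m _ => (hX a m).mul (hY m a)) hp] at h1
    simp only [wirt_wirt_mul hz (hX _ _) (hY _ _) hp, hXp, hYp, diagonal_apply, hinv] at h1
    simp only [mul_ite, mul_zero, ite_mul, zero_mul, Finset.sum_add_distrib,
      Finset.sum_ite_eq, Finset.sum_ite_eq', Finset.mem_univ, if_true] at h1
    have hla : (l a : ℂ) ≠ 0 := by exact_mod_cast (hl a).ne'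
    have h3 : ∑ b, (wirt z c' k (fun x => X x a b) p * wirt z c k (fun x => X x b a) p +
        wirt z c k (fun x => X x a b) p * wirt z c' k (fun x => X x b a) p) *
          ((l a : ℂ) ^ 2 * l b)⁻¹ = (l a : ℂ)⁻¹ * -(
        (∑ m, wirt z c' k (fun x => X x a m) p *
          -(wirt z c k (fun x => X x m a) p * ((l m : ℂ)⁻¹ * (l a : ℂ)⁻¹))) +
        ∑ m, wirt z c k (fun x => X x a m) p *
          -(wirt z c' k (fun x => X x m a) p * ((l m : ℂ)⁻¹ * (l a : ℂ)⁻¹))) := by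
      rw [← Finset.sum_add_distrib, ← Finset.sum_neg_distrib, Finset.mul_sum]
      refine Finset.sum_congr rfl fun b _ => ?_
      rw [mul_inv, pow_two, mul_inv]
      ring
    rw [h3]
    have h4 : ((l a : ℂ) ^ 2)⁻¹ = (l a : ℂ)⁻¹ * (l a : ℂ)⁻¹ := by rw [pow_two, mul_inv]
    rw [h4]
    have h5 : (l a : ℂ)⁻¹ * (l a : ℂ) = 1 := inv_mul_cancel₀ hla
    linear_combination (l a : ℂ)⁻¹ * h1 -
      wirt z c k (wirt z c' k fun x => Y x a a) p * h5
  have h1 : wirt z c k (wirt z c' k fun x => ∑ a, ∑ b, Y x a b * G x b a) p =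
      wirt z c k (wirt z c' k h) p :=
    wirt_congr_on hz.isOpen (fun y hy => wirt_congr_on hz.isOpen (fun y hy => by
      rw [← hh y hy]; simp [Matrix.trace, Matrix.mul_apply]) hy c' k) hp c k
  rw [wirt_wirt_sum hz (fun a _ => CkOn.sum fun b _ => (hY a b).mul (hG b a)) hp] at h1
  simp only [wirt_wirt_sum hz (fun b _ => (hY _ b).mul (hG b _)) hp,
    wirt_wirt_mul hz (hY _ _) (hG _ _) hp, hinv, hGp, hYp,
    diagonal_apply, Matrix.one_apply] at h1
  simp only [mul_ite, mul_zero, ite_mul, zero_mul, mul_one, Finset.sum_add_distrib,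
    Finset.sum_ite_eq, Finset.sum_ite_eq', Finset.mem_univ, if_true, hY2,
    Finset.sum_sub_distrib] at h1
  have h6 : ∑ a, ∑ b, (wirt z c' k (fun x => X x a b) p * wirt z c k (fun x => G x b a) p +
        wirt z c k (fun x => X x a b) p * wirt z c' k (fun x => G x b a) p) * ((l a : ℂ) * l b)⁻¹ =
      -((∑ a, ∑ b, -(wirt z c' k (fun x => X x a b) p * ((l a : ℂ)⁻¹ * (l b : ℂ)⁻¹)) *
          wirt z c k (fun x => G x b a) p) +
        ∑ a, ∑ b, -(wirt z c k (fun x => X x a b) p * ((l a : ℂ)⁻¹ * (l b : ℂ)⁻¹)) *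
          wirt z c' k (fun x => G x b a) p) := by
    rw [← Finset.sum_add_distrib, ← Finset.sum_neg_distrib]
    refine Finset.sum_congr rfl fun a _ => ?_
    rw [← Finset.sum_add_distrib, ← Finset.sum_neg_distrib]
    refine Finset.sum_congr rfl fun b _ => ?_
    rw [mul_inv]
    ring
  have h7 : ∑ a, (l a : ℂ)⁻¹ * wirt z c k (wirt z c' k fun x => G x a a) p =
      ∑ a, wirt z c k (wirt z c' k fun x => G x a a) p * (l a : ℂ)⁻¹ :=
    Finset.sum_congr rfl fun _ _ => mul_comm _ _
  rw [h6, ← h1, ← h7]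
  ring

/-- The first and second derivatives of `tr (H X)` at a point where `H = 1` and `X` is diagonal. -/
theorem wirt_trace_mul {H : M → Matrix (Fin n) (Fin n) ℂ} (hz : IsHolCoord J U z) (hp : p ∈ U)
    (hH : ∀ i j, CkOn n 2 (fun x => H x i j) U) (hX : ∀ i j, CkOn n 2 (fun x => X x i j) U)
    (hHp : H p = 1) (c c' : ℂ) (i : Fin n) :
    (wirt z c i (fun x => (H x * X x).trace) p = ∑ k, wirt z c i (fun x => X x k k) p +
      ∑ k, ∑ m, wirt z c i (fun x => H x k m) p * X p m k) ∧
    wirt z c i (wirt z c' i fun x => (H x * X x).trace) p =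
      ∑ k, wirt z c i (wirt z c' i fun x => X x k k) p +
      ∑ k, ∑ m, (wirt z c' i (fun x => H x k m) p * wirt z c i (fun x => X x m k) p +
        wirt z c i (fun x => H x k m) p * wirt z c' i (fun x => X x m k) p) +
      ∑ k, ∑ m, wirt z c i (wirt z c' i fun x => H x k m) p * X p m k := by
  have h12 : (1 : WithTop ℕ∞) ≤ 2 := by norm_num
  have e : (fun x => (H x * X x).trace) = fun x => ∑ k, ∑ m, H x k m * X x m k := by
    funext x
    simp [Matrix.trace, Matrix.mul_apply]
  rw [e]
  constructor
  · rw [wirt_sum hz.isOpen (fun a _ => CkOn.sum fun b _ => (hH a b).mul (hX b a)) h12 hp]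
    simp only [wirt_sum hz.isOpen (fun b _ => (hH _ b).mul (hX b _)) h12 hp,
      wirt_mul hz.isOpen (hH _ _) (hX _ _) h12 hp, hHp, Matrix.one_apply]
    simp only [ite_mul, zero_mul, one_mul, Finset.sum_add_distrib,
      Finset.sum_ite_eq, Finset.mem_univ, if_true]
    ring
  · rw [wirt_wirt_sum hz (fun a _ => CkOn.sum fun b _ => (hH a b).mul (hX b a)) hp]
    simp only [wirt_wirt_sum hz (fun b _ => (hH _ b).mul (hX b _)) hp,
      wirt_wirt_mul hz (hH _ _) (hX _ _) hp, hHp, Matrix.one_apply]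
    simp only [ite_mul, zero_mul, one_mul, Finset.sum_add_distrib,
      Finset.sum_ite_eq, Finset.mem_univ, if_true]
    ring

end Identities

/-! ### Normal frames and exchange of derivatives -/

section Frame

open Matrix

variable {n : ℕ} [NeZero n] {M : Type*} [TopologicalSpace M]
  [ChartedSpace (EuclideanHalfSpace (2 * n)) M] [IsManifold (𝓡∂ (2 * n)) ∞ M]
  {𝒥 : ComplexStructure n M}

/-- Holomorphic coordinates near `p` in which, at `p`, the metric is the identity and `χ_u` is
diagonal, with bounds for the other data of the equation. -/
structure NormalFrame (Ω : HermitianMetric 𝒥) (χ : RealOneOneForm 𝒥) (ψ u : M → ℝ) (U : Set M)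
    (z : M → Fin n → ℂ) (p : M) (l : Fin n → ℝ) (K : ℝ) : Prop where
  coord : IsHolCoord 𝒥.J U z
  mem : p ∈ U
  one_le : 1 ≤ K
  pos : ∀ i, 0 < l i
  metric : components Ω.form z p = 1
  form : chiComp χ u z p = diagonal fun i => (l i : ℂ)
  c2_metric : ∀ i j, C2At z p (fun x => components Ω.form z x i j) K
  c2_inv : ∀ i j, C2At z p (fun x => (components Ω.form z x)⁻¹ i j) K
  c2_form : ∀ i j, C2At z p (fun x => components χ.form z x i j) K
  c2_rhs : C2At z p (fun x => (n : ℂ) * (ψ x : ℂ)⁻¹) K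

theorem three_le_infty : (2 : WithTop ℕ∞) + 1 ≤ ∞ := by
  have h1 : (2 : WithTop ℕ∞) + 1 = 3 := by norm_num
  have h2 : ((3 : ℕ∞) : WithTop ℕ∞) ≤ ∞ := by exact_mod_cast le_top
  rw [h1]
  exact h2

theorem four_le_infty : (3 : WithTop ℕ∞) + 1 ≤ ∞ := by
  have h1 : (3 : WithTop ℕ∞) + 1 = 4 := by norm_num
  have h2 : ((4 : ℕ∞) : WithTop ℕ∞) ≤ ∞ := by exact_mod_cast le_top
  rw [h1]
  exact h2

theorem two_add_two_le_infty : (2 : WithTop ℕ∞) + 2 ≤ ∞ := by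
  have h1 : (2 : WithTop ℕ∞) + 2 = 3 + 1 := by norm_num
  rw [h1]
  exact four_le_infty

theorem CkOn.chiComp {χ : RealOneOneForm 𝒥} {u : M → ℝ} {U : Set M} {z : M → Fin n → ℂ}
    (h : IsHolCoord 𝒥.J U z) (hu : IsCk n 4 u) (i j : Fin n) :
    CkOn n 2 (fun x => HermitianMA.chiComp χ u z x i j) U :=
  ((χ.smooth U z h i j : CkOn n ∞ _ U).of_le two_le_infty).add
    ((IsCk.ofReal hu U).complexHessian h (by norm_num) two_add_two_le_infty i j)

theorem wirt_conj_of_hermitian {U : Set M} {z : M → Fin n → ℂ} {p : M} (hU : IsOpen U) (hp : p ∈ U)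
    {X : M → Matrix (Fin n) (Fin n) ℂ} (hX : ∀ i j, CkOn n 2 (fun x => X x i j) U)
    (hXh : ∀ x ∈ U, (X x).IsHermitian) (k a b : Fin n) :
    wirt z Complex.I k (fun x => X x a b) p =
      (starRingEnd ℂ) (wirt z (-Complex.I) k (fun x => X x b a) p) := by
  have h1 := wirt_conj (z := z) hU (hX b a) (by norm_num) hp Complex.I k
  rw [Complex.conj_I] at h1
  rw [← h1]
  exact wirt_congr_on hU (fun y hy => ((hXh y hy).apply a b).symm) hp _ _

theorem wirt_three_comm {J : ∀ x : M, Tan n x →ₗ[ℝ] Tan n x} {U : Set M} {z : M → Fin n → ℂ} {p : M}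
    (hz : IsHolCoord J U z) (hp : p ∈ U) {f : M → ℂ} (hf : CkOn n 3 f U) (c₁ c₂ c₃ : ℂ)
    (i j k : Fin n) : wirt z c₁ i (wirt z c₂ j (wirt z c₃ k f)) p =
      wirt z c₃ k (wirt z c₁ i (wirt z c₂ j f)) p := by
  have h2 : CkOn n 2 f U := hf.of_le (by norm_num)
  rw [wirt_congr_on hz.isOpen (fun y hy => wirt_comm hz h2 hy c₂ c₃ j k) hp,
    wirt_comm hz (hf.wirt hz (by norm_num) three_le_infty c₂ j) hp]

/-- The fourth derivatives in ∂_i ∂̄_i u_{k k̄} are symmetric under exchange of i and k. This makes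
the twice differentiated equation applicable to L of the trace. -/
theorem wirt_four_comm {J : ∀ x : M, Tan n x →ₗ[ℝ] Tan n x} {U : Set M} {z : M → Fin n → ℂ} {p : M}
    (hz : IsHolCoord J U z) (hp : p ∈ U) {f : M → ℂ} (hf : CkOn n 4 f U) (c c' : ℂ)
    (i k : Fin n) : wirt z c i (wirt z c' i (wirt z c k (wirt z c' k f))) p =
      wirt z c k (wirt z c' k (wirt z c i (wirt z c' i f))) p := by
  have h3 : ∀ c k, CkOn n 3 (wirt z c k f) U := fun c k => hf.wirt hz (by norm_num) four_le_infty c k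
  have h4 : CkOn n 3 f U := hf.of_le (by norm_num)
  rw [wirt_three_comm hz hp (h3 c' k) c c' c i i k]
  refine wirt_congr_on hz.isOpen (fun y hy => ?_) hp c k
  exact wirt_three_comm hz hy h4 c c' c' i i k

namespace NormalFrame

variable {Ω : HermitianMetric 𝒥} {χ : RealOneOneForm 𝒥} {ψ u : M → ℝ} {U : Set M}
  {z : M → Fin n → ℂ} {p : M} {l : Fin n → ℝ} {K : ℝ}

theorem trace_eq (F : NormalFrame Ω χ ψ u U z p l K) (hu : IsCk n 4 u) (hψ : ∀ x, 0 < ψ x)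
    (hsol : IsSolution Ω χ ψ u) : ∀ x ∈ U,
      ((chiComp χ u z x)⁻¹ * components Ω.form z x).trace = (n : ℂ) * (ψ x : ℂ)⁻¹ := by
  intro x hx
  have h1 := hsol.trace_eq (hu.of_le (by norm_num)) F.coord hx
  have h2 : (ψ x : ℂ) ≠ 0 := by exact_mod_cast (hψ x).ne'
  rw [← h1]
  field_simp

theorem sum_inv_eq (F : NormalFrame Ω χ ψ u U z p l K) (hu : IsCk n 4 u) (hψ : ∀ x, 0 < ψ x)
    (hsol : IsSolution Ω χ ψ u) : ∑ i, (l i)⁻¹ = n * (ψ p)⁻¹ := by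
  have h1 := F.trace_eq hu hψ hsol p F.mem
  have hX := inv_eq_diagonal (X := chiComp χ u z) (Y := fun x => (chiComp χ u z x)⁻¹) F.pos F.form
    (mul_nonsing_inv _ ((Matrix.isUnit_iff_isUnit_det _).1
      (chiComp_posDef χ (hu.of_le (by norm_num)) (hsol p).1 F.coord F.mem).isUnit))
  rw [F.metric, Matrix.mul_one, hX, trace_diagonal] at h1
  exact_mod_cast h1

/-- The equation at `p`, with n/ψ bounded, makes all eigenvalues of χ_u bounded below. No upper
bound is available yet. -/
theorem sum_inv_le (F : NormalFrame Ω χ ψ u U z p l K) (hu : IsCk n 4 u) (hψ : ∀ x, 0 < ψ x)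
    (hsol : IsSolution Ω χ ψ u) : ∑ i, (l i)⁻¹ ≤ K := by
  rw [F.sum_inv_eq hu hψ hsol]
  have h1 := (c2At_iff.1 F.c2_rhs).1
  have h2 : ((n : ℂ) * (ψ p : ℂ)⁻¹) = (((n : ℝ) * (ψ p)⁻¹ : ℝ) : ℂ) := by push_cast; ring
  rw [h2, Complex.norm_real] at h1
  exact (le_abs_self _).trans h1

/-- The exchange of indices in the first derivatives of `χ_u`. -/
theorem norm_swap_le (F : NormalFrame Ω χ ψ u U z p l K) (hu : IsCk n 4 u) (k m i : Fin n) :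
    ‖wirt z (-Complex.I) i (fun x => chiComp χ u z x k m) p -
      wirt z (-Complex.I) k (fun x => chiComp χ u z x i m) p‖ ≤ 2 * K := by
  have hE : ∀ i j, CkOn n 2 (fun x => components χ.form z x i j) U := fun i j =>
    (χ.smooth U z F.coord i j : CkOn n ∞ _ U).of_le two_le_infty
  have huU : CkOn n 4 (fun x => (u x : ℂ)) U := IsCk.ofReal hu U
  have hD : ∀ i j, CkOn n 2 (fun x => complexHessian z u x i j) U := fun i j =>
    huU.complexHessian F.coord (by norm_num) two_add_two_le_infty i j
  have h3 : CkOn n 3 (wirt z Complex.I m fun x => (u x : ℂ)) U :=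
    huU.wirt F.coord (by norm_num) four_le_infty _ _
  have e : ∀ a b c, wirt z (-Complex.I) c (fun x => chiComp χ u z x a b) p =
      wirt z (-Complex.I) c (fun x => components χ.form z x a b) p +
      wirt z (-Complex.I) c (wirt z (-Complex.I) a (wirt z Complex.I b fun x => (u x : ℂ))) p := by
    intro a b c
    have h4 : (fun x => complexHessian z u x a b) =
        wirt z (-Complex.I) a (wirt z Complex.I b fun x => (u x : ℂ)) := by
      rw [← partialZ_eq_wirt, ← partialZbar_eq_wirt]; rfl
    rw [← h4]
    exact wirt_add F.coord.isOpen (hE a b) (hD a b) (by norm_num) F.mem _ _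
  -- The third derivatives of u cancel; only first derivatives of χ remain.
  rw [e, e, wirt_comm F.coord (h3.of_le (by norm_num)) F.mem _ _ i k, add_sub_add_right_eq_sub]
  refine (norm_sub_le _ _).trans ?_
  have h5 : ‖-Complex.I‖ = 1 := by simp
  linarith [(F.c2_form k m).norm_wirt h5 i, (F.c2_form i m).norm_wirt h5 k]

/-- The exchange of indices in the second derivatives of `χ_u`. -/
theorem norm_swap_two_le (F : NormalFrame Ω χ ψ u U z p l K) (hu : IsCk n 4 u) (k i : Fin n) :
    ‖wirt z (-Complex.I) i (wirt z Complex.I i fun x => chiComp χ u z x k k) p -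
      wirt z (-Complex.I) k (wirt z Complex.I k fun x => chiComp χ u z x i i) p‖ ≤ 2 * K := by
  have hE : ∀ i j, CkOn n 2 (fun x => components χ.form z x i j) U := fun i j =>
    (χ.smooth U z F.coord i j : CkOn n ∞ _ U).of_le two_le_infty
  have huU : CkOn n 4 (fun x => (u x : ℂ)) U := IsCk.ofReal hu U
  have hD : ∀ i j, CkOn n 2 (fun x => complexHessian z u x i j) U := fun i j =>
    huU.complexHessian F.coord (by norm_num) two_add_two_le_infty i j
  have e : ∀ a c, wirt z (-Complex.I) c (wirt z Complex.I c fun x => chiComp χ u z x a a) p =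
      wirt z (-Complex.I) c (wirt z Complex.I c fun x => components χ.form z x a a) p +
      wirt z (-Complex.I) c (wirt z Complex.I c
        (wirt z (-Complex.I) a (wirt z Complex.I a fun x => (u x : ℂ)))) p := by
    intro a c
    have h4 : (fun x => complexHessian z u x a a) =
        wirt z (-Complex.I) a (wirt z Complex.I a fun x => (u x : ℂ)) := by
      rw [← partialZ_eq_wirt, ← partialZbar_eq_wirt]; rfl
    rw [← h4]
    exact wirt_wirt_add F.coord (hE a a) (hD a a) F.mem _ _ _ _
  -- The fourth derivatives of u cancel; only second derivatives of χ remain.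
  rw [e, e, wirt_four_comm F.coord F.mem huU _ _ i k, add_sub_add_right_eq_sub]
  refine (norm_sub_le _ _).trans ?_
  have h5 : ‖-Complex.I‖ = 1 := by simp
  linarith [(F.c2_form k k).norm_wirt_wirt F.coord F.mem (hE k k) h5 Complex.norm_I i i,
    (F.c2_form i i).norm_wirt_wirt F.coord F.mem (hE i i) h5 Complex.norm_I k k]

end NormalFrame

end Frame

/-! ### Differential inequality for log tr_ω χ_u -/

section SecondOrder

open Matrix

variable {n : ℕ} [NeZero n] {M : Type*} [TopologicalSpace M]
  [ChartedSpace (EuclideanHalfSpace (2 * n)) M] [IsManifold (𝓡∂ (2 * n)) ∞ M]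
  {𝒥 : ComplexStructure n M}

theorem inv_sq_sum_le {l : Fin n → ℝ} (hl : ∀ i, 0 < l i) {K : ℝ} (hsum : ∑ i, (l i)⁻¹ ≤ K)
    {a : Fin n → ℝ} {c : ℝ} (hc : 0 ≤ c) (ha : ∀ i, a i ≤ c) :
    ∑ i, a i * ((l i) ^ 2)⁻¹ ≤ c * K ^ 2 := by
  calc ∑ i, a i * ((l i) ^ 2)⁻¹ ≤ ∑ i, c * ((l i) ^ 2)⁻¹ := by
        refine Finset.sum_le_sum fun i _ => mul_le_mul_of_nonneg_right (ha i) ?_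
        have := hl i
        positivity
    _ = c * ∑ i, ((l i) ^ 2)⁻¹ := by rw [Finset.mul_sum]
    _ ≤ c * K ^ 2 := mul_le_mul_of_nonneg_left (sum_inv_sq_le hl hsum) hc

namespace NormalFrame

variable {Ω : HermitianMetric 𝒥} {χ : RealOneOneForm 𝒥} {ψ u : M → ℝ} {U : Set M}
  {z : M → Fin n → ℂ} {p : M} {l : Fin n → ℝ} {K : ℝ}

theorem chiComp_isHermitian (F : NormalFrame Ω χ ψ u U z p l K) (hu : IsCk n 4 u)
    (hsol : IsSolution Ω χ ψ u) : ∀ x ∈ U, (chiComp χ u z x).IsHermitian := fun x hx =>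
  (chiComp_posDef χ (hu.of_le (by norm_num)) (hsol x).1 F.coord hx).1

theorem chiComp_mul_inv (F : NormalFrame Ω χ ψ u U z p l K) (hu : IsCk n 4 u)
    (hsol : IsSolution Ω χ ψ u) : ∀ x ∈ U, chiComp χ u z x * (chiComp χ u z x)⁻¹ = 1 := fun x hx =>
  mul_nonsing_inv _ ((Matrix.isUnit_iff_isUnit_det _).1
    (chiComp_posDef χ (hu.of_le (by norm_num)) (hsol x).1 F.coord hx).isUnit)

theorem ckOn_inv (F : NormalFrame Ω χ ψ u U z p l K) (hu : IsCk n 4 u)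
    (hsol : IsSolution Ω χ ψ u) (i j : Fin n) : CkOn n 2 (fun x => (chiComp χ u z x)⁻¹ i j) U :=
  CkOn.matrix_inv (fun i j => CkOn.chiComp F.coord hu i j) (fun x hx =>
    ((Matrix.isUnit_iff_isUnit_det _).1
      (chiComp_posDef χ (hu.of_le (by norm_num)) (hsol x).1 F.coord hx).isUnit).ne_zero) i j

theorem ckOn_rhs (hψ2 : IsCk n 2 ψ) (hψ : ∀ x, 0 < ψ x) :
    CkOn n 2 (fun x => (n : ℂ) * (ψ x : ℂ)⁻¹) U :=
  (CkOn.const _).mul ((IsCk.ofReal hψ2 U).inv fun x _ => by exact_mod_cast (hψ x).ne')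

/-- The twice differentiated equation, as an inequality. -/
theorem sum_deriv_two_ge (F : NormalFrame Ω χ ψ u U z p l K) (hu : IsCk n 4 u) (hψ2 : IsCk n 2 ψ)
    (hψ : ∀ x, 0 < ψ x) (hsol : IsSolution Ω χ ψ u) (x : Fin n → Fin n → Fin n → ℂ)
    (hx : ∀ a b k, x a b k = wirt z (-Complex.I) k (fun y => chiComp χ u z y a b) p) (k : Fin n) :
    ∑ a, ∑ b, ‖x a b k‖ ^ 2 * ((l a) ^ 2 * l b)⁻¹
      - 2 * K * ∑ a, ∑ b, ‖x a b k‖ * (l a * l b)⁻¹ - (K ^ 2 + K) ≤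
    ∑ a, (wirt z (-Complex.I) k (wirt z Complex.I k fun y => chiComp χ u z y a a) p).re *
      ((l a) ^ 2)⁻¹ := by
  have hI : ‖-Complex.I‖ = 1 := by simp
  have hX : ∀ i j, CkOn n 2 (fun x => chiComp χ u z x i j) U := fun i j =>
    CkOn.chiComp F.coord hu i j
  have hG : ∀ i j, CkOn n 2 (fun x => components Ω.form z x i j) U := fun i j =>
    (CkOn.metric Ω F.coord i j).of_le two_le_infty
  have hK0 : 0 ≤ K := zero_le_one.trans F.one_le
  have heq := wirt_wirt_trace_eq (Y := fun y => (chiComp χ u z y)⁻¹) F.coord F.mem F.pos hX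
    (F.ckOn_inv hu hsol) hG (F.chiComp_mul_inv hu hsol) F.form F.metric (F.trace_eq hu hψ hsol)
    (-Complex.I) Complex.I k
  have hconj : ∀ a b, wirt z Complex.I k (fun y => chiComp χ u z y a b) p =
      (starRingEnd ℂ) (x b a k) := fun a b => by
    rw [hx]
    exact wirt_conj_of_hermitian F.coord.isOpen F.mem hX (F.chiComp_isHermitian hu hsol) k a b
  simp only [hconj, ← hx] at heq
  have hre := congrArg Complex.re heq
  simp only [← Complex.ofReal_pow, ← Complex.ofReal_mul, ← Complex.ofReal_inv, Complex.re_sum,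
    Complex.sub_re, Complex.add_re, Complex.re_mul_ofReal] at hre
  rw [hre]
  -- Since χ_u is Hermitian, both quadratic terms are squares, |x_{ba}|² and |x_{ab}|². Only the
  -- second is needed.
  have h1 : ∑ a, ∑ b, ‖x a b k‖ ^ 2 * ((l a) ^ 2 * l b)⁻¹ ≤ ∑ a, ∑ b,
      (((starRingEnd ℂ) (x b a k) * x b a k).re + (x a b k * (starRingEnd ℂ) (x a b k)).re) *
        ((l a) ^ 2 * l b)⁻¹ := by
    refine Finset.sum_le_sum fun a _ => Finset.sum_le_sum fun b _ =>
      mul_le_mul_of_nonneg_right ?_ (by have := F.pos a; have := F.pos b; positivity)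
    rw [mul_comm ((starRingEnd ℂ) (x b a k)), Complex.mul_conj, Complex.mul_conj, Complex.ofReal_re,
      Complex.ofReal_re, Complex.normSq_eq_norm_sq, Complex.normSq_eq_norm_sq]
    nlinarith [sq_nonneg ‖x b a k‖]
  have h2 : ∑ a, ∑ b,
      (((starRingEnd ℂ) (x b a k) *
          wirt z (-Complex.I) k (fun y => components Ω.form z y b a) p).re +
        (x a b k * wirt z Complex.I k (fun y => components Ω.form z y b a) p).re) * (l a * l b)⁻¹ ≤
      2 * K * ∑ a, ∑ b, ‖x a b k‖ * (l a * l b)⁻¹ := by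
    have h3 : ∑ a, ∑ b, ‖x b a k‖ * (l a * l b)⁻¹ = ∑ a, ∑ b, ‖x a b k‖ * (l a * l b)⁻¹ := by
      rw [Finset.sum_comm]
      refine Finset.sum_congr rfl fun a _ => Finset.sum_congr rfl fun b _ => ?_
      rw [mul_comm (l a)]
    calc _ ≤ ∑ a, ∑ b, (K * (‖x b a k‖ * (l a * l b)⁻¹) + K * (‖x a b k‖ * (l a * l b)⁻¹)) := by
          refine Finset.sum_le_sum fun a _ => Finset.sum_le_sum fun b _ => ?_
          have h4 : 0 ≤ (l a * l b)⁻¹ := by have := F.pos a; have := F.pos b; positivity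
          have h5 : ((starRingEnd ℂ) (x b a k) *
              wirt z (-Complex.I) k (fun y => components Ω.form z y b a) p).re ≤ ‖x b a k‖ * K := by
            refine (Complex.re_le_norm _).trans ?_
            rw [norm_mul, RCLike.norm_conj]
            exact mul_le_mul_of_nonneg_left ((F.c2_metric b a).norm_wirt hI k) (norm_nonneg _)
          have h6 : (x a b k * wirt z Complex.I k (fun y => components Ω.form z y b a) p).re ≤
              ‖x a b k‖ * K := by
            refine (Complex.re_le_norm _).trans ?_
            rw [norm_mul]
            exact mul_le_mul_of_nonneg_left ((F.c2_metric b a).norm_wirt Complex.norm_I k)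
              (norm_nonneg _)
          calc _ ≤ (‖x b a k‖ * K + ‖x a b k‖ * K) * (l a * l b)⁻¹ :=
                mul_le_mul_of_nonneg_right (add_le_add h5 h6) h4
            _ = _ := by ring
      _ = _ := by
        simp only [Finset.sum_add_distrib, ← Finset.mul_sum]
        rw [h3]
        ring
  have h3 : -(K ^ 2) ≤ ∑ a, (wirt z (-Complex.I) k
      (wirt z Complex.I k fun y => components Ω.form z y a a) p).re * (l a)⁻¹ := by
    have h4 := F.sum_inv_le hu hψ hsol
    calc -(K ^ 2) ≤ -K * ∑ i, (l i)⁻¹ := by nlinarith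
      _ = ∑ i, -K * (l i)⁻¹ := by rw [Finset.mul_sum]
      _ ≤ _ := by
        refine Finset.sum_le_sum fun a _ =>
          mul_le_mul_of_nonneg_right ?_ (inv_pos.2 (F.pos a)).le
        have h5 := (F.c2_metric a a).norm_wirt_wirt F.coord F.mem (hG a a) hI Complex.norm_I k k
        exact (abs_le.1 ((Complex.abs_re_le_norm _).trans h5)).1
  have h4 := (Complex.re_le_norm _).trans
    (F.c2_rhs.norm_wirt_wirt F.coord F.mem (ckOn_rhs hψ2 hψ) hI Complex.norm_I k k)
  simp only [← Complex.ofReal_inv] at h4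
  linarith

theorem norm_deriv_le (F : NormalFrame Ω χ ψ u U z p l K) (hu : IsCk n 4 u) (k m i : Fin n) :
    ‖wirt z (-Complex.I) i (fun y => chiComp χ u z y k m) p‖ ≤
      ‖wirt z (-Complex.I) k (fun y => chiComp χ u z y i m) p‖ + 2 * K := by
  have h1 := norm_le_norm_add_norm_sub' (wirt z (-Complex.I) i (fun y => chiComp χ u z y k m) p)
    (wirt z (-Complex.I) k (fun y => chiComp χ u z y i m) p)
  linarith [F.norm_swap_le hu k m i]

/-- The differential inequality for the logarithm of the trace of `χ_u`. -/
theorem trace_log_bound (F : NormalFrame Ω χ ψ u U z p l K) (hu : IsCk n 4 u) (hψ2 : IsCk n 2 ψ)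
    (hψ : ∀ x, 0 < ψ x) (hsol : IsSolution Ω χ ψ u) {W : M → ℂ} {C : ℝ}
    (hW : W = fun x => ((components Ω.form z x)⁻¹ * chiComp χ u z x).trace)
    (hC : C = 10 * n ^ 2 * K ^ 5 * (1 + K + 2 * n * K)) :
    (√(∑ i, ‖wirt z (-Complex.I) i W p‖ ^ 2 * ((l i) ^ 2)⁻¹) / ∑ i, l i) ^ 2 - (3 * C + 2 * C ^ 2) *
        (1 + √(∑ i, ‖wirt z (-Complex.I) i W p‖ ^ 2 * ((l i) ^ 2)⁻¹) / ∑ i, l i) ≤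
      (∑ i, (wirt z (-Complex.I) i (wirt z Complex.I i W) p).re * ((l i) ^ 2)⁻¹) / ∑ i, l i := by
  subst hC
  have hI : ‖-Complex.I‖ = 1 := by simp
  have hX : ∀ i j, CkOn n 2 (fun x => chiComp χ u z x i j) U := fun i j =>
    CkOn.chiComp F.coord hu i j
  have hH : ∀ i j, CkOn n 2 (fun x => (components Ω.form z x)⁻¹ i j) U := fun i j =>
    (CkOn.metric_inv Ω F.coord i j).of_le two_le_infty
  have hHp : (components Ω.form z p)⁻¹ = 1 := by rw [F.metric, inv_one]
  have hn : 0 < n := Nat.pos_of_ne_zero (NeZero.ne n)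
  have hn1 : (1 : ℝ) ≤ n := by exact_mod_cast hn
  have hK1 := F.one_le
  have hK0 : 0 ≤ K := zero_le_one.trans F.one_le
  have hsum := F.sum_inv_le hu hψ hsol
  have hlw : ∀ i, l i ≤ ∑ i, l i := fun i =>
    Finset.single_le_sum (f := l) (fun i _ => (F.pos i).le) (Finset.mem_univ i)
  -- Used throughout to absorb constants into multiples of the trace.
  have hw1 : 1 ≤ K * ∑ i, l i := by
    have h1 : (l ⟨0, hn⟩)⁻¹ ≤ K := (Finset.single_le_sum (f := fun i => (l i)⁻¹)
      (fun i _ => (inv_pos.2 (F.pos i)).le) (Finset.mem_univ _)).trans hsum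
    have h3 := F.pos ⟨0, hn⟩
    calc (1 : ℝ) = (l ⟨0, hn⟩)⁻¹ * l ⟨0, hn⟩ := (inv_mul_cancel₀ h3.ne').symm
      _ ≤ K * ∑ i, l i := mul_le_mul h1 (hlw _) h3.le hK0
  set w := ∑ i, l i with hw
  have hd := fun c c' i => wirt_trace_mul (c := c) (c' := c') F.coord F.mem hH hX hHp i
  subst hW
  set x : Fin n → Fin n → Fin n → ℂ := fun a b k =>
    wirt z (-Complex.I) k (fun y => chiComp χ u z y a b) p with hx
  -- The index of differentiation is moved to the first place, where the weight of the good term is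
  -- λ_a⁻². It is the index that carries λ_i⁻² in the linearized operator.
  have hswap : ∀ a b k, ‖x a b k‖ ≤ ‖x k b a‖ + 2 * K := fun a b k => F.norm_deriv_le hu a b k
  have hconj : ∀ k a b, ‖wirt z Complex.I k (fun y => chiComp χ u z y a b) p‖ = ‖x b a k‖ :=
    fun k a b => by
      rw [wirt_conj_of_hermitian F.coord.isOpen F.mem hX (F.chiComp_isHermitian hu hsol) k a b,
        RCLike.norm_conj]
  have hK5 : ∀ m : ℕ, m ≤ 5 → K ^ m ≤ K ^ 5 := fun m hm => pow_le_pow_right₀ hK1 hm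
  have hn2 : (1 : ℝ) ≤ n ^ 2 := one_le_pow₀ hn1
  have hnn : (n : ℝ) ≤ n ^ 2 := by nlinarith
  have hw0 : 0 ≤ w := by
    by_contra! h
    nlinarith
  clear_value w
  rw [hw]
  -- The error constant is 10n²K⁵, chosen to exceed all coefficients collected below, and h₀ = K.
  refine laplacian_log_bound hn F.pos (by positivity) hsum x _ _ (fun i => ?_) ?_
  · rw [(hd (-Complex.I) Complex.I i).1]
    have e : (∑ k, wirt z (-Complex.I) i (fun y => chiComp χ u z y k k) p +
        ∑ k, ∑ m, wirt z (-Complex.I) i (fun y => (components Ω.form z y)⁻¹ k m) p *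
          chiComp χ u z p m k) - ∑ k, x i k k =
        ∑ k, ((wirt z (-Complex.I) i (fun y => chiComp χ u z y k k) p - x i k k) +
          wirt z (-Complex.I) i (fun y => (components Ω.form z y)⁻¹ k k) p * (l k : ℂ)) := by
      simp only [F.form, diagonal_apply, mul_ite, mul_zero, Finset.sum_ite_eq', Finset.mem_univ,
        if_true, Finset.sum_add_distrib, Finset.sum_sub_distrib]
      ring
    rw [e]
    have h1 : ‖∑ k, ((wirt z (-Complex.I) i (fun y => chiComp χ u z y k k) p - x i k k) +
          wirt z (-Complex.I) i (fun y => (components Ω.form z y)⁻¹ k k) p * (l k : ℂ))‖ ≤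
        ∑ k, (2 * K + K * l k) := by
      refine norm_sum_le_of_le _ fun k _ => (norm_add_le _ _).trans (add_le_add ?_ ?_)
      · exact F.norm_swap_le hu k k i
      · rw [norm_mul, Complex.norm_real, Real.norm_of_nonneg (F.pos k).le]
        exact mul_le_mul_of_nonneg_right ((F.c2_inv k k).norm_wirt hI i) (F.pos k).le
    refine h1.trans ?_
    rw [Finset.sum_add_distrib, ← Finset.mul_sum (f := l), ← hw]
    simp only [Finset.sum_const, Finset.card_univ, Fintype.card_fin, nsmul_eq_mul]
    have h2 : (n : ℝ) * (2 * K) ≤ 2 * n ^ 2 * K ^ 2 * w := by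
      calc (n : ℝ) * (2 * K) ≤ n ^ 2 * (2 * K) * (K * w) := by
            have : (n : ℝ) * (2 * K) ≤ n ^ 2 * (2 * K) := by gcongr
            exact this.trans (le_mul_of_one_le_right (by positivity) hw1)
        _ = _ := by ring
    have h3 : 2 * (n : ℝ) ^ 2 * K ^ 2 * w ≤ 2 * n ^ 2 * K ^ 5 * w := by
      have := hK5 2 (by norm_num)
      gcongr
    have h4 : K * w ≤ n ^ 2 * K ^ 5 * w := by
      refine mul_le_mul_of_nonneg_right ?_ hw0
      have := hK5 1 (by norm_num)
      rw [pow_one] at this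
      exact this.trans (le_mul_of_one_le_left (by positivity) hn2)
    have h5 : 0 ≤ (n : ℝ) ^ 2 * K ^ 5 * w := by positivity
    linarith
  · -- lower bound for the linearized operator applied to the trace
    set D : Fin n → Fin n → ℝ := fun k i =>
      (wirt z (-Complex.I) i (wirt z Complex.I i fun y => chiComp χ u z y k k) p).re with hD
    -- Exchange of the two pairs of indices: after it the sum over i weighted by λ_i⁻² runs over the
    -- diagonal entries of χ_u, as in the twice differentiated equation.
    have hDs : ∀ k i, D i k - 2 * K ≤ D k i := fun k i => by
      have := (Complex.abs_re_le_norm _).trans (F.norm_swap_two_le hu k i)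
      rw [Complex.sub_re] at this
      linarith [(abs_le.1 this).1]
    have hmain : ∀ k, _ := fun k => F.sum_deriv_two_ge hu hψ2 hψ hsol x (fun _ _ _ => rfl) k
    -- In the second derivative of tr(G⁻¹X), the mixed terms pair first derivatives of G⁻¹ and X,
    -- and the last ones pair second derivatives of G⁻¹ with X, which contributes at most K times
    -- the trace.
    have hterm : ∀ i, ∑ k, D k i - K * ∑ k, ∑ m, (‖x i k m‖ + ‖x i m k‖ + 4 * K) - K * w ≤
        (wirt z (-Complex.I) i (wirt z Complex.I i fun x =>
          ((components Ω.form z x)⁻¹ * chiComp χ u z x).trace) p).re := by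
      intro i
      rw [(hd (-Complex.I) Complex.I i).2, Complex.add_re, Complex.add_re, Complex.re_sum]
      have h1 : -(K * ∑ k, ∑ m, (‖x i k m‖ + ‖x i m k‖ + 4 * K)) ≤ (∑ k, ∑ m,
          (wirt z Complex.I i (fun x => (components Ω.form z x)⁻¹ k m) p *
            wirt z (-Complex.I) i (fun x => chiComp χ u z x m k) p +
          wirt z (-Complex.I) i (fun x => (components Ω.form z x)⁻¹ k m) p *
            wirt z Complex.I i (fun x => chiComp χ u z x m k) p)).re := by
        refine (abs_le.1 ((Complex.abs_re_le_norm _).trans ?_)).1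
        rw [Finset.mul_sum]
        refine norm_sum_le_of_le _ fun k _ => ?_
        rw [Finset.mul_sum]
        refine norm_sum_le_of_le _ fun m _ => (norm_add_le _ _).trans ?_
        rw [norm_mul, norm_mul, hconj]
        have h2 := mul_le_mul ((F.c2_inv k m).norm_wirt Complex.norm_I i) (hswap m k i)
          (norm_nonneg _) hK0
        have h3 := mul_le_mul ((F.c2_inv k m).norm_wirt hI i) (hswap k m i)
          (norm_nonneg _) hK0
        linarith
      have h2 : -(K * w) ≤ (∑ k, ∑ m, wirt z (-Complex.I) i (wirt z Complex.I i fun x =>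
          (components Ω.form z x)⁻¹ k m) p * chiComp χ u z p m k).re := by
        refine (abs_le.1 ((Complex.abs_re_le_norm _).trans ?_)).1
        rw [hw, Finset.mul_sum]
        refine norm_sum_le_of_le _ fun k _ => ?_
        simp only [F.form, diagonal_apply, mul_ite, mul_zero, Finset.sum_ite_eq', Finset.mem_univ,
          if_true]
        rw [norm_mul, Complex.norm_real, Real.norm_of_nonneg (F.pos k).le]
        exact mul_le_mul_of_nonneg_right ((F.c2_inv k k).norm_wirt_wirt F.coord F.mem (hH k k) hI
          Complex.norm_I i i) (F.pos k).le
      linarith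
    have hl2 : ∀ i, 0 ≤ ((l i) ^ 2)⁻¹ := fun i => by have := F.pos i; positivity
    have hS := Finset.sum_le_sum fun i (_ : i ∈ Finset.univ) =>
      mul_le_mul_of_nonneg_right (hterm i) (hl2 i)
    refine le_trans ?_ hS
    have hq := sum_inv_sq_le F.pos hsum
    set q := ∑ i, ((l i) ^ 2)⁻¹ with hqdef
    set P := ∑ a, ∑ b, ∑ k, ‖x a b k‖ * (l a * l b)⁻¹ with hP
    set R := ∑ a, ∑ b, ∑ k, ‖x a b k‖ * ((l a) ^ 2)⁻¹ with hR
    have hP0 : 0 ≤ P := Finset.sum_nonneg fun a _ => Finset.sum_nonneg fun b _ =>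
      Finset.sum_nonneg fun k _ => by have := F.pos a; have := F.pos b; positivity
    have hR0 : 0 ≤ R := Finset.sum_nonneg fun a _ => Finset.sum_nonneg fun b _ =>
      Finset.sum_nonneg fun k _ => by have := F.pos a; positivity
    have e1 : ∑ i, (∑ k, D k i - K * ∑ k, ∑ m, (‖x i k m‖ + ‖x i m k‖ + 4 * K) - K * w) *
        ((l i) ^ 2)⁻¹ = ∑ i, ∑ k, D k i * ((l i) ^ 2)⁻¹ - 2 * K * R - 4 * K ^ 2 * n ^ 2 * q
          - K * w * q := by
      have h1 : ∀ i, ∑ k, ∑ m, (‖x i k m‖ + ‖x i m k‖ + 4 * K) =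
          2 * ∑ k, ∑ m, ‖x i k m‖ + n ^ 2 * (4 * K) := by
        intro i
        simp only [Finset.sum_add_distrib, Finset.sum_const, Finset.card_univ, Fintype.card_fin,
          nsmul_eq_mul]
        rw [Finset.sum_comm (f := fun k m => ‖x i m k‖)]
        ring
      have h2 : R = ∑ i, (∑ k, ∑ m, ‖x i k m‖) * ((l i) ^ 2)⁻¹ := by
        rw [hR]
        simp only [Finset.sum_mul]
      rw [h2, hqdef, Finset.mul_sum, Finset.mul_sum, Finset.mul_sum (a := K * w), ← Finset.sum_sub_distrib,
        ← Finset.sum_sub_distrib, ← Finset.sum_sub_distrib]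
      refine Finset.sum_congr rfl fun i _ => ?_
      rw [h1, ← Finset.sum_mul]
      ring
    have e2 : ∑ k, ∑ i, D i k * ((l i) ^ 2)⁻¹ - 2 * K * n * q ≤ ∑ i, ∑ k, D k i * ((l i) ^ 2)⁻¹ := by
      have h1 : ∑ i, ∑ k, (D i k * ((l i) ^ 2)⁻¹ - 2 * K * ((l i) ^ 2)⁻¹) ≤
          ∑ i, ∑ k, D k i * ((l i) ^ 2)⁻¹ := by
        refine Finset.sum_le_sum fun i _ => Finset.sum_le_sum fun k _ => ?_
        rw [← sub_mul]
        exact mul_le_mul_of_nonneg_right (hDs k i) (hl2 i)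
      refine le_trans (le_of_eq ?_) h1
      rw [Finset.sum_comm]
      simp only [Finset.sum_sub_distrib, Finset.sum_const, Finset.card_univ, Fintype.card_fin,
        nsmul_eq_mul, ← Finset.mul_sum]
      rw [← hqdef]
      ring
    have e3 : (∑ a, ∑ b, ∑ k, ‖x a b k‖ ^ 2 * ((l a) ^ 2 * l b)⁻¹) - 2 * K * P - n * (K ^ 2 + K) ≤
        ∑ k, ∑ i, D i k * ((l i) ^ 2)⁻¹ := by
      refine le_trans (le_of_eq ?_) (Finset.sum_le_sum fun k (_ : k ∈ Finset.univ) => hmain k)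
      have h1 : ∀ f : Fin n → Fin n → Fin n → ℝ, ∑ a, ∑ b, ∑ k, f a b k = ∑ k, ∑ a, ∑ b, f a b k := by
        intro f
        exact (Finset.sum_congr rfl fun _ _ => Finset.sum_comm).trans Finset.sum_comm
      rw [hP, h1 fun a b k => ‖x a b k‖ ^ 2 * ((l a) ^ 2 * l b)⁻¹,
        h1 fun a b k => ‖x a b k‖ * (l a * l b)⁻¹]
      simp only [Finset.sum_sub_distrib, Finset.sum_const, Finset.card_univ, Fintype.card_fin,
        nsmul_eq_mul, ← Finset.mul_sum]
    rw [e1]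
    have k1 : 2 * K * P ≤ 10 * n ^ 2 * K ^ 5 * P := by
      refine mul_le_mul_of_nonneg_right ?_ hP0
      have := hK5 1 (by norm_num)
      rw [pow_one] at this
      nlinarith [mul_le_mul hn2 this hK0 (by positivity)]
    have k2 : 2 * K * R ≤ 10 * n ^ 2 * K ^ 5 * R := by
      refine mul_le_mul_of_nonneg_right ?_ hR0
      have := hK5 1 (by norm_num)
      rw [pow_one] at this
      nlinarith [mul_le_mul hn2 this hK0 (by positivity)]
    have k3 : 4 * K ^ 2 * n ^ 2 * q ≤ 4 * (n ^ 2 * K ^ 5 * w) := by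
      calc 4 * K ^ 2 * n ^ 2 * q ≤ 4 * K ^ 2 * n ^ 2 * K ^ 2 * (K * w) :=
            (mul_le_mul_of_nonneg_left hq (by positivity)).trans
              (le_mul_of_one_le_right (by positivity) hw1)
        _ = _ := by ring
    have k4 : K * w * q ≤ n ^ 2 * K ^ 5 * w := by
      calc K * w * q ≤ K * w * K ^ 2 := mul_le_mul_of_nonneg_left hq (by positivity)
        _ = K ^ 3 * w := by ring
        _ ≤ n ^ 2 * K ^ 5 * w := by
          refine mul_le_mul_of_nonneg_right ?_ hw0
          exact (hK5 3 (by norm_num)).trans (le_mul_of_one_le_left (by positivity) hn2)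
    have k5 : 2 * K * n * q ≤ 2 * (n ^ 2 * K ^ 5 * w) := by
      calc 2 * K * n * q ≤ 2 * K * n ^ 2 * K ^ 2 * (K * w) := by
            refine le_trans ?_ (le_mul_of_one_le_right (by positivity) hw1)
            gcongr
        _ = 2 * (n ^ 2 * K ^ 4 * w) := by ring
        _ ≤ _ := by
          have := hK5 4 (by norm_num)
          gcongr
    have k6 : n * (K ^ 2 + K) ≤ 2 * (n ^ 2 * K ^ 5 * w) := by
      calc n * (K ^ 2 + K) ≤ n ^ 2 * (2 * K ^ 2) * (K * w) := by
            refine le_trans ?_ (le_mul_of_one_le_right (by positivity) hw1)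
            have : K ^ 2 + K ≤ 2 * K ^ 2 := by nlinarith
            gcongr
        _ = 2 * (n ^ 2 * K ^ 3 * w) := by ring
        _ ≤ _ := by
          have := hK5 3 (by norm_num)
          gcongr
    have k7 : 0 ≤ n ^ 2 * K ^ 5 * w := by positivity
    rw [← hw]
    linarith

end NormalFrame

end SecondOrder

/-! ### Differential inequality for log |∇u|² -/

section FirstOrder

open Matrix

variable {n : ℕ} [NeZero n] {M : Type*} [TopologicalSpace M]
  [ChartedSpace (EuclideanHalfSpace (2 * n)) M] [IsManifold (𝓡∂ (2 * n)) ∞ M]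
  {𝒥 : ComplexStructure n M}

/-- The derivatives of the product `uₘ u_k̄`. -/
theorem wirt_gradMatrix {J : ∀ x : M, Tan n x →ₗ[ℝ] Tan n x} {U : Set M} {z : M → Fin n → ℂ}
    {p : M} (hz : IsHolCoord J U z) (hp : p ∈ U) {u : M → ℝ}
    (hu : CkOn n 3 (fun x => (u x : ℂ)) U) {g : Fin n → ℂ} {a q t : Fin n → Fin n → ℂ}
    (hg : ∀ k, g k = wirt z (-Complex.I) k (fun x => (u x : ℂ)) p)
    (ha : ∀ k i, a k i = wirt z (-Complex.I) i (wirt z (-Complex.I) k fun x => (u x : ℂ)) p)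
    (hq : ∀ k i, q k i = wirt z (-Complex.I) i (wirt z Complex.I k fun x => (u x : ℂ)) p)
    (ht : ∀ k i, t k i = wirt z (-Complex.I) i (wirt z Complex.I i
      (wirt z (-Complex.I) k fun x => (u x : ℂ))) p) (m k i : Fin n) :
    gradMatrix z u p m k = g m * (starRingEnd ℂ) (g k) ∧
    wirt z (-Complex.I) i (fun x => gradMatrix z u x m k) p =
      a m i * (starRingEnd ℂ) (g k) + g m * q k i ∧
    wirt z Complex.I i (fun x => gradMatrix z u x m k) p =
      (starRingEnd ℂ) (q m i) * (starRingEnd ℂ) (g k) + g m * (starRingEnd ℂ) (a k i) ∧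
    wirt z (-Complex.I) i (wirt z Complex.I i fun x => gradMatrix z u x m k) p =
      t m i * (starRingEnd ℂ) (g k) + (starRingEnd ℂ) (q m i) * q k i +
        a m i * (starRingEnd ℂ) (a k i) + g m * (starRingEnd ℂ) (t k i) := by
  have h1 : (1 : WithTop ℕ∞) ≤ 2 := by norm_num
  have h13 : (1 : WithTop ℕ∞) ≤ 3 := by norm_num
  have hd : ∀ c k, CkOn n 2 (wirt z c k fun x => (u x : ℂ)) U := fun c k =>
    hu.wirt hz (by norm_num) three_le_infty c k
  have hcc : (starRingEnd ℂ) (-Complex.I) = Complex.I := by simp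
  have hc0 : ∀ c k, ∀ y ∈ U, wirt z c k (fun x => (u x : ℂ)) y =
      (starRingEnd ℂ) (wirt z ((starRingEnd ℂ) c) k (fun x => (u x : ℂ)) y) := by
    intro c k y hy
    rw [← wirt_conj hz.isOpen hu h13 hy c k]
    simp only [Complex.conj_ofReal]
  have hc1 : ∀ c c' i k, ∀ y ∈ U, wirt z c i (wirt z c' k fun x => (u x : ℂ)) y =
      (starRingEnd ℂ) (wirt z ((starRingEnd ℂ) c) i
        (wirt z ((starRingEnd ℂ) c') k fun x => (u x : ℂ)) y) := by
    intro c c' i k y hy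
    rw [wirt_congr_on hz.isOpen (hc0 c' k) hy c i, wirt_conj hz.isOpen (hd _ k) h1 hy]
  -- As u is real, conjugation exchanges ∂ and ∂̄; commuting the outer two derivatives brings the
  -- result to the form of `t`.
  have hc2 : wirt z (-Complex.I) i (wirt z Complex.I i (wirt z Complex.I k fun x => (u x : ℂ))) p =
      (starRingEnd ℂ) (t k i) := by
    rw [wirt_congr_on hz.isOpen (hc1 Complex.I Complex.I i k) hp,
      wirt_conj hz.isOpen ((hd _ _).wirt_two hz _ _) le_rfl hp, ht, hcc, Complex.conj_I,
      wirt_comm hz (hd _ _) hp]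
  have e : (fun x => gradMatrix z u x m k) = fun x => wirt z (-Complex.I) m (fun x => (u x : ℂ)) x *
      wirt z Complex.I k (fun x => (u x : ℂ)) x := by
    funext x
    rw [← partialZ_eq_wirt, ← partialZbar_eq_wirt]
    rfl
  have b0 := hc0 Complex.I k p hp
  have b1 := hc1 Complex.I (-Complex.I) i m p hp
  have b2 := hc1 Complex.I Complex.I i k p hp
  rw [hcc, Complex.conj_I] at b1
  rw [Complex.conj_I] at b0 b2
  rw [e]
  refine ⟨?_, ?_, ?_, ?_⟩
  · rw [congrFun e p, hg, hg, b0]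
  · rw [wirt_mul hz.isOpen (hd _ _) (hd _ _) h1 hp, ha, hg, hg, hq, b0]
  · rw [wirt_mul hz.isOpen (hd _ _) (hd _ _) h1 hp, hq, ha, hg, hg, b0, b1, b2]
  · rw [wirt_wirt_mul hz (hd _ _) (hd _ _) hp, hc2, ← ht, b1, ← hq, ← hq, b0, ← hg, ← hg, b2, ← ha,
      ← ha]

namespace NormalFrame

variable {Ω : HermitianMetric 𝒥} {χ : RealOneOneForm 𝒥} {ψ u : M → ℝ} {U : Set M}
  {z : M → Fin n → ℂ} {p : M} {l : Fin n → ℝ} {K : ℝ}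

theorem norm_hessian_le (F : NormalFrame Ω χ ψ u U z p l K) (k i : Fin n) :
    ‖wirt z (-Complex.I) i (wirt z Complex.I k fun x => (u x : ℂ)) p‖ ≤
      (if i = k then l i else 0) + K := by
  have h1 : wirt z (-Complex.I) i (wirt z Complex.I k fun x => (u x : ℂ)) p =
      chiComp χ u z p i k - components χ.form z p i k := by
    rw [← partialZ_eq_wirt, ← partialZbar_eq_wirt, chiComp, Matrix.add_apply, add_sub_cancel_left]
    rfl
  rw [h1, F.form, diagonal_apply]
  refine (norm_sub_le _ _).trans (add_le_add ?_ (c2At_iff.1 (F.c2_form i k)).1)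
  split_ifs
  · rw [Complex.norm_real, Real.norm_of_nonneg (F.pos i).le]
  · simp

/-- The once differentiated equation, as an estimate. -/
theorem norm_sum_deriv_le (F : NormalFrame Ω χ ψ u U z p l K) (hu : IsCk n 4 u)
    (hψ : ∀ x, 0 < ψ x) (hsol : IsSolution Ω χ ψ u) (k : Fin n) :
    ‖∑ i, wirt z (-Complex.I) i (wirt z Complex.I i
      (wirt z (-Complex.I) k fun x => (u x : ℂ))) p * ((l i : ℂ) ^ 2)⁻¹‖ ≤ 3 * K ^ 3 := by
  have hI : ‖-Complex.I‖ = 1 := by simp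
  have hX : ∀ i j, CkOn n 1 (fun x => chiComp χ u z x i j) U := fun i j =>
    (CkOn.chiComp F.coord hu i j).of_le (by norm_num)
  have hE : ∀ i j, CkOn n 2 (fun x => components χ.form z x i j) U := fun i j =>
    (χ.smooth U z F.coord i j : CkOn n ∞ _ U).of_le two_le_infty
  have hG : ∀ i j, CkOn n 1 (fun x => components Ω.form z x i j) U := fun i j =>
    (CkOn.metric Ω F.coord i j).of_le (by simp)
  have huU : CkOn n 4 (fun x => (u x : ℂ)) U := IsCk.ofReal hu U
  have hD : ∀ i j, CkOn n 2 (fun x => complexHessian z u x i j) U := fun i j =>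
    huU.complexHessian F.coord (by norm_num) two_add_two_le_infty i j
  have hK1 := F.one_le
  have hK0 : 0 ≤ K := zero_le_one.trans F.one_le
  have hsum := F.sum_inv_le hu hψ hsol
  -- ∂_k is moved to the outside, so that u_{i ī k} becomes a first derivative of χ_u up to one of
  -- χ; the once differentiated equation then controls the sum against λ_i⁻².
  have e : ∀ i, wirt z (-Complex.I) i (wirt z Complex.I i
      (wirt z (-Complex.I) k fun x => (u x : ℂ))) p =
      wirt z (-Complex.I) k (fun x => chiComp χ u z x i i) p -
        wirt z (-Complex.I) k (fun x => components χ.form z x i i) p := by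
    intro i
    have h4 : (fun x => complexHessian z u x i i) =
        wirt z (-Complex.I) i (wirt z Complex.I i fun x => (u x : ℂ)) := by
      rw [← partialZ_eq_wirt, ← partialZbar_eq_wirt]; rfl
    have h5 : wirt z (-Complex.I) k (fun x => chiComp χ u z x i i) p = _ :=
      wirt_add F.coord.isOpen (hE i i) (hD i i) (by norm_num) F.mem _ _
    rw [wirt_three_comm F.coord F.mem (huU.of_le (by norm_num)), h5, ← h4]
    ring
  have h1 := wirt_trace_eq (Y := fun y => (chiComp χ u z y)⁻¹) F.coord F.mem F.pos hX
    (fun i j => (F.ckOn_inv hu hsol i j).of_le (by norm_num)) hG (F.chiComp_mul_inv hu hsol) F.form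
    F.metric (F.trace_eq hu hψ hsol) (-Complex.I) k
  simp only [e, sub_mul, Finset.sum_sub_distrib]
  rw [h1]
  have h2 : ‖∑ a, wirt z (-Complex.I) k (fun x => components Ω.form z x a a) p * (l a : ℂ)⁻¹‖ ≤
      K * K := by
    calc _ ≤ ∑ a, K * (l a)⁻¹ := by
          refine norm_sum_le_of_le _ fun a _ => ?_
          rw [norm_mul, norm_inv, Complex.norm_real, Real.norm_of_nonneg (F.pos a).le]
          exact mul_le_mul_of_nonneg_right ((F.c2_metric a a).norm_wirt hI k)
            (inv_pos.2 (F.pos a)).le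
      _ ≤ K * K := by
        rw [← Finset.mul_sum]
        exact mul_le_mul_of_nonneg_left hsum hK0
  have h3 : ‖∑ a, wirt z (-Complex.I) k (fun x => components χ.form z x a a) p *
      ((l a : ℂ) ^ 2)⁻¹‖ ≤ K * K ^ 2 := by
    refine le_trans (norm_sum_le_of_le _ fun a _ => ?_)
      (inv_sq_sum_le F.pos hsum (a := fun _ => K) hK0 fun _ => le_rfl)
    rw [norm_mul, norm_inv, norm_pow, Complex.norm_real, Real.norm_of_nonneg (F.pos a).le]
    exact mul_le_mul_of_nonneg_right ((F.c2_form a a).norm_wirt hI k)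
      (by have := F.pos a; positivity)
  have h4 := F.c2_rhs.norm_wirt hI k
  refine (norm_sub_le _ _).trans ?_
  have h5 := norm_sub_le (∑ a, wirt z (-Complex.I) k (fun x => components Ω.form z x a a) p *
    (l a : ℂ)⁻¹) (wirt z (-Complex.I) k (fun x => (n : ℂ) * (ψ x : ℂ)⁻¹) p)
  have h6 : K ≤ K ^ 2 := by nlinarith
  have h7 : K ^ 2 + K ≤ 2 * K ^ 3 := by nlinarith
  nlinarith

/-- The differential inequality for the logarithm of `|∇u|²`, where `|∇u| ≥ 1`. -/
theorem grad_log_bound (F : NormalFrame Ω χ ψ u U z p l K) (hu : IsCk n 4 u)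
    (hψ : ∀ x, 0 < ψ x) (hsol : IsSolution Ω χ ψ u) {W : M → ℂ} {C w : ℝ}
    (hW : W = fun x => ((components Ω.form z x)⁻¹ * gradMatrix z u x).trace)
    (hw : w = ∑ k, ‖wirt z (-Complex.I) k (fun x => (u x : ℂ)) p‖ ^ 2) (hw1 : 1 ≤ w)
    (hC : C = 20 * n ^ 2 * K ^ 4 * (1 + n * K + n * (1 + K))) :
    (√(∑ i, ‖wirt z (-Complex.I) i W p‖ ^ 2 * ((l i) ^ 2)⁻¹) / w) ^ 2 - (3 * C + 2 * C ^ 2) *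
        (1 + √(∑ i, ‖wirt z (-Complex.I) i W p‖ ^ 2 * ((l i) ^ 2)⁻¹) / w) ≤
      (∑ i, (wirt z (-Complex.I) i (wirt z Complex.I i W) p).re * ((l i) ^ 2)⁻¹) / w := by
  subst hC
  have hI : ‖-Complex.I‖ = 1 := by simp
  have huU : CkOn n 4 (fun x => (u x : ℂ)) U := IsCk.ofReal hu U
  have hu3 : CkOn n 3 (fun x => (u x : ℂ)) U := huU.of_le (by norm_num)
  have hX : ∀ i j, CkOn n 2 (fun x => gradMatrix z u x i j) U := fun i j =>
    huU.gradMatrix F.coord (by norm_num) three_le_infty i j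
  have hH : ∀ i j, CkOn n 2 (fun x => (components Ω.form z x)⁻¹ i j) U := fun i j =>
    (CkOn.metric_inv Ω F.coord i j).of_le two_le_infty
  have hHp : (components Ω.form z p)⁻¹ = 1 := by rw [F.metric, inv_one]
  have hn : 0 < n := Nat.pos_of_ne_zero (NeZero.ne n)
  have hn1 : (1 : ℝ) ≤ n := by exact_mod_cast hn
  have hK1 := F.one_le
  have hK0 : 0 ≤ K := zero_le_one.trans F.one_le
  have hsum := F.sum_inv_le hu hψ hsol
  have hd := fun c c' i => wirt_trace_mul (c := c) (c' := c') F.coord F.mem hH hX hHp i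
  subst hW
  obtain ⟨g, hg⟩ : ∃ g : Fin n → ℂ, ∀ k, g k = wirt z (-Complex.I) k (fun x => (u x : ℂ)) p :=
    ⟨_, fun _ => rfl⟩
  obtain ⟨a, ha⟩ : ∃ a : Fin n → Fin n → ℂ, ∀ k i, a k i =
    wirt z (-Complex.I) i (wirt z (-Complex.I) k fun x => (u x : ℂ)) p := ⟨_, fun _ _ => rfl⟩
  obtain ⟨q, hq⟩ : ∃ q : Fin n → Fin n → ℂ, ∀ k i, q k i =
    wirt z (-Complex.I) i (wirt z Complex.I k fun x => (u x : ℂ)) p :=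
      ⟨fun k i => wirt z (-Complex.I) i (wirt z Complex.I k fun x => (u x : ℂ)) p, fun _ _ => rfl⟩
  obtain ⟨t, ht⟩ : ∃ t : Fin n → Fin n → ℂ, ∀ k i, t k i =
    wirt z (-Complex.I) i (wirt z Complex.I i (wirt z (-Complex.I) k fun x => (u x : ℂ))) p :=
      ⟨_, fun _ _ => rfl⟩
  have hgrad := wirt_gradMatrix F.coord F.mem hu3 hg ha hq ht
  have hgrad0 : ∀ m k, gradMatrix z u p m k = g m * (starRingEnd ℂ) (g k) := fun m k =>
    (hgrad m k ⟨0, hn⟩).1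
  have hqn : ∀ k i, ‖q k i‖ ≤ (if i = k then l i else 0) + K := fun k i => by
    rw [hq]; exact F.norm_hessian_le k i
  have hqn' : ∀ k i, ‖q k i‖ ≤ l i + K := fun k i => (hqn k i).trans (by
    have := (F.pos i).le
    split_ifs <;> linarith)
  have hR : ∀ k, ‖∑ i, t k i * ((l i : ℂ) ^ 2)⁻¹‖ ≤ 3 * K ^ 3 := fun k => by
    simp only [ht]; exact F.norm_sum_deriv_le hu hψ hsol k
  simp only [← hg] at hw
  have hgw2 : ∀ k, ‖g k‖ ^ 2 ≤ w := fun k => by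
    rw [hw]
    exact Finset.single_le_sum (f := fun k => ‖g k‖ ^ 2) (fun _ _ => sq_nonneg _)
      (Finset.mem_univ k)
  -- Here w ≥ 1 enters: terms linear in the gradient are bounded by w.
  have hgw : ∀ k, ‖g k‖ ≤ w := fun k => by nlinarith [hgw2 k, norm_nonneg (g k)]
  have hggw : ∀ k m, ‖g k‖ * ‖g m‖ ≤ w := fun k m => by
    nlinarith [hgw2 k, hgw2 m, sq_nonneg (‖g k‖ - ‖g m‖)]
  have hw0 : 0 < w := by linarith
  have hK4 : ∀ m : ℕ, m ≤ 4 → K ^ m ≤ K ^ 4 := fun m hm => pow_le_pow_right₀ hK1 hm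
  have hn2 : (1 : ℝ) ≤ n ^ 2 := one_le_pow₀ hn1
  have hnn : (n : ℝ) ≤ n ^ 2 := by nlinarith
  -- The error constant is 20n²K⁴, chosen to exceed all coefficients collected below, and h₀ = K.
  refine gradient_log_bound hn F.pos (by positivity) hsum a g _ hw hw0 (fun i => ?_) ?_
  · rw [(hd (-Complex.I) Complex.I i).1]
    simp only [hgrad0, (hgrad _ _ _).2.1]
    have e : ∀ A : ℂ, ∑ k, (a k i * (starRingEnd ℂ) (g k) + g k * q k i) + A -
        ∑ k, a k i * (starRingEnd ℂ) (g k) = ∑ k, g k * q k i + A := by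
      intro A
      rw [Finset.sum_add_distrib]
      ring
    rw [e]
    have h1 : ‖∑ k, g k * q k i‖ ≤ w * l i + n * (w * K) := by
      have h2 : ‖∑ k, g k * q k i‖ ≤ ∑ k, (w * (if i = k then l i else 0) + w * K) := by
        refine norm_sum_le_of_le _ fun k _ => ?_
        rw [norm_mul, ← mul_add]
        exact mul_le_mul (hgw k) (hqn k i) (norm_nonneg _) hw0.le
      simpa [Finset.sum_add_distrib] using h2
    have h2 : ‖∑ k, ∑ m, wirt z (-Complex.I) i (fun x => (components Ω.form z x)⁻¹ k m) p *
        (g m * (starRingEnd ℂ) (g k))‖ ≤ ∑ _k : Fin n, ∑ _m : Fin n, K * w := by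
      refine norm_sum_le_of_le _ fun k _ => norm_sum_le_of_le _ fun m _ => ?_
      rw [norm_mul, norm_mul, RCLike.norm_conj]
      exact mul_le_mul ((F.c2_inv k m).norm_wirt hI i) (hggw m k) (by positivity) hK0
    simp only [Finset.sum_const, Finset.card_univ, Fintype.card_fin, nsmul_eq_mul] at h2
    refine (norm_add_le _ _).trans ((add_le_add h1 h2).trans ?_)
    have hl := (F.pos i).le
    have h4 : (1 : ℝ) ≤ n ^ 2 * K ^ 4 := by nlinarith [hK4 0 (by norm_num)]
    have h5 : n * K ≤ n ^ 2 * K ^ 4 := by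
      have := hK4 1 (by norm_num)
      rw [pow_one] at this
      gcongr
    have h6 : n * (n * K) ≤ n ^ 2 * K ^ 4 := by
      have := hK4 1 (by norm_num)
      rw [pow_one] at this
      rw [← mul_assoc, ← pow_two]
      gcongr
    have h7 : w * l i ≤ (n ^ 2 * K ^ 4) * (w * l i) := le_mul_of_one_le_left (by positivity) h4
    have h8 : n * K * w ≤ n ^ 2 * K ^ 4 * w := by gcongr
    have h9 : n * (n * K) * w ≤ n ^ 2 * K ^ 4 * w := by gcongr
    have h10 : 0 ≤ n ^ 2 * K ^ 4 * (w * l i) := by positivity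
    have h11 : 0 ≤ n ^ 2 * K ^ 4 * w := by positivity
    linarith
  · have hl2 : ∀ i, 0 ≤ ((l i) ^ 2)⁻¹ := fun i => by have := F.pos i; positivity
    have hterm : ∀ i, ∑ k, (‖a k i‖ ^ 2 + 2 * (t k i * (starRingEnd ℂ) (g k)).re) -
        K * ∑ k, ∑ m, (‖a k i‖ * ‖g m‖ + ‖a m i‖ * ‖g k‖ + 2 * ((l i + K) * w))
          - K * (n ^ 2 * w) ≤
        (wirt z (-Complex.I) i (wirt z Complex.I i fun x =>
          ((components Ω.form z x)⁻¹ * gradMatrix z u x).trace) p).re := by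
      intro i
      rw [(hd (-Complex.I) Complex.I i).2, Complex.add_re, Complex.add_re, Complex.re_sum]
      simp only [hgrad0, (hgrad _ _ _).2.1, (hgrad _ _ _).2.2.1, (hgrad _ _ _).2.2.2]
      -- The square of the mixed derivative `q` is dropped, and the two terms with third derivatives
      -- have equal real parts.
      have h0 : ∑ k, (‖a k i‖ ^ 2 + 2 * (t k i * (starRingEnd ℂ) (g k)).re) ≤
          ∑ k, (t k i * (starRingEnd ℂ) (g k) + (starRingEnd ℂ) (q k i) * q k i +
            a k i * (starRingEnd ℂ) (a k i) + g k * (starRingEnd ℂ) (t k i)).re := by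
        refine Finset.sum_le_sum fun k _ => ?_
        rw [mul_comm ((starRingEnd ℂ) (q k i)), Complex.add_re, Complex.add_re, Complex.add_re,
          Complex.mul_conj, Complex.mul_conj, Complex.ofReal_re, Complex.ofReal_re,
          Complex.normSq_eq_norm_sq, Complex.normSq_eq_norm_sq]
        have h1 : (g k * (starRingEnd ℂ) (t k i)).re = (t k i * (starRingEnd ℂ) (g k)).re := by
          rw [← Complex.conj_re, map_mul, Complex.conj_conj, mul_comm]
        rw [h1]
        nlinarith [sq_nonneg ‖q k i‖]
      have h1 : -(K * ∑ k, ∑ m, (‖a k i‖ * ‖g m‖ + ‖a m i‖ * ‖g k‖ + 2 * ((l i + K) * w))) ≤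
          (∑ k, ∑ m,
          (wirt z Complex.I i (fun x => (components Ω.form z x)⁻¹ k m) p *
            (a m i * (starRingEnd ℂ) (g k) + g m * q k i) +
          wirt z (-Complex.I) i (fun x => (components Ω.form z x)⁻¹ k m) p *
            ((starRingEnd ℂ) (q m i) * (starRingEnd ℂ) (g k) +
              g m * (starRingEnd ℂ) (a k i)))).re := by
        refine (abs_le.1 ((Complex.abs_re_le_norm _).trans ?_)).1
        rw [Finset.mul_sum]
        refine norm_sum_le_of_le _ fun k _ => ?_
        rw [Finset.mul_sum]
        refine norm_sum_le_of_le _ fun m _ => (norm_add_le _ _).trans ?_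
        rw [norm_mul, norm_mul]
        have n1 : ‖a m i * (starRingEnd ℂ) (g k) + g m * q k i‖ ≤
            ‖a m i‖ * ‖g k‖ + (l i + K) * w := by
          refine (norm_add_le _ _).trans (add_le_add (by simp) ?_)
          rw [norm_mul, mul_comm]
          exact mul_le_mul (hqn' k i) (hgw m) (norm_nonneg _)
            (by have := (F.pos i).le; positivity)
        have n2 : ‖(starRingEnd ℂ) (q m i) * (starRingEnd ℂ) (g k) +
            g m * (starRingEnd ℂ) (a k i)‖ ≤ ‖a k i‖ * ‖g m‖ + (l i + K) * w := by
          rw [add_comm]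
          refine (norm_add_le _ _).trans (add_le_add (by simp [mul_comm]) ?_)
          rw [norm_mul, RCLike.norm_conj, RCLike.norm_conj]
          exact mul_le_mul (hqn' m i) (hgw k) (norm_nonneg _)
            (by have := (F.pos i).le; positivity)
        have h2 := mul_le_mul ((F.c2_inv k m).norm_wirt Complex.norm_I i) n1 (norm_nonneg _) hK0
        have h3 := mul_le_mul ((F.c2_inv k m).norm_wirt hI i) n2 (norm_nonneg _) hK0
        linarith
      have h2 : -(K * (n ^ 2 * w)) ≤ (∑ k, ∑ m, wirt z (-Complex.I) i (wirt z Complex.I i fun x =>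
          (components Ω.form z x)⁻¹ k m) p * (g m * (starRingEnd ℂ) (g k))).re := by
        refine (abs_le.1 ((Complex.abs_re_le_norm _).trans ?_)).1
        have h3 : ‖∑ k, ∑ m, wirt z (-Complex.I) i (wirt z Complex.I i fun x =>
          (components Ω.form z x)⁻¹ k m) p * (g m * (starRingEnd ℂ) (g k))‖ ≤
            ∑ _k : Fin n, ∑ _m : Fin n, K * w := by
          refine norm_sum_le_of_le _ fun k _ => norm_sum_le_of_le _ fun m _ => ?_
          rw [norm_mul, norm_mul, RCLike.norm_conj]
          exact mul_le_mul ((F.c2_inv k m).norm_wirt_wirt F.coord F.mem (hH k m) hI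
            Complex.norm_I i i) (hggw m k) (by positivity) hK0
        simp only [Finset.sum_const, Finset.card_univ, Fintype.card_fin, nsmul_eq_mul] at h3
        refine h3.trans (le_of_eq ?_)
        ring
      linarith
    have hS := Finset.sum_le_sum fun i (_ : i ∈ Finset.univ) =>
      mul_le_mul_of_nonneg_right (hterm i) (hl2 i)
    refine le_trans ?_ hS
    have hQ := sum_inv_sq_le F.pos hsum
    obtain ⟨Q, hQd⟩ : ∃ Q, Q = ∑ i, ((l i) ^ 2)⁻¹ := ⟨_, rfl⟩
    rw [← hQd] at hQ
    obtain ⟨R, hRd⟩ : ∃ R, R = ∑ i, ∑ k, ∑ m, ‖a k i‖ * ‖g m‖ * ((l i) ^ 2)⁻¹ := ⟨_, rfl⟩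
    obtain ⟨T, hTd⟩ : ∃ T, T = ∑ i, ∑ k, ‖a k i‖ ^ 2 * ((l i) ^ 2)⁻¹ := ⟨_, rfl⟩
    rw [← hRd, ← hTd]
    have hR0 : 0 ≤ R := by
      rw [hRd]
      exact Finset.sum_nonneg fun i _ => Finset.sum_nonneg fun b _ =>
        Finset.sum_nonneg fun k _ => by have := hl2 i; positivity
    -- The mixed derivatives of u may be as large as λ_i, which is not yet bounded above; against
    -- the weight λ_i⁻² they still sum to a bounded quantity.
    have hli : ∑ i, l i * ((l i) ^ 2)⁻¹ ≤ K := by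
      refine le_trans (le_of_eq (Finset.sum_congr rfl fun i _ => ?_)) hsum
      have := (F.pos i).ne'
      field_simp
    have e1 : ∑ i, (∑ k, (‖a k i‖ ^ 2 + 2 * (t k i * (starRingEnd ℂ) (g k)).re) -
        K * ∑ k, ∑ m, (‖a k i‖ * ‖g m‖ + ‖a m i‖ * ‖g k‖ + 2 * ((l i + K) * w))
          - K * (n ^ 2 * w)) * ((l i) ^ 2)⁻¹ = T + 2 * ∑ i, ∑ k,
            (t k i * (starRingEnd ℂ) (g k)).re * ((l i) ^ 2)⁻¹ - 2 * K * R
            - 2 * K * n ^ 2 * w * (∑ i, l i * ((l i) ^ 2)⁻¹) - 2 * K ^ 2 * n ^ 2 * w * Q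
            - K * n ^ 2 * w * Q := by
      have h1 : ∀ i, ∑ k, ∑ m, (‖a k i‖ * ‖g m‖ + ‖a m i‖ * ‖g k‖ + 2 * ((l i + K) * w)) =
          2 * ∑ k, ∑ m, ‖a k i‖ * ‖g m‖ + n ^ 2 * (2 * ((l i + K) * w)) := by
        intro i
        simp only [Finset.sum_add_distrib, Finset.sum_const, Finset.card_univ,
          Fintype.card_fin, nsmul_eq_mul]
        rw [Finset.sum_comm (f := fun k m => ‖a m i‖ * ‖g k‖)]
        ring
      have h2 : R = ∑ i, (∑ k, ∑ m, ‖a k i‖ * ‖g m‖) * ((l i) ^ 2)⁻¹ := by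
        rw [hRd]
        simp only [Finset.sum_mul]
      have h3 : T = ∑ i, (∑ k, ‖a k i‖ ^ 2) * ((l i) ^ 2)⁻¹ := by
        rw [hTd]
        simp only [Finset.sum_mul]
      simp only [← Finset.sum_mul]
      rw [h2, h3, hQd]
      rw [Finset.mul_sum (a := 2 * K), Finset.mul_sum (a := (2 : ℝ)),
        Finset.mul_sum (a := 2 * K * n ^ 2 * w), Finset.mul_sum (a := 2 * K ^ 2 * n ^ 2 * w),
        Finset.mul_sum (a := K * n ^ 2 * w), ← Finset.sum_add_distrib, ← Finset.sum_sub_distrib,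
        ← Finset.sum_sub_distrib, ← Finset.sum_sub_distrib, ← Finset.sum_sub_distrib]
      refine Finset.sum_congr rfl fun i _ => ?_
      rw [h1, Finset.sum_add_distrib, ← Finset.mul_sum]
      ring
    -- Third derivatives are not bounded individually. Summing over i first produces the combination
    -- controlled by the once differentiated equation.
    have e2 : -(n * (3 * K ^ 3 * w)) ≤
        ∑ i, ∑ k, (t k i * (starRingEnd ℂ) (g k)).re * ((l i) ^ 2)⁻¹ := by
      have h1 : ∑ i, ∑ k, (t k i * (starRingEnd ℂ) (g k)).re * ((l i) ^ 2)⁻¹ =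
          (∑ k, (∑ i, t k i * ((l i : ℂ) ^ 2)⁻¹) * (starRingEnd ℂ) (g k)).re := by
        rw [Finset.sum_comm, Complex.re_sum]
        refine Finset.sum_congr rfl fun k _ => ?_
        rw [Finset.sum_mul, Complex.re_sum]
        refine Finset.sum_congr rfl fun i _ => ?_
        rw [← Complex.re_mul_ofReal]
        push_cast
        congr 1
        ring
      rw [h1]
      refine (abs_le.1 ((Complex.abs_re_le_norm _).trans ?_)).1
      have h2 : ‖∑ k, (∑ i, t k i * ((l i : ℂ) ^ 2)⁻¹) * (starRingEnd ℂ) (g k)‖ ≤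
          ∑ _k : Fin n, 3 * K ^ 3 * w := by
        refine norm_sum_le_of_le _ fun k _ => ?_
        rw [norm_mul, RCLike.norm_conj]
        exact mul_le_mul (hR k) (hgw k) (norm_nonneg _) (by positivity)
      simpa using h2
    rw [e1]
    have k1 : 2 * K * R ≤ 20 * n ^ 2 * K ^ 4 * R := by
      refine mul_le_mul_of_nonneg_right ?_ hR0
      have := hK4 1 (by norm_num)
      rw [pow_one] at this
      nlinarith [mul_le_mul hn2 this hK0 (by positivity)]
    have k2 : n * (3 * K ^ 3 * w) ≤ 3 * (n ^ 2 * K ^ 4 * w) := by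
      calc n * (3 * K ^ 3 * w) ≤ n ^ 2 * (3 * K ^ 4 * w) := by
            have := hK4 3 (by norm_num)
            gcongr
        _ = _ := by ring
    have k3 : 2 * K * n ^ 2 * w * (∑ i, l i * ((l i) ^ 2)⁻¹) ≤ 2 * (n ^ 2 * K ^ 4 * w) := by
      calc _ ≤ 2 * K * n ^ 2 * w * K := mul_le_mul_of_nonneg_left hli (by positivity)
        _ = 2 * (n ^ 2 * K ^ 2 * w) := by ring
        _ ≤ _ := by
          have := hK4 2 (by norm_num)
          gcongr
    have k4 : 2 * K ^ 2 * n ^ 2 * w * Q ≤ 2 * (n ^ 2 * K ^ 4 * w) := by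
      calc _ ≤ 2 * K ^ 2 * n ^ 2 * w * K ^ 2 := mul_le_mul_of_nonneg_left hQ (by positivity)
        _ = _ := by ring
    have k5 : K * n ^ 2 * w * Q ≤ n ^ 2 * K ^ 4 * w := by
      calc _ ≤ K * n ^ 2 * w * K ^ 2 := mul_le_mul_of_nonneg_left hQ (by positivity)
        _ = n ^ 2 * K ^ 3 * w := by ring
        _ ≤ _ := by
          have := hK4 3 (by norm_num)
          gcongr
    have k6 : 0 ≤ n ^ 2 * K ^ 4 * w := by positivity
    linarith

end NormalFrame

end FirstOrder

/-! ### The maximum principle for w exp(exp(Aτ)) -/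

section AuxiliaryMaximum

variable {n : ℕ} [NeZero n] {M : Type*} [TopologicalSpace M]
  [ChartedSpace (EuclideanHalfSpace (2 * n)) M] [IsManifold (𝓡∂ (2 * n)) ∞ M]
  {J : ∀ x : M, Tan n x →ₗ[ℝ] Tan n x} {U : Set M} {z : M → Fin n → ℂ} {x p : M}

theorem CkOn.cexp {f : M → ℂ} {k : WithTop ℕ∞} (hf : CkOn n k f U) :
    CkOn n k (fun y => Complex.exp (f y)) U :=
  CkOn.comp (F := Complex.exp) Complex.contDiff_exp hf

theorem wirt_cexp (hU : IsOpen U) {f : M → ℂ} {k : WithTop ℕ∞} (hf : CkOn n k f U) (hk : 1 ≤ k)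
    (hx : x ∈ U) (c : ℂ) (i : Fin n) :
    wirt z c i (fun y => Complex.exp (f y)) x = Complex.exp (f x) * wirt z c i f x := by
  have h1 := (Complex.hasDerivAt_exp (f x)).hasFDerivAt.restrictScalars ℝ
  have h2 : ∀ a, coordDeriv z a (fun y => Complex.exp (f y)) x =
      Complex.exp (f x) * coordDeriv z a f x := fun a => by
    rw [coordDeriv_comp h1 (hf.mdifferentiableAt hU hk hx)]
    simp [mul_comm]
  simp only [wirt, h2]
  ring

theorem wirt_wirt_cexp (h : IsHolCoord J U z) {f : M → ℂ} (hf : CkOn n 2 f U)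
    (hx : x ∈ U) (c c' : ℂ) (i : Fin n) :
    wirt z c i (wirt z c' i fun y => Complex.exp (f y)) x = Complex.exp (f x) *
      (wirt z c i f x * wirt z c' i f x + wirt z c i (wirt z c' i f) x) := by
  have h12 : (1 : WithTop ℕ∞) ≤ 2 := by norm_num
  rw [wirt_congr_on h.isOpen (fun y hy => wirt_cexp h.isOpen hf h12 hy c' i) hx,
    wirt_mul h.isOpen (hf.cexp.of_le h12) (hf.wirt_two h c' i) le_rfl hx,
    wirt_cexp h.isOpen hf h12 hx]
  ring

theorem wirt_ofReal (hU : IsOpen U) {f : M → ℝ} {k : WithTop ℕ∞}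
    (hf : CkOn n k (fun y => (f y : ℂ)) U) (hk : 1 ≤ k) (hx : x ∈ U) (i : Fin n) :
    wirt z Complex.I i (fun y => (f y : ℂ)) x =
      (starRingEnd ℂ) (wirt z (-Complex.I) i (fun y => (f y : ℂ)) x) := by
  have := wirt_conj (z := z) hU hf hk hx Complex.I i
  simpa only [Complex.conj_ofReal, Complex.conj_I] using this

/-- At an interior local maximum of `w exp (exp (A τ))`, a differential inequality for `log w`
yields one for `τ`. -/
theorem linearized_le_of_isLocalMax (hz : IsHolCoord J U z) (hp : p ∈ U)
    (hint : (𝓡∂ (2 * n)).IsInteriorPoint p) {w τ : M → ℝ}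
    (hw : CkOn n 2 (fun x => (w x : ℂ)) U) (hτ : CkOn n 2 (fun x => (τ x : ℂ)) U) {A C : ℝ}
    (hmax : IsLocalMax (fun x => w x * Real.exp (Real.exp (A * τ x))) p) (hw0 : 0 < w p)
    (hτ0 : 0 ≤ τ p) (hA : 0 ≤ A) (hC : 0 ≤ C) (l : Fin n → ℝ)
    (hlog : (√(∑ i, ‖wirt z (-Complex.I) i (fun x => (w x : ℂ)) p‖ ^ 2 * ((l i) ^ 2)⁻¹) / w p) ^ 2
      - C * (1 + √(∑ i, ‖wirt z (-Complex.I) i (fun x => (w x : ℂ)) p‖ ^ 2 * ((l i) ^ 2)⁻¹) / w p) ≤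
      (∑ i, (wirt z (-Complex.I) i (wirt z Complex.I i fun x => (w x : ℂ)) p).re *
        ((l i) ^ 2)⁻¹) / w p) :
    A ^ 2 * √(∑ i, ‖wirt z (-Complex.I) i (fun x => (τ x : ℂ)) p‖ ^ 2 * ((l i) ^ 2)⁻¹) ^ 2
      - C * (1 + A * √(∑ i, ‖wirt z (-Complex.I) i (fun x => (τ x : ℂ)) p‖ ^ 2 * ((l i) ^ 2)⁻¹))
      + A * ∑ i, (wirt z (-Complex.I) i (wirt z Complex.I i fun x => (τ x : ℂ)) p).re *
        ((l i) ^ 2)⁻¹ ≤ 0 := by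
  have h12 : (1 : WithTop ℕ∞) ≤ 2 := by norm_num
  have hAτ : CkOn n 2 (fun x => (A : ℂ) * (τ x : ℂ)) U := (CkOn.const _).mul hτ
  have hΦ := hAτ.cexp.cexp
  have e : (fun x => ((w x * Real.exp (Real.exp (A * τ x)) : ℝ) : ℂ)) =
      fun x => (w x : ℂ) * Complex.exp (Complex.exp ((A : ℂ) * (τ x : ℂ))) := by
    funext x
    push_cast
    rfl
  have hF : CkOn n 2 (fun x => ((w x * Real.exp (Real.exp (A * τ x)) : ℝ) : ℂ)) U := by
    rw [e]
    exact hw.mul hΦ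
  set φ := Real.exp (A * τ p) with hφ
  have hφ1 : 1 ≤ φ := Real.one_le_exp (mul_nonneg hA hτ0)
  have hφ0 : 0 < φ := by linarith
  have hφc : Complex.exp ((A : ℂ) * (τ p : ℂ)) = (φ : ℂ) := by rw [hφ]; push_cast; rfl
  have d1 : ∀ c i, wirt z c i (fun x => (A : ℂ) * (τ x : ℂ)) p =
      A * wirt z c i (fun x => (τ x : ℂ)) p := fun c i => wirt_const_mul hz.isOpen hτ h12 hp _ _ _
  have d2 : ∀ c c' i, wirt z c i (wirt z c' i fun x => (A : ℂ) * (τ x : ℂ)) p =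
      A * wirt z c i (wirt z c' i fun x => (τ x : ℂ)) p := fun c c' i => by
    rw [wirt_congr_on hz.isOpen (fun y hy => wirt_const_mul hz.isOpen hτ h12 hy _ _ _) hp,
      wirt_const_mul hz.isOpen (hτ.wirt_two hz _ _) le_rfl hp]
  have hE0 : Complex.exp (φ : ℂ) ≠ 0 := Complex.exp_ne_zero _
  have hEr : Complex.exp (φ : ℂ) = ((Real.exp φ : ℝ) : ℂ) := by push_cast; rfl
  -- With φ = exp(Aτ), the first order condition is w_i = −wφAτ_i. Inserted in the second order
  -- condition, the two cross terms contribute −2w(φA)²|τ_i|², while the double exponential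
  -- contributes w(φA)²|τ_i|² and wφA²|τ_i|².
  have hkey : ∀ i, wirt z (-Complex.I) i (fun x => (w x : ℂ)) p =
        -((w p * (φ * A) : ℝ) : ℂ) * wirt z (-Complex.I) i (fun x => (τ x : ℂ)) p ∧
      (wirt z (-Complex.I) i (wirt z Complex.I i fun x => (w x : ℂ)) p).re ≤
        w p * ((φ * A) ^ 2 - φ * A ^ 2) * ‖wirt z (-Complex.I) i (fun x => (τ x : ℂ)) p‖ ^ 2 -
        w p * (φ * A) * (wirt z (-Complex.I) i (wirt z Complex.I i fun x => (τ x : ℂ)) p).re := by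
    intro i
    obtain ⟨h1, h2⟩ := wirt_of_isLocalMax hz hF hp hint hmax i
    rw [e, wirt_mul hz.isOpen hw hΦ h12 hp, wirt_cexp hz.isOpen hAτ.cexp h12 hp,
      wirt_cexp hz.isOpen hAτ h12 hp, d1, hφc] at h1
    have hwi : wirt z (-Complex.I) i (fun x => (w x : ℂ)) p =
        -((w p * (φ * A) : ℝ) : ℂ) * wirt z (-Complex.I) i (fun x => (τ x : ℂ)) p := by
      apply mul_left_cancel₀ hE0
      push_cast
      linear_combination h1
    refine ⟨hwi, ?_⟩
    rw [e, wirt_wirt_mul hz hw hΦ hp, wirt_wirt_cexp hz hAτ.cexp hp, wirt_wirt_cexp hz hAτ hp,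
      wirt_cexp hz.isOpen hAτ.cexp h12 hp, wirt_cexp hz.isOpen hAτ.cexp h12 hp,
      wirt_cexp hz.isOpen hAτ h12 hp, wirt_cexp hz.isOpen hAτ h12 hp, d1, d1, d2, hφc,
      wirt_ofReal hz.isOpen hw h12 hp, wirt_ofReal hz.isOpen hτ h12 hp, hwi] at h2
    generalize wirt z (-Complex.I) i (fun x => (τ x : ℂ)) p = t at h2 ⊢
    generalize wirt z (-Complex.I) i (wirt z Complex.I i fun x => (τ x : ℂ)) p = D at h2 ⊢
    generalize wirt z (-Complex.I) i (wirt z Complex.I i fun x => (w x : ℂ)) p = W at h2 ⊢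
    have h3 : t * (starRingEnd ℂ) t = ((‖t‖ ^ 2 : ℝ) : ℂ) := by
      rw [Complex.mul_conj, Complex.normSq_eq_norm_sq]
    have h4 : W * Complex.exp (φ : ℂ) +
        (starRingEnd ℂ) (-((w p * (φ * A) : ℝ) : ℂ) * t) * (Complex.exp (φ : ℂ) * (φ * (A * t))) +
        (-((w p * (φ * A) : ℝ) : ℂ) * t) *
          (Complex.exp (φ : ℂ) * (φ * (A * (starRingEnd ℂ) t))) +
        w p * (Complex.exp (φ : ℂ) * (φ * (A * t) * (φ * (A * (starRingEnd ℂ) t)) +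
          φ * (A * t * (A * (starRingEnd ℂ) t) + A * D))) =
        ((Real.exp φ : ℝ) : ℂ) * (W + ((w p * (φ * A ^ 2 - (φ * A) ^ 2) * ‖t‖ ^ 2 : ℝ) : ℂ) +
          ((w p * (φ * A) : ℝ) : ℂ) * D) := by
      rw [← hEr, map_mul, map_neg, Complex.conj_ofReal]
      push_cast at h3 ⊢
      linear_combination Complex.exp (φ : ℂ) * w p * (φ * A ^ 2 - (φ * A) ^ 2) * h3
    rw [h4, Complex.re_ofReal_mul, Complex.add_re, Complex.add_re, Complex.ofReal_re,
      Complex.re_ofReal_mul] at h2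
    have h5 := nonpos_of_mul_nonpos_right h2 (Real.exp_pos φ)
    linarith
  set σ := √(∑ i, ‖wirt z (-Complex.I) i (fun x => (τ x : ℂ)) p‖ ^ 2 * ((l i) ^ 2)⁻¹) with hσ
  have hσ0 : 0 ≤ σ := Real.sqrt_nonneg _
  have hl2 : ∀ i, 0 ≤ ((l i) ^ 2)⁻¹ := fun i => by positivity
  have hσ2 : σ ^ 2 = ∑ i, ‖wirt z (-Complex.I) i (fun x => (τ x : ℂ)) p‖ ^ 2 * ((l i) ^ 2)⁻¹ :=
    Real.sq_sqrt (Finset.sum_nonneg fun i _ => mul_nonneg (sq_nonneg _) (hl2 i))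
  set L := ∑ i, (wirt z (-Complex.I) i (wirt z Complex.I i fun x => (τ x : ℂ)) p).re *
        ((l i) ^ 2)⁻¹ with hL
  -- The first order condition identifies |∂w|/w in the weighted norm with φAσ.
  have hs : √(∑ i, ‖wirt z (-Complex.I) i (fun x => (w x : ℂ)) p‖ ^ 2 * ((l i) ^ 2)⁻¹) / w p =
      φ * A * σ := by
    have h1 : ∑ i, ‖wirt z (-Complex.I) i (fun x => (w x : ℂ)) p‖ ^ 2 * ((l i) ^ 2)⁻¹ =
        (w p * (φ * A)) ^ 2 * ∑ i,
          ‖wirt z (-Complex.I) i (fun x => (τ x : ℂ)) p‖ ^ 2 * ((l i) ^ 2)⁻¹ := by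
      rw [Finset.mul_sum]
      refine Finset.sum_congr rfl fun i _ => ?_
      rw [(hkey i).1, norm_mul, norm_neg, Complex.norm_real, mul_pow, Real.norm_eq_abs, sq_abs]
      ring
    rw [h1, Real.sqrt_mul (sq_nonneg _), Real.sqrt_sq (by positivity), ← hσ]
    field_simp
  rw [hs] at hlog
  have hS : (∑ i, (wirt z (-Complex.I) i (wirt z Complex.I i fun x => (w x : ℂ)) p).re *
        ((l i) ^ 2)⁻¹) / w p ≤ ((φ * A) ^ 2 - φ * A ^ 2) * σ ^ 2 - φ * A * L := by
    rw [div_le_iff₀ hw0, hσ2, hL, Finset.mul_sum, Finset.mul_sum, ← Finset.sum_sub_distrib,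
      Finset.sum_mul]
    refine Finset.sum_le_sum fun i _ => ?_
    refine (mul_le_mul_of_nonneg_right (hkey i).2 (hl2 i)).trans (le_of_eq ?_)
    ring
  -- The term (φA)²σ² on the right cancels s² on the left. What survives is the gain φA²σ² from the
  -- outer exponential.
  have h1 : φ * (A ^ 2 * σ ^ 2 + A * L) ≤ C * (1 + φ * A * σ) := by
    nlinarith [hlog.trans hS]
  -- φ ≥ 1, from τ ≥ 0 at the maximum, allows division by φ.
  have h2 : C * (1 + φ * A * σ) ≤ φ * (C * (1 + A * σ)) := by nlinarith
  have h3 := le_of_mul_le_mul_left (h1.trans h2) hφ0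
  linarith

end AuxiliaryMaximum

/-! ### Bounds at an interior maximum -/

section PointwiseBounds

open Matrix

variable {n : ℕ} [NeZero n] {M : Type*} [TopologicalSpace M]
  [ChartedSpace (EuclideanHalfSpace (2 * n)) M] [IsManifold (𝓡∂ (2 * n)) ∞ M]
  {𝒥 : ComplexStructure n M}

theorem gradMatrix_isHermitian {J : ∀ x : M, Tan n x →ₗ[ℝ] Tan n x} {U : Set M}
    {z : M → Fin n → ℂ} {x : M} (hz : IsHolCoord J U z) (hx : x ∈ U) {u : M → ℝ}
    (hu : CkOn n 1 (fun x => (u x : ℂ)) U) : (gradMatrix z u x).IsHermitian := by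
  ext i j
  have h1 : ∀ k, partialZbar z k (fun y => (u y : ℂ)) x =
      (starRingEnd ℂ) (partialZ z k (fun y => (u y : ℂ)) x) := fun k => by
    rw [partialZbar_eq_wirt, partialZ_eq_wirt]
    exact wirt_ofReal hz.isOpen hu le_rfl hx k
  simp only [conjTranspose_apply, gradMatrix, Matrix.of_apply, h1, star_mul', RCLike.star_def,
    Complex.conj_conj]
  ring

/-- The trace of `χ_u` with respect to the metric. -/
def formTrace (Ω : HermitianMetric 𝒥) (χ : RealOneOneForm 𝒥) (u : M → ℝ) (x : M) : ℝ :=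
  laplacian Ω u x + metricTrace Ω χ x

theorem formTrace_eq (Ω : HermitianMetric 𝒥) {χ : RealOneOneForm 𝒥} {u : M → ℝ} (hu : IsCk n 2 u)
    (hpos : ∀ x, (chiMatrix χ u x).PosDef) {U : Set M} {z : M → Fin n → ℂ}
    (h : IsHolCoord 𝒥.J U z) {x : M} (hx : x ∈ U) :
    (formTrace Ω χ u x : ℂ) = ((components Ω.form z x)⁻¹ * chiComp χ u z x).trace := by
  rw [← trace_inv_mul_im (metric_posDef Ω h hx).1 (chiComp_posDef χ hu (hpos x) h hx).1, formTrace,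
    laplacian_eq Ω hu h hx, metricTrace_eq Ω χ h hx, chiComp, Matrix.mul_add, trace_add,
    Complex.add_re, add_comm]

theorem gradSq_eq_trace (Ω : HermitianMetric 𝒥) {u : M → ℝ} (hu : IsCk n 1 u)
    {U : Set M} {z : M → Fin n → ℂ} (h : IsHolCoord 𝒥.J U z) {x : M} (hx : x ∈ U) :
    (gradSq Ω u x : ℂ) = ((components Ω.form z x)⁻¹ * gradMatrix z u x).trace := by
  rw [← trace_inv_mul_im (metric_posDef Ω h hx).1
    (gradMatrix_isHermitian h hx (IsCk.ofReal hu U)), gradSq_eq Ω u h hx]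

namespace NormalFrame

variable {Ω : HermitianMetric 𝒥} {χ : RealOneOneForm 𝒥} {ψ u v τ : M → ℝ} {U : Set M}
  {z : M → Fin n → ℂ} {p : M} {l : Fin n → ℝ} {K : ℝ}

theorem formTrace_eq_sum (F : NormalFrame Ω χ ψ u U z p l K) (hu : IsCk n 2 u)
    (hpos : ∀ x, (chiMatrix χ u x).PosDef) : formTrace Ω χ u p = ∑ i, l i := by
  have h1 := formTrace_eq Ω hu hpos F.coord F.mem
  rw [F.metric, inv_one, Matrix.one_mul, F.form, trace_diagonal] at h1
  exact_mod_cast h1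

theorem gradSq_eq_sum (F : NormalFrame Ω χ ψ u U z p l K) (hu : IsCk n 1 u) :
    gradSq Ω u p = ∑ k, ‖wirt z (-Complex.I) k (fun x => (u x : ℂ)) p‖ ^ 2 := by
  have h1 := gradSq_eq_trace Ω hu F.coord F.mem
  rw [F.metric, inv_one, Matrix.one_mul, Matrix.trace] at h1
  have h2 : ∀ k, (gradMatrix z u p).diag k =
      ((‖wirt z (-Complex.I) k (fun x => (u x : ℂ)) p‖ ^ 2 : ℝ) : ℂ) := fun k => by
    rw [Matrix.diag_apply, gradMatrix, Matrix.of_apply, partialZ_eq_wirt, partialZbar_eq_wirt,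
      wirt_ofReal F.coord.isOpen (IsCk.ofReal hu U) le_rfl F.mem, Complex.mul_conj,
      Complex.normSq_eq_norm_sq]
  simp only [h2] at h1
  exact_mod_cast h1

theorem abs_metricTrace_le (F : NormalFrame Ω χ ψ u U z p l K) : |metricTrace Ω χ p| ≤ n * K := by
  rw [metricTrace_eq Ω χ F.coord F.mem, F.metric, inv_one, Matrix.one_mul]
  refine (Complex.abs_re_le_norm _).trans ?_
  have h1 : ‖(components χ.form z p).trace‖ ≤ ∑ _i : Fin n, K :=
    norm_sum_le_of_le _ fun i _ => (c2At_iff.1 (F.c2_form i i)).1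
  simpa using h1

/-- The linearized operator applied to the difference of a subsolution and the solution. -/
theorem subsolution_lower_bound (F : NormalFrame Ω χ ψ u U z p l K) (hu : IsCk n 4 u)
    (hv : IsCk n 2 v) (hψ : ∀ x, 0 < ψ x) (hsol : IsSolution Ω χ ψ u)
    (hsub : IsSubsolution Ω χ ψ v) {b : ℝ} (hτ : τ = fun x => v x - u x + b) :
    0 ≤ ∑ i, (wirt z (-Complex.I) i (wirt z Complex.I i fun x => (τ x : ℂ)) p).re *
        ((l i) ^ 2)⁻¹ ∧
      ∀ m, ∀ K' : ℝ, (chiComp χ v z p m m).re ≤ K' → K'⁻¹ - 2 * (l m)⁻¹ ≤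
        ∑ i, (wirt z (-Complex.I) i (wirt z Complex.I i fun x => (τ x : ℂ)) p).re *
          ((l i) ^ 2)⁻¹ := by
  have hvU : CkOn n 2 (fun x => (v x : ℂ)) U := IsCk.ofReal hv U
  have huU : CkOn n 2 (fun x => (u x : ℂ)) U := (IsCk.ofReal hu U : CkOn n 4 _ U).of_le (by norm_num)
  -- The form χ cancels in χ_v − χ_u, leaving the complex Hessian of v − u, and χ_u is diagonal in
  -- the frame.
  have h1 : ∀ i, (wirt z (-Complex.I) i (wirt z Complex.I i fun x => (τ x : ℂ)) p).re =
      (chiComp χ v z p i i).re - l i := by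
    intro i
    have e : (fun x => (τ x : ℂ)) = fun x => ((v x : ℂ) + (-1) * (u x : ℂ)) + (b : ℂ) := by
      funext x
      rw [hτ]
      push_cast
      ring
    have e2 : ∀ f : M → ℝ, wirt z (-Complex.I) i (wirt z Complex.I i fun x => (f x : ℂ)) p =
        complexHessian z f p i i := fun f => by
      rw [← partialZ_eq_wirt, ← partialZbar_eq_wirt]
      rfl
    rw [e, wirt_wirt_add F.coord (hvU.add ((CkOn.const _).mul huU)) (CkOn.const _) F.mem,
      wirt_wirt_const F.coord _ _ _ _ _ F.mem,
      wirt_wirt_add F.coord hvU ((CkOn.const _).mul huU) F.mem,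
      wirt_wirt_mul F.coord (CkOn.const _) huU F.mem, wirt_wirt_const F.coord _ _ _ _ _ F.mem,
      wirt_const, wirt_const, e2, e2]
    have h2 := congrFun (congrFun F.form i) i
    rw [chiComp, Matrix.add_apply, diagonal_apply_eq] at h2
    have h3 : chiComp χ v z p i i = components χ.form z p i i + complexHessian z v p i i := rfl
    have h4 : (l i : ℝ) = ((l i : ℝ) : ℂ).re := (Complex.ofReal_re _).symm
    rw [h3, h4, ← h2]
    simp only [Complex.add_re, add_zero, zero_mul, zero_add, neg_mul, one_mul, Complex.neg_re]
    ring
  simp only [h1]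
  -- In the frame G = 1, so the subsolution condition reads tr χ_v⁻¹ ≤ n/ψ = Σ 1/λ_i.
  refine linearized_lower_bound F.pos (chiComp_posDef χ hv (hsub p).1 F.coord F.mem) ?_
  rw [F.sum_inv_eq hu hψ hsol]
  have h2 := hsub.trace_le hv F.coord F.mem
  rw [F.metric, Matrix.mul_one] at h2
  rw [← div_eq_mul_inv, le_div_iff₀ (hψ p)]
  linarith

/-- At an interior maximum of the auxiliary function the eigenvalues of `χ_u` are bounded. -/
theorem eigenvalue_le_of_isLocalMax (F : NormalFrame Ω χ ψ u U z p l K) (hu : IsCk n 4 u)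
    (hv : IsCk n 2 v) (hψ : ∀ x, 0 < ψ x) (hsol : IsSolution Ω χ ψ u)
    (hsub : IsSubsolution Ω χ ψ v) {b : ℝ} (hτ : τ = fun x => v x - u x + b)
    (hvK : ∀ m, (chiComp χ v z p m m).re ≤ K) {C A σ : ℝ} (hC : 0 ≤ C)
    (hA : A = 2 * K * (C + C ^ 2 + 1))
    (h : A ^ 2 * σ ^ 2 - C * (1 + A * σ) + A *
      ∑ i, (wirt z (-Complex.I) i (wirt z Complex.I i fun x => (τ x : ℂ)) p).re *
        ((l i) ^ 2)⁻¹ ≤ 0) (hσ : 0 ≤ σ) : (∀ m, l m ≤ 4 * K) ∧ σ ≤ C + 1 := by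
  obtain ⟨h1, h2⟩ := F.subsolution_lower_bound hu hv hψ hsol hsub hτ
  have hK1 := F.one_le
  have hK0 : 0 < K := by linarith
  have hA1 : 1 ≤ A := by
    rw [hA]
    nlinarith [mul_nonneg hK0.le (add_nonneg hC (sq_nonneg C))]
  constructor
  · intro m
    -- If λ_m > 4K, then Lτ ≥ 1/K − 2/(4K) = 1/(2K).
    by_contra! hm
    have h3 := h2 m K (hvK m)
    have h4 : (l m)⁻¹ ≤ (4 * K)⁻¹ := inv_anti₀ (by positivity) hm.le
    have h5 : K⁻¹ - 2 * (4 * K)⁻¹ = (2 * K)⁻¹ := by field_simp; norm_num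
    have h6 := mul_le_mul_of_nonneg_left ((by linarith : (2 * K)⁻¹ ≤ _) : (2 * K)⁻¹ ≤
      ∑ i, (wirt z (-Complex.I) i (wirt z Complex.I i fun x => (τ x : ℂ)) p).re *
        ((l i) ^ 2)⁻¹) (by linarith : 0 ≤ A)
    -- This is the reason for the choice of A: the gain exceeds C + C², while (Aσ)² − CAσ is never
    -- below −C²/4.
    have h7 : A * (2 * K)⁻¹ = C + C ^ 2 + 1 := by
      rw [hA]
      field_simp
    nlinarith [sq_nonneg (A * σ - C / 2)]
  · have h3 := mul_nonneg (by linarith : 0 ≤ A) h1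
    -- Dropping A Lτ ≥ 0 leaves (Aσ)² ≤ C + CAσ, impossible for Aσ > C + 1; and σ ≤ Aσ as A ≥ 1.
    by_contra! hm
    have h4 : σ ≤ A * σ := le_mul_of_one_le_left hσ hA1
    nlinarith [mul_pos (by linarith : 0 < A * σ) (by linarith : 0 < A * σ - (C + 1))]

/-- In the frame the trace is Σ λ_i, so the eigenvalue bound at the maximum suffices. -/
theorem formTrace_le_of_isLocalMax (F : NormalFrame Ω χ ψ u U z p l K) (hu : IsCk n 4 u)
    (hv : IsCk n 2 v) (hψ2 : IsCk n 2 ψ) (hψ : ∀ x, 0 < ψ x) (hsol : IsSolution Ω χ ψ u)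
    (hsub : IsSubsolution Ω χ ψ v) {b : ℝ} (hτ : τ = fun x => v x - u x + b) (hτ0 : 0 ≤ τ p)
    (hvK : ∀ m, (chiComp χ v z p m m).re ≤ K) {C A : ℝ}
    (hC : C = 3 * (10 * n ^ 2 * K ^ 5 * (1 + K + 2 * n * K)) +
      2 * (10 * n ^ 2 * K ^ 5 * (1 + K + 2 * n * K)) ^ 2)
    (hA : A = 2 * K * (C + C ^ 2 + 1)) (hint : (𝓡∂ (2 * n)).IsInteriorPoint p)
    (hmax : IsLocalMax (fun x => formTrace Ω χ u x * Real.exp (Real.exp (A * τ x))) p) :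
    formTrace Ω χ u p ≤ n * (4 * K) := by
  have hK1 := F.one_le
  have hK0 : 0 < K := by linarith
  have hC0 : 0 ≤ C := by rw [hC]; positivity
  have hu2 : IsCk n 2 u := hu.of_le (by norm_num)
  have hvU : CkOn n 2 (fun x => (v x : ℂ)) U := IsCk.ofReal hv U
  have huU : CkOn n 2 (fun x => (u x : ℂ)) U := IsCk.ofReal hu2 U
  have hτU : CkOn n 2 (fun x => (τ x : ℂ)) U :=
    (((hvU.add ((CkOn.const (-1)).mul huU))).add (CkOn.const (b : ℂ))).congr fun x _ => by
      rw [hτ]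
      push_cast
      ring
  have hWeq : ∀ x ∈ U, (formTrace Ω χ u x : ℂ) =
      ((components Ω.form z x)⁻¹ * chiComp χ u z x).trace := fun x hx =>
    formTrace_eq Ω hu2 (fun x => (hsol x).1) F.coord hx
  have hwU : CkOn n 2 (fun x => (formTrace Ω χ u x : ℂ)) U :=
    (CkOn.trace_mul (fun i j => (CkOn.metric_inv Ω F.coord i j).of_le two_le_infty)
      (fun i j => CkOn.chiComp F.coord hu i j)).congr hWeq
  have hwp : formTrace Ω χ u p = ∑ i, l i := F.formTrace_eq_sum hu2 fun x => (hsol x).1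
  have hn : 0 < n := Nat.pos_of_ne_zero (NeZero.ne n)
  have hw0 : 0 < formTrace Ω χ u p := by
    rw [hwp]
    exact Finset.sum_pos (fun i _ => F.pos i) ⟨⟨0, hn⟩, Finset.mem_univ _⟩
  have hlog := F.trace_log_bound hu hψ2 hψ hsol rfl rfl
  rw [← hwp, ← hC] at hlog
  have d1 : ∀ i, wirt z (-Complex.I) i (fun x => (formTrace Ω χ u x : ℂ)) p = wirt z (-Complex.I) i
      (fun x => ((components Ω.form z x)⁻¹ * chiComp χ u z x).trace) p := fun i =>
    wirt_congr_on F.coord.isOpen hWeq F.mem _ i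
  have d2 : ∀ i, wirt z (-Complex.I) i (wirt z Complex.I i fun x => (formTrace Ω χ u x : ℂ)) p =
      wirt z (-Complex.I) i (wirt z Complex.I i
        fun x => ((components Ω.form z x)⁻¹ * chiComp χ u z x).trace) p := fun i =>
    wirt_congr_on F.coord.isOpen (fun y hy => wirt_congr_on F.coord.isOpen hWeq hy _ i) F.mem _ i
  simp only [← d1, ← d2] at hlog
  have hkey := linearized_le_of_isLocalMax F.coord F.mem hint hwU hτU hmax hw0 hτ0
    (by rw [hA]; positivity) hC0 l hlog
  have := (F.eigenvalue_le_of_isLocalMax hu hv hψ hsol hsub hτ hvK hC0 hA hkey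
    (Real.sqrt_nonneg _)).1
  rw [hwp]
  refine (Finset.sum_le_sum fun i _ => this i).trans (le_of_eq ?_)
  simp

/-- A single term of the weighted sum gives |τ_k| ≤ λ_k C, and u differs from −τ by v and a
constant. -/
theorem norm_deriv_le_of_sqrt_le (F : NormalFrame Ω χ ψ u U z p l K)
    (huU : CkOn n 2 (fun x => (u x : ℂ)) U) (hvU : CkOn n 2 (fun x => (v x : ℂ)) U) {b : ℝ}
    (hτ : τ = fun x => v x - u x + b)
    (hvK : ∀ i, ‖wirt z (-Complex.I) i (fun x => (v x : ℂ)) p‖ ≤ K) {K' C : ℝ}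
    (hl : ∀ i, l i ≤ K') (hC : 0 ≤ C)
    (hσ : √(∑ i, ‖wirt z (-Complex.I) i (fun x => (τ x : ℂ)) p‖ ^ 2 * ((l i) ^ 2)⁻¹) ≤ C)
    (k : Fin n) : ‖wirt z (-Complex.I) k (fun x => (u x : ℂ)) p‖ ≤ K + K' * C := by
  have h12 : (1 : WithTop ℕ∞) ≤ 2 := by norm_num
  have h1 : ‖wirt z (-Complex.I) k (fun x => (τ x : ℂ)) p‖ ≤ l k * C := by
    have h2 : ‖wirt z (-Complex.I) k (fun x => (τ x : ℂ)) p‖ * (l k)⁻¹ ≤ C := by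
      refine le_trans (Real.le_sqrt_of_sq_le ?_) hσ
      rw [mul_pow, inv_pow]
      exact Finset.single_le_sum
        (f := fun i => ‖wirt z (-Complex.I) i (fun x => (τ x : ℂ)) p‖ ^ 2 * ((l i) ^ 2)⁻¹)
        (fun i _ => by positivity) (Finset.mem_univ k)
    rw [← div_eq_mul_inv, div_le_iff₀ (F.pos k)] at h2
    linarith
  have e : (fun x => (τ x : ℂ)) = fun x => ((v x : ℂ) + (-1) * (u x : ℂ)) + (b : ℂ) := by
    funext x
    rw [hτ]
    push_cast
    ring
  rw [e, wirt_add F.coord.isOpen (hvU.add ((CkOn.const _).mul huU)) (CkOn.const _) h12 F.mem,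
    wirt_const, wirt_add F.coord.isOpen hvU ((CkOn.const _).mul huU) h12 F.mem,
    wirt_const_mul F.coord.isOpen huU h12 F.mem, add_zero] at h1
  have h2 := norm_sub_norm_le (wirt z (-Complex.I) k (fun x => (u x : ℂ)) p)
    (wirt z (-Complex.I) k (fun x => (v x : ℂ)) p)
  have h3 : ‖wirt z (-Complex.I) k (fun x => (u x : ℂ)) p -
      wirt z (-Complex.I) k (fun x => (v x : ℂ)) p‖ =
      ‖wirt z (-Complex.I) k (fun x => (v x : ℂ)) p +
        -1 * wirt z (-Complex.I) k (fun x => (u x : ℂ)) p‖ := by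
    rw [← norm_neg]
    congr 1
    ring
  have h4 := mul_le_mul_of_nonneg_right (hl k) hC
  linarith [hvK k]

/-- The eigenvalue bound alone says nothing about the gradient. Combined with σ ≤ C + 1, it turns
the weighted bound for ∂τ into an honest one, hence bounds ∂u. -/
theorem gradSq_le_of_isLocalMax (F : NormalFrame Ω χ ψ u U z p l K) (hu : IsCk n 4 u)
    (hv : IsCk n 2 v) (hψ : ∀ x, 0 < ψ x) (hsol : IsSolution Ω χ ψ u)
    (hsub : IsSubsolution Ω χ ψ v) {b : ℝ} (hτ : τ = fun x => v x - u x + b) (hτ0 : 0 ≤ τ p)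
    (hvK : ∀ m, (chiComp χ v z p m m).re ≤ K)
    (hvK' : ∀ i, ‖wirt z (-Complex.I) i (fun x => (v x : ℂ)) p‖ ≤ K) {C A : ℝ}
    (hC : C = 3 * (20 * n ^ 2 * K ^ 4 * (1 + n * K + n * (1 + K))) +
      2 * (20 * n ^ 2 * K ^ 4 * (1 + n * K + n * (1 + K))) ^ 2)
    (hA : A = 2 * K * (C + C ^ 2 + 1)) (hint : (𝓡∂ (2 * n)).IsInteriorPoint p)
    (hmax : IsLocalMax (fun x => gradSq Ω u x * Real.exp (Real.exp (A * τ x))) p) :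
    gradSq Ω u p ≤ n * (K + 4 * K * (C + 1)) ^ 2 := by
  have hK1 := F.one_le
  have hK0 : 0 < K := by linarith
  have hC0 : 0 ≤ C := by rw [hC]; positivity
  have hu2 : IsCk n 2 u := hu.of_le (by norm_num)
  have hvU : CkOn n 2 (fun x => (v x : ℂ)) U := IsCk.ofReal hv U
  have huU : CkOn n 2 (fun x => (u x : ℂ)) U := IsCk.ofReal hu2 U
  have hτU : CkOn n 2 (fun x => (τ x : ℂ)) U :=
    (((hvU.add ((CkOn.const (-1)).mul huU))).add (CkOn.const (b : ℂ))).congr fun x _ => by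
      rw [hτ]
      push_cast
      ring
  have hWeq : ∀ x ∈ U, (gradSq Ω u x : ℂ) =
      ((components Ω.form z x)⁻¹ * gradMatrix z u x).trace := fun x hx =>
    gradSq_eq_trace Ω (hu.of_le (by norm_num)) F.coord hx
  have hwU : CkOn n 2 (fun x => (gradSq Ω u x : ℂ)) U :=
    (CkOn.trace_mul (fun i j => (CkOn.metric_inv Ω F.coord i j).of_le two_le_infty)
      (fun i j => (IsCk.ofReal hu U : CkOn n 4 _ U).gradMatrix F.coord (by norm_num)
        three_le_infty i j)).congr hWeq
  have hwp := F.gradSq_eq_sum (hu.of_le (by norm_num))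
  have hn : 0 < n := Nat.pos_of_ne_zero (NeZero.ne n)
  have hn1 : (1 : ℝ) ≤ n := by exact_mod_cast hn
  -- The differential inequality is available only where |∇u| ≥ 1; otherwise the claim holds because
  -- the right side is at least 1.
  rcases lt_or_ge (gradSq Ω u p) 1 with hlt | hge
  · refine hlt.le.trans ?_
    have h1 : 1 ≤ K + 4 * K * (C + 1) := by
      have : 0 ≤ 4 * K * (C + 1) := by positivity
      linarith
    nlinarith [one_le_pow₀ h1 (n := 2)]
  have hw0 : 0 < gradSq Ω u p := by linarith
  have hlog := F.grad_log_bound hu hψ hsol rfl hwp hge rfl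
  rw [← hC] at hlog
  have d1 : ∀ i, wirt z (-Complex.I) i (fun x => (gradSq Ω u x : ℂ)) p = wirt z (-Complex.I) i
      (fun x => ((components Ω.form z x)⁻¹ * gradMatrix z u x).trace) p := fun i =>
    wirt_congr_on F.coord.isOpen hWeq F.mem _ i
  have d2 : ∀ i, wirt z (-Complex.I) i (wirt z Complex.I i fun x => (gradSq Ω u x : ℂ)) p =
      wirt z (-Complex.I) i (wirt z Complex.I i
        fun x => ((components Ω.form z x)⁻¹ * gradMatrix z u x).trace) p := fun i =>
    wirt_congr_on F.coord.isOpen (fun y hy => wirt_congr_on F.coord.isOpen hWeq hy _ i) F.mem _ i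
  simp only [← d1, ← d2] at hlog
  have hA0 : 0 ≤ A := by rw [hA]; positivity
  have hkey := linearized_le_of_isLocalMax F.coord F.mem hint hwU hτU hmax hw0 hτ0
    hA0 hC0 l hlog
  obtain ⟨hl, hσ⟩ := F.eigenvalue_le_of_isLocalMax hu hv hψ hsol hsub hτ hvK hC0 hA hkey
    (Real.sqrt_nonneg _)
  have hbound : ∀ k, ‖wirt z (-Complex.I) k (fun x => (u x : ℂ)) p‖ ≤ K + 4 * K * (C + 1) :=
    fun k => F.norm_deriv_le_of_sqrt_le huU hvU hτ hvK' hl (by linarith) hσ k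
  rw [hwp]
  refine (Finset.sum_le_sum fun k _ => pow_le_pow_left₀ (norm_nonneg _) (hbound k) 2).trans
    (le_of_eq ?_)
  simp

end NormalFrame

end PointwiseBounds

/-! ### Existence of normal frames with uniform bounds -/

section FrameExistence

open Matrix

variable {n : ℕ} [NeZero n] {M : Type*} [TopologicalSpace M]
  [ChartedSpace (EuclideanHalfSpace (2 * n)) M] [IsManifold (𝓡∂ (2 * n)) ∞ M]
  {𝒥 : ComplexStructure n M}

theorem coordDeriv_inv {U : Set M} {z : M → Fin n → ℂ} {x : M} (hU : IsOpen U) {f : M → ℂ}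
    (hf : CkOn n 1 f U) (hx : x ∈ U) (h0 : f x ≠ 0) (a : Fin n → ℂ) :
    coordDeriv z a (fun y => (f y)⁻¹) x = -(coordDeriv z a f x * ((f x)⁻¹ * (f x)⁻¹)) := by
  have h1 := (hasDerivAt_inv h0).hasFDerivAt.restrictScalars ℝ
  rw [coordDeriv_comp h1 (hf.mdifferentiableAt hU le_rfl hx)]
  simp [pow_two]

/-- The three summands bound the value, the first and the second derivatives of 1/f. -/
theorem C2At.inv {J : ∀ x : M, Tan n x →ₗ[ℝ] Tan n x} {U : Set M} {z : M → Fin n → ℂ} {x : M}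
    (h : IsHolCoord J U z) (hx : x ∈ U) {f : M → ℂ} {b c : ℝ} (hf : C2At z x f b)
    (hfs : CkOn n 2 f U) (h0 : ∀ y ∈ U, f y ≠ 0) (hc : ‖(f x)⁻¹‖ ≤ c) :
    C2At z x (fun y => (f y)⁻¹) (c + b * c ^ 2 + 2 * b ^ 2 * c ^ 3) := by
  have h12 : (1 : WithTop ℕ∞) ≤ 2 := by norm_num
  have hf1 : CkOn n 1 f U := hfs.of_le h12
  have hb := hf.nonneg
  have hc0 : 0 ≤ c := (norm_nonneg _).trans hc
  have hm : ∀ {F : M → ℂ}, CkOn n 1 F U → MDifferentiableAt (𝓡∂ (2 * n)) 𝓘(ℝ, ℂ) F x :=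
    fun hF => hF.mdifferentiableAt h.isOpen le_rfl hx
  rw [c2At_iff] at hf ⊢
  have p1 : 0 ≤ b * c ^ 2 := by positivity
  have p2 : 0 ≤ 2 * b ^ 2 * c ^ 3 := by positivity
  refine ⟨by linarith, fun a ha => ?_, fun a d ha hd => ?_⟩
  · rw [coordDeriv_inv h.isOpen hf1 hx (h0 x hx), norm_neg, norm_mul, norm_mul]
    have := mul_le_mul (hf.2.1 a ha) (mul_le_mul hc hc (norm_nonneg _) hc0) (by positivity) hb
    nlinarith
  · have hi : CkOn n 1 (fun y => (f y)⁻¹) U := hf1.inv h0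
    have hd1 : CkOn n 1 (coordDeriv z d f) U := hfs.coordDeriv h (by norm_num) one_add_one_le_infty d
    have e : coordDeriv z a (coordDeriv z d fun y => (f y)⁻¹) x =
        -(coordDeriv z a (coordDeriv z d f) x * ((f x)⁻¹ * (f x)⁻¹)) +
          2 * (coordDeriv z d f x * coordDeriv z a f x * ((f x)⁻¹ * (f x)⁻¹ * (f x)⁻¹)) := by
      rw [coordDeriv_congr (g := fun y => (-1) * (coordDeriv z d f y * ((f y)⁻¹ * (f y)⁻¹))) (by
        filter_upwards [h.isOpen.mem_nhds hx] with y hy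
        rw [coordDeriv_inv h.isOpen hf1 hy (h0 y hy)]
        ring) z a, coordDeriv_const_mul h hx (hd1.mul (hi.mul hi)),
        coordDeriv_mul (hm hd1) (hm (hi.mul hi)), coordDeriv_mul (hm hi) (hm hi),
        coordDeriv_inv h.isOpen hf1 hx (h0 x hx)]
      ring
    rw [e]
    refine (norm_add_le _ _).trans ?_
    rw [norm_neg, norm_mul, norm_mul, norm_mul, norm_mul, norm_mul, norm_mul, norm_mul,
      Complex.norm_ofNat]
    have h1 := mul_le_mul (hf.2.2 a d ha hd) (mul_le_mul hc hc (norm_nonneg _) hc0) (by positivity)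
      hb
    have h2 := mul_le_mul (mul_le_mul (hf.2.1 d hd) (hf.2.1 a ha) (norm_nonneg _) hb)
      (mul_le_mul (mul_le_mul hc hc (norm_nonneg _) hc0) hc (norm_nonneg _) (by positivity))
      (by positivity) (by positivity)
    nlinarith

/-- Each entry is a combination of n² entries of P with constant coefficients of size at most q². -/
theorem C2At.congruence {J : ∀ x : M, Tan n x →ₗ[ℝ] Tan n x} {U : Set M} {z : M → Fin n → ℂ} {x : M}
    (h : IsHolCoord J U z) (hx : x ∈ U) {P : M → Matrix (Fin n) (Fin n) ℂ} {b q : ℝ}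
    (hP : ∀ i j, C2At z x (fun y => P y i j) b) (hPs : ∀ i j, CkOn n 2 (fun y => P y i j) U)
    {Q : Matrix (Fin n) (Fin n) ℂ} (hQ : ∀ i j, ‖Q i j‖ ≤ q) (i j : Fin n) :
    C2At z x (fun y => (Qᵀ * P y * Q.map (starRingEnd ℂ)) i j) (n ^ 2 * (q ^ 2 * b)) ∧
      CkOn n 2 (fun y => (Qᵀ * P y * Q.map (starRingEnd ℂ)) i j) U := by
  have e : (fun y => (Qᵀ * P y * Q.map (starRingEnd ℂ)) i j) = fun y =>
      ∑ s : Fin n × Fin n, (Q s.1 i * (starRingEnd ℂ) (Q s.2 j)) * P y s.1 s.2 := by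
    funext y
    simp only [Matrix.mul_apply, Finset.sum_mul, Fintype.sum_prod_type, Matrix.transpose_apply,
      Matrix.map_apply]
    rw [Finset.sum_comm]
    refine Finset.sum_congr rfl fun k _ => Finset.sum_congr rfl fun m _ => ?_
    ring
  rw [e]
  have hq0 : 0 ≤ q := (norm_nonneg _).trans (hQ i j)
  constructor
  · refine (C2At.lincomb h hx (F := fun (s : Fin n × Fin n) y => P y s.1 s.2) (q := q ^ 2)
      (fun s => hP s.1 s.2) (fun s => hPs s.1 s.2) (fun s => ?_) Finset.univ).mono (le_of_eq ?_)
    · rw [norm_mul, RCLike.norm_conj, pow_two]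
      exact mul_le_mul (hQ _ _) (hQ _ _) (norm_nonneg _) hq0
    · simp [Fintype.card_prod, pow_two]
  · exact CkOn.sum fun s _ => (CkOn.const _).mul (hPs s.1 s.2)

theorem C2BoundOn.mono {z : M → Fin n → ℂ} {K : Set M} {f : M → ℂ} {b b' : ℝ}
    (h : C2BoundOn z K f b) (hb : b ≤ b') : C2BoundOn z K f b' := fun x hx =>
  ⟨(h x hx).1.trans hb, fun a ha => ((h x hx).2.1 a ha).trans hb,
    fun a c ha hc => ((h x hx).2.2 a c ha hc).trans hb⟩

/-- The metric and its inverse are bounded in `C²`. -/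
theorem exists_metric_bound (Ω : HermitianMetric 𝒥) (𝒜 : CoordCover 𝒥) : ∃ β : ℝ, 1 ≤ β ∧
    ∀ k, ∀ i j : Fin n, C2BoundOn (𝒜.z k) (𝒜.K k) (fun x => components Ω.form (𝒜.z k) x i j) β ∧
      C2BoundOn (𝒜.z k) (𝒜.K k) (fun x => (components Ω.form (𝒜.z k) x)⁻¹ i j) β := by
  choose b hb using fun k : Fin 𝒜.N => fun i j : Fin n =>
    exists_c2BoundOn (𝒜.isHolCoord k)
      ((CkOn.metric Ω (𝒜.isHolCoord k) i j).of_le two_le_infty) (𝒜.isCompact k) (𝒜.subset k)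
  choose b' hb' using fun k : Fin 𝒜.N => fun i j : Fin n =>
    exists_c2BoundOn (𝒜.isHolCoord k)
      ((CkOn.metric_inv Ω (𝒜.isHolCoord k) i j).of_le two_le_infty) (𝒜.isCompact k) (𝒜.subset k)
  set S := ∑ s : Fin 𝒜.N × Fin n × Fin n, (|b s.1 s.2.1 s.2.2| + |b' s.1 s.2.1 s.2.2|) with hS
  have hle : ∀ k i j, |b k i j| + |b' k i j| ≤ S := fun k i j =>
    Finset.single_le_sum (f := fun s : Fin 𝒜.N × Fin n × Fin n =>
      |b s.1 s.2.1 s.2.2| + |b' s.1 s.2.1 s.2.2|) (fun _ _ => by positivity)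
      (Finset.mem_univ (k, i, j))
  have hS0 : 0 ≤ S := Finset.sum_nonneg fun _ _ => by positivity
  refine ⟨1 + S, by linarith, fun k i j => ⟨(hb k i j).mono ?_, (hb' k i j).mono ?_⟩⟩
  · linarith [hle k i j, le_abs_self (b k i j), abs_nonneg (b' k i j)]
  · linarith [hle k i j, le_abs_self (b' k i j), abs_nonneg (b k i j)]

/-- A diagonal entry of a Gram matrix is the squared length of a column of B. Since β ≥ 1, √β ≤ β.
-/
theorem norm_entry_le_of_gram {B G : Matrix (Fin n) (Fin n) ℂ} (h : G = Bᵀ * B.map (starRingEnd ℂ))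
    {β : ℝ} (hβ : 1 ≤ β) (hG : ∀ i j, ‖G i j‖ ≤ β) (i j : Fin n) : ‖B i j‖ ≤ β := by
  have h1 : G j j = ((∑ k, ‖B k j‖ ^ 2 : ℝ) : ℂ) := by
    rw [h, Matrix.mul_apply]
    push_cast
    refine Finset.sum_congr rfl fun k _ => ?_
    rw [transpose_apply, map_apply, Complex.mul_conj, Complex.normSq_eq_norm_sq]
    push_cast
    rfl
  have h2 := hG j j
  rw [h1, Complex.norm_real] at h2
  have h3 : ‖B i j‖ ^ 2 ≤ ∑ k, ‖B k j‖ ^ 2 :=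
    Finset.single_le_sum (f := fun k => ‖B k j‖ ^ 2) (fun _ _ => sq_nonneg _) (Finset.mem_univ i)
  have h4 := h3.trans ((le_abs_self _).trans h2)
  nlinarith [norm_nonneg (B i j)]

/-- Frames with uniform bounds exist at all points. -/
theorem exists_normalFrame (Ω : HermitianMetric 𝒥) (𝒜 : CoordCover 𝒥) (B : ℝ) {c : ℝ} (hc : 0 < c) :
    ∃ K : ℝ, ∀ (χ : RealOneOneForm 𝒥) (ψ u v : M → ℝ),
      IsCk n 2 ψ → IsCk n 4 u → IsCk n 2 v → IsSolution Ω χ ψ u → 𝒜.C2Bound v B →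
      (∀ x, c ≤ ψ x) → 𝒜.C2BoundForm χ B → 𝒜.C2Bound ψ B →
      ∀ p, ∃ (U : Set M) (z : M → Fin n → ℂ) (l : Fin n → ℝ), NormalFrame Ω χ ψ u U z p l K ∧
        (∀ m, (chiComp χ v z p m m).re ≤ K) ∧
        ∀ i, ‖wirt z (-Complex.I) i (fun x => (v x : ℂ)) p‖ ≤ K := by
  obtain ⟨β, hβ, hΩ⟩ := exists_metric_bound Ω 𝒜
  have hn1 : (1 : ℝ) ≤ n := by exact_mod_cast Nat.pos_of_ne_zero (NeZero.ne n)
  set r : ℝ := n * β with hr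
  have hr1 : 1 ≤ r := by nlinarith
  set k₁ : ℝ := r ^ 2 * (n ^ 2 * (β ^ 2 * β)) with hk₁
  set k₂ : ℝ := r ^ 2 * (n ^ 2 * (β ^ 2 * |B|)) with hk₂
  set k₃ : ℝ := r ^ 2 * (n * (c⁻¹ + |B| * c⁻¹ ^ 2 + 2 * |B| ^ 2 * c⁻¹ ^ 3)) with hk₃
  set k₄ : ℝ := r ^ 2 * |B| with hk₄
  have hci : 0 < c⁻¹ := inv_pos.2 hc
  have q1 : 0 ≤ k₁ := by positivity
  have q2 : 0 ≤ k₂ := by positivity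
  have q3 : 0 ≤ k₃ := by positivity
  have q4 : 0 ≤ k₄ := by positivity
  -- The summands serve the metric and its inverse, χ, n/ψ and v. All are fixed before χ, ψ, u, v
  -- and the point are given, which is the required uniformity.
  refine ⟨1 + k₁ + k₂ + k₃ + k₄, fun χ ψ u v hψ2 hu hv hsol hvB hψc hχB hψB p => ?_⟩
  obtain ⟨k, hpk⟩ := 𝒜.covers p
  have hz := 𝒜.isHolCoord k
  have hpU := 𝒜.subset k hpk
  have hu2 : IsCk n 2 u := hu.of_le (by norm_num)
  have hψ0 : ∀ x, 0 < ψ x := fun x => hc.trans_le (hψc x)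
  set z := 𝒜.z k with hzdef
  set U := 𝒜.U k with hUdef
  have hGpd := fun x (hx : x ∈ U) => metric_posDef Ω hz hx
  -- Diagonalization at the single point p within the cover's coordinates; the frame is given by the
  -- coordinates Q'z with Q' constant, and Q = Q'⁻¹ is their Jacobian in the other direction.
  obtain ⟨Q', l, hQ'u, hl, hX, hG⟩ := exists_simultaneous_diagonalization
    (chiComp_posDef χ hu2 (hsol p).1 hz hpU) (hGpd p hpU)
  have hQ'd : IsUnit Q'.det := (Matrix.isUnit_iff_isUnit_det _).1 hQ'u
  set Q := Q'⁻¹ with hQ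
  have hQ'Q : Q' * Q = 1 := mul_nonsing_inv _ hQ'd
  have hQQ' : Q * Q' = 1 := nonsing_inv_mul _ hQ'd
  have hmap : ∀ A C : Matrix (Fin n) (Fin n) ℂ, (A * C).map (starRingEnd ℂ) =
      A.map (starRingEnd ℂ) * C.map (starRingEnd ℂ) := fun A C => Matrix.map_mul
  have hmap1 : (1 : Matrix (Fin n) (Fin n) ℂ).map (starRingEnd ℂ) = 1 :=
    Matrix.map_one _ (map_zero _) (map_one _)
  have t1 : Qᵀ * Q'ᵀ = 1 := by rw [← transpose_mul, hQ'Q, transpose_one]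
  have t2 : Q'.map (starRingEnd ℂ) * Q.map (starRingEnd ℂ) = 1 := by rw [← hmap, hQ'Q, hmap1]
  have t3 : Q'ᵀ * Qᵀ = 1 := by rw [← transpose_mul, hQQ', transpose_one]
  have t4 : Q.map (starRingEnd ℂ) * Q'.map (starRingEnd ℂ) = 1 := by rw [← hmap, hQQ', hmap1]
  have hsand : ∀ D : Matrix (Fin n) (Fin n) ℂ,
      Qᵀ * (Q'ᵀ * D * Q'.map (starRingEnd ℂ)) * Q.map (starRingEnd ℂ) = D := fun D => by
    calc _ = (Qᵀ * Q'ᵀ) * D * (Q'.map (starRingEnd ℂ) * Q.map (starRingEnd ℂ)) := by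
          simp only [Matrix.mul_assoc]
      _ = D := by rw [t1, t2, Matrix.one_mul, Matrix.mul_one]
  have hQ'n : ∀ i j, ‖Q' i j‖ ≤ β := norm_entry_le_of_gram hG hβ fun i j =>
    (c2At_iff.1 ((hΩ k i j).1.c2At hpk)).1
  -- G is the Gram matrix of Q', and the transpose of G⁻¹ is that of Qᵀ. Bounds for the metric and
  -- its inverse therefore bound Q' and Q, independently of χ_u.
  have hQn : ∀ i j, ‖Q i j‖ ≤ β := by
    have h1 : (components Ω.form z p)⁻¹ = Q.map (starRingEnd ℂ) * Qᵀ := by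
      refine Matrix.inv_eq_right_inv ?_
      rw [hG]
      calc _ = Q'ᵀ * (Q'.map (starRingEnd ℂ) * Q.map (starRingEnd ℂ)) * Qᵀ := by
            simp only [Matrix.mul_assoc]
        _ = 1 := by rw [t2, Matrix.mul_one, t3]
    have h2 : ((components Ω.form z p)⁻¹)ᵀ = (Qᵀ)ᵀ * (Qᵀ).map (starRingEnd ℂ) := by
      rw [h1, transpose_mul, transpose_map]
    intro i j
    exact norm_entry_le_of_gram h2 hβ (fun i j => (c2At_iff.1 ((hΩ k j i).2.c2At hpk)).1) j i
  have hQr : ∀ a : Fin n → ℂ, ‖a‖ ≤ 1 → ‖Q *ᵥ a‖ ≤ r := by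
    intro a ha
    refine (pi_norm_le_iff_of_nonneg (by positivity)).2 fun i => ?_
    have h1 : ‖(Q *ᵥ a) i‖ ≤ ∑ _j : Fin n, β := by
      change ‖∑ j, Q i j * a j‖ ≤ _
      refine norm_sum_le_of_le _ fun j _ => ?_
      rw [norm_mul]
      have := mul_le_mul (hQn i j) ((norm_le_pi_norm a j).trans ha) (norm_nonneg _) (by linarith)
      linarith
    simpa using h1
  set z' := linCoord Q' z with hz'
  have hzz : IsHolCoord 𝒥.J U z' := hz.linear hQ'u
  have hjac : ∀ x ∈ U, jacobian z' z x = Q := fun x hx => jacobian_linCoord_left hz hQ'u hx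
  have hlin : ∀ {f : M → ℂ} {b : ℝ}, C2At z p f b → CkOn n 2 f U → C2At z' p f (r ^ 2 * b) :=
    fun hf hfs => hf.linCoord hz hQ'u hpU hfs hr1 hQr
  have hGc : ∀ x ∈ U, components Ω.form z' x =
      Qᵀ * components Ω.form z x * Q.map (starRingEnd ℂ) := fun x hx => by
    rw [components_change hzz hz hx Ω.form (Ω.invariant x), hjac x hx]
  have hEc : ∀ x ∈ U, components χ.form z' x =
      Qᵀ * components χ.form z x * Q.map (starRingEnd ℂ) := fun x hx => by
    rw [components_change hzz hz hx χ.form (χ.invariant x), hjac x hx]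
  -- The inverse metric transforms by a constant congruence as well, so its C² bound carries over
  -- without differentiating an inverse matrix.
  have hHc : ∀ x ∈ U, (components Ω.form z' x)⁻¹ = ((Q'.map (starRingEnd ℂ))ᵀ)ᵀ *
      (components Ω.form z x)⁻¹ * ((Q'.map (starRingEnd ℂ))ᵀ).map (starRingEnd ℂ) := fun x hx => by
    have h1 : components Ω.form z x * (components Ω.form z x)⁻¹ = 1 :=
      mul_nonsing_inv _ ((Matrix.isUnit_iff_isUnit_det _).1 (hGpd x hx).isUnit)
    have h2 : ((Q'.map (starRingEnd ℂ))ᵀ).map (starRingEnd ℂ) = Q'ᵀ := by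
      ext i j
      simp
    refine Matrix.inv_eq_right_inv ?_
    rw [hGc x hx, h2, transpose_transpose]
    calc _ = Qᵀ * (components Ω.form z x * ((Q.map (starRingEnd ℂ) * Q'.map (starRingEnd ℂ)) *
          (components Ω.form z x)⁻¹)) * Q'ᵀ := by simp only [Matrix.mul_assoc]
      _ = 1 := by rw [t4, Matrix.one_mul, h1, Matrix.mul_one, t1]
  have sG : ∀ i j, CkOn n 2 (fun x => components Ω.form z x i j) U := fun i j =>
    (CkOn.metric Ω hz i j).of_le two_le_infty
  have sH : ∀ i j, CkOn n 2 (fun x => (components Ω.form z x)⁻¹ i j) U := fun i j =>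
    (CkOn.metric_inv Ω hz i j).of_le two_le_infty
  have sE : ∀ i j, CkOn n 2 (fun x => components χ.form z x i j) U := fun i j =>
    (χ.smooth U z hz i j : CkOn n ∞ _ U).of_le two_le_infty
  have sv : CkOn n 2 (fun x => (v x : ℂ)) U := IsCk.ofReal hv U
  have sψ : CkOn n 2 (fun x => (ψ x : ℂ)) U := IsCk.ofReal hψ2 U
  have cE : ∀ i j, C2At z' p (fun x => components χ.form z' x i j) k₂ := fun i j => by
    obtain ⟨h1, h2⟩ := C2At.congruence hz hpU (P := fun x => components χ.form z x)
      (fun i j => ((hχB k i j).mono (le_abs_self B)).c2At hpk) sE hQn i j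
    exact C2At.congr hzz hpU (hlin h1 h2) fun y hy => by rw [hEc y hy]
  have cv : C2At z' p (fun x => (v x : ℂ)) k₄ :=
    hlin (((hvB k).mono (le_abs_self B)).c2At hpk) sv
  have hI : ‖-Complex.I‖ = 1 := by simp
  refine ⟨U, z', l, ⟨hzz, hpU, by linarith, hl, ?_, ?_, fun i j => ?_, fun i j => ?_, fun i j => ?_,
    ?_⟩, fun m => ?_, fun i => ?_⟩
  · rw [hGc p hpU, hG]
    simpa using hsand 1
  · rw [chiComp_change hzz hz hpU χ (IsCk.ofReal hu2 U), hjac p hpU, hX, hsand]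
  · obtain ⟨h1, h2⟩ := C2At.congruence hz hpU (P := fun x => components Ω.form z x)
      (fun i j => (hΩ k i j).1.c2At hpk) sG hQn i j
    exact C2At.mono (C2At.congr hzz hpU (hlin h1 h2) fun y hy => by rw [hGc y hy]) (by linarith)
  · obtain ⟨h1, h2⟩ := C2At.congruence hz hpU (P := fun x => (components Ω.form z x)⁻¹)
      (Q := (Q'.map (starRingEnd ℂ))ᵀ) (fun i j => (hΩ k i j).2.c2At hpk) sH
      (fun i j => by rw [transpose_apply, map_apply, RCLike.norm_conj]; exact hQ'n j i) i j
    exact C2At.mono (C2At.congr hzz hpU (hlin h1 h2) fun y hy => by rw [hHc y hy]) (by linarith)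
  · exact (cE i j).mono (by linarith)
  · have hne : ∀ y ∈ U, (ψ y : ℂ) ≠ 0 := fun y _ => by exact_mod_cast (hψ0 y).ne'
    have h1 := (((hψB k).mono (le_abs_self B)).c2At hpk).inv hz hpU sψ hne (c := c⁻¹) (by
      rw [norm_inv, Complex.norm_real, Real.norm_of_nonneg (hψ0 p).le]
      exact inv_anti₀ hc (hψc p))
    have h2 := h1.const_mul hz hpU (sψ.inv hne) (n : ℂ)
    rw [Complex.norm_natCast] at h2
    exact (hlin h2 ((CkOn.const _).mul (sψ.inv hne))).mono (by linarith)
  · have h1 : chiComp χ v z' p m m = components χ.form z' p m m +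
        wirt z' (-Complex.I) m (wirt z' Complex.I m fun x => (v x : ℂ)) p := by
      rw [← partialZ_eq_wirt, ← partialZbar_eq_wirt]
      rfl
    have h2 := (c2At_iff.1 (cE m m)).1
    have h3 := cv.norm_wirt_wirt hzz hpU sv hI Complex.norm_I m m
    rw [h1, Complex.add_re]
    linarith [(Complex.re_le_norm _).trans h2, (Complex.re_le_norm _).trans h3]
  · linarith [cv.norm_wirt hI i]

end FrameExistence

/-! ### Global estimates -/

section Global

variable {n : ℕ} [NeZero n] {M : Type*} [TopologicalSpace M] [CompactSpace M]
  [ChartedSpace (EuclideanHalfSpace (2 * n)) M] [IsManifold (𝓡∂ (2 * n)) ∞ M]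
  {𝒥 : ComplexStructure n M}

/-- The maximum of `w` is controlled by its boundary values and its values at the interior maxima
of `w exp (exp (A τ))`. -/
theorem le_of_auxiliary_maximum {w τ : M → ℝ} (hw : Continuous w) (hτ : Continuous τ)
    (hw0 : ∀ x, 0 ≤ w x) {A R N S : ℝ} (hA : 0 ≤ A) (hτR : ∀ x, τ x ≤ R) (hN : 0 ≤ N)
    (hS : 0 ≤ S) (hbd : ∀ x ∈ bdry n M, w x ≤ S)
    (hint : ∀ p, (𝓡∂ (2 * n)).IsInteriorPoint p →
      IsLocalMax (fun x => w x * Real.exp (Real.exp (A * τ x))) p → w p ≤ N) (x : M) :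
    w x ≤ (N + S) * Real.exp (Real.exp (A * R)) := by
  have hF : Continuous fun x => w x * Real.exp (Real.exp (A * τ x)) := by fun_prop
  obtain ⟨p, -, hp⟩ := isCompact_univ.exists_isMaxOn ⟨x, mem_univ x⟩ hF.continuousOn
  have hwp : w p ≤ N + S := by
    rcases ModelWithCorners.isInteriorPoint_or_isBoundaryPoint (I := 𝓡∂ (2 * n)) p with h | h
    · linarith [hint p h (hp.isLocalMax Filter.univ_mem)]
    · linarith [hbd p h]
  have h1 : w x * Real.exp (Real.exp (A * τ x)) ≤ w p * Real.exp (Real.exp (A * τ p)) :=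
    hp (mem_univ x)
  calc w x ≤ w x * Real.exp (Real.exp (A * τ x)) :=
        le_mul_of_one_le_right (hw0 x) (Real.one_le_exp (Real.exp_pos _).le)
    _ ≤ w p * Real.exp (Real.exp (A * τ p)) := h1
    _ ≤ (N + S) * Real.exp (Real.exp (A * R)) := by
      refine mul_le_mul hwp ?_ (Real.exp_pos _).le (by linarith)
      exact Real.exp_le_exp.2 (Real.exp_le_exp.2 (mul_le_mul_of_nonneg_left (hτR p) hA))

theorem le_sSup_bdry {f : M → ℝ} (hf : Continuous f) {x : M} (hx : x ∈ bdry n M) :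
    f x ≤ sSup (f '' bdry n M) :=
  le_csSup (BddAbove.mono (image_subset_range _ _) (isCompact_range hf).bddAbove)
    (mem_image_of_mem f hx)

/-- The difference of a subsolution and the solution, normalized to be nonnegative. -/
theorem exists_normalized_difference {𝒜 : CoordCover 𝒥} {u v : M → ℝ} (hu : Continuous u)
    {B C₀ : ℝ} (hv : 𝒜.C2Bound v B) (hosc : (⨆ x, u x) - (⨅ x, u x) ≤ C₀) :
    ∃ b : ℝ, ∀ x, 0 ≤ v x - u x + b ∧ v x - u x + b ≤ 2 * |B| + C₀ := by
  have h1 : BddAbove (range u) := (isCompact_range hu).bddAbove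
  have h2 : BddBelow (range u) := (isCompact_range hu).bddBelow
  -- With b = |B| + sup u the function v − u + b lies between 0 and 2|B| + osc u, since |v| ≤ |B|.
  refine ⟨|B| + ⨆ x, u x, fun x => ?_⟩
  obtain ⟨k, hk⟩ := 𝒜.covers x
  have h3 := (hv k x hk).1
  rw [Complex.norm_real] at h3
  have h4 := abs_le.1 (h3.trans (le_abs_self B))
  have h5 := le_ciSup h1 x
  have h6 := ciInf_le h2 x
  constructor <;> linarith [h4.1, h4.2]

/-- The auxiliary function is used with w = |∇u|², interior bound N from `gradSq_le_of_isLocalMax`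
and boundary bound S². The supremum over an empty boundary is 0, so a closed manifold needs no
separate treatment. -/
theorem gradient_estimate (Ω : HermitianMetric 𝒥) (𝒜 : CoordCover 𝒥) (C₀ B : ℝ) {c : ℝ}
    (hc : 0 < c) : ∃ C₁ : ℝ, ∀ (χ : RealOneOneForm 𝒥) (ψ u v : M → ℝ),
      IsCk n 2 ψ → IsCk n 4 u → IsCk n 2 v →
      IsSolution Ω χ ψ u → IsSubsolution Ω χ ψ v →
      (⨆ x, u x) - (⨅ x, u x) ≤ C₀ → 𝒜.C2Bound v B → (∀ x, c ≤ ψ x) →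
      𝒜.C2BoundForm χ B → 𝒜.C2Bound ψ B →
      ∀ x, gradNorm Ω u x ≤ C₁ * (1 + sSup (gradNorm Ω u '' bdry n M)) := by
  obtain ⟨K, hK⟩ := exists_normalFrame Ω 𝒜 B hc
  obtain ⟨C, hC⟩ : ∃ C : ℝ, C = 3 * (20 * n ^ 2 * K ^ 4 * (1 + n * K + n * (1 + K))) +
      2 * (20 * n ^ 2 * K ^ 4 * (1 + n * K + n * (1 + K))) ^ 2 := ⟨_, rfl⟩
  obtain ⟨A, hA⟩ : ∃ A, A = 2 * K * (C + C ^ 2 + 1) := ⟨_, rfl⟩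
  obtain ⟨N, hN⟩ : ∃ N : ℝ, N = n * (K + 4 * K * (C + 1)) ^ 2 := ⟨_, rfl⟩
  obtain ⟨E, hE⟩ : ∃ E, E = Real.exp (Real.exp (A * (2 * |B| + C₀))) := ⟨_, rfl⟩
  -- The maximum principle bounds |∇u|² by (N + S²)E. Since E ≥ 1, the square of (N + 1)E(1 + S)
  -- dominates this, so the constants need no square roots.
  refine ⟨(N + 1) * E, fun χ ψ u v hψ2 hu hv hsol hsub hosc hvB hψc hχB hψB x => ?_⟩
  have hfr := hK χ ψ u v hψ2 hu hv hsol hvB hψc hχB hψB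
  have hψ0 : ∀ x, 0 < ψ x := fun x => hc.trans_le (hψc x)
  -- `exists_normalFrame` records K ≥ 1 only inside a frame, and the given point supplies one.
  have hK1 : 1 ≤ K := by
    obtain ⟨U, z, l, F, -⟩ := hfr x
    exact F.one_le
  have hC0 : 0 ≤ C := by rw [hC]; positivity
  have hA0 : 0 ≤ A := by rw [hA]; positivity
  have hN0 : 0 ≤ N := by rw [hN]; positivity
  have hE1 : 1 ≤ E := by rw [hE]; exact Real.one_le_exp (Real.exp_pos _).le
  obtain ⟨b, hb⟩ := exists_normalized_difference hu.continuous hvB hosc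
  have hcont := continuous_gradSq Ω (hu.of_le (by norm_num) : IsCk n 2 u)
  have hnn : ∀ y, 0 ≤ gradSq Ω u y := fun y => by
    obtain ⟨U, z, l, F, -⟩ := hfr y
    rw [F.gradSq_eq_sum (hu.of_le (by norm_num))]
    positivity
  have hgn : ∀ y, gradNorm Ω u y = √(gradSq Ω u y) := gradNorm_eq_sqrt Ω u
  have hgc : Continuous (gradNorm Ω u) := by
    rw [funext hgn]
    exact hcont.sqrt
  set S := sSup (gradNorm Ω u '' bdry n M) with hS
  have hS0 : 0 ≤ S := Real.sSup_nonneg (by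
    rintro _ ⟨y, -, rfl⟩
    rw [hgn]
    exact Real.sqrt_nonneg _)
  have hmain := le_of_auxiliary_maximum (w := gradSq Ω u) (τ := fun x => v x - u x + b) (S := S ^ 2)
    hcont ((hv.continuous.sub hu.continuous).add continuous_const) hnn hA0 (fun x => (hb x).2) hN0
    (sq_nonneg S) (fun y hy => by
      rw [← Real.sq_sqrt (hnn y), ← hgn]
      exact pow_le_pow_left₀ (by rw [hgn]; exact Real.sqrt_nonneg _) (le_sSup_bdry hgc hy) 2)
    (fun p hp hmax => by
      obtain ⟨U, z, l, F, h1, h2⟩ := hfr p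
      rw [hN]
      exact F.gradSq_le_of_isLocalMax hu hv hψ0 hsol hsub rfl (hb p).1 h1 h2 hC hA hp hmax) x
  rw [← hE] at hmain
  rw [hgn]
  refine Real.sqrt_le_iff.2 ⟨by positivity, hmain.trans ?_⟩
  have h1 : N + S ^ 2 ≤ ((N + 1) * (1 + S)) ^ 2 := by
    have h2 : 1 + S ≤ (N + 1) * (1 + S) := le_mul_of_one_le_left (by linarith) (by linarith)
    have h3 : N + 1 ≤ (N + 1) * (1 + S) := le_mul_of_one_le_right (by linarith) (by linarith)
    nlinarith
  calc (N + S ^ 2) * E ≤ ((N + 1) * (1 + S)) ^ 2 * E ^ 2 := by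
        refine mul_le_mul h1 ?_ (by linarith) (sq_nonneg _)
        nlinarith
    _ = _ := by ring

/-- The maximum principle is applied to tr_ω χ_u = Δu + tr_ω χ, which is positive. Since |tr_ω χ| ≤
nK, passing to Δu costs nK on the boundary and again at the end. Positivity of the trace supplies
the lower bound for Δu. -/
theorem laplacian_estimate (Ω : HermitianMetric 𝒥) (𝒜 : CoordCover 𝒥) (C₀ B : ℝ) {c : ℝ}
    (hc : 0 < c) : ∃ C₂ : ℝ, ∀ (χ : RealOneOneForm 𝒥) (ψ u v : M → ℝ),
      IsCk n 2 ψ → IsCk n 4 u → IsCk n 2 v →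
      IsSolution Ω χ ψ u → IsSubsolution Ω χ ψ v →
      (⨆ x, u x) - (⨅ x, u x) ≤ C₀ → 𝒜.C2Bound v B → (∀ x, c ≤ ψ x) →
      𝒜.C2BoundForm χ B → 𝒜.C2Bound ψ B →
      ∀ x, |laplacian Ω u x| ≤ C₂ * (1 + sSup ((fun y => |laplacian Ω u y|) '' bdry n M)) := by
  obtain ⟨K, hK⟩ := exists_normalFrame Ω 𝒜 B hc
  obtain ⟨C, hC⟩ : ∃ C : ℝ, C = 3 * (10 * n ^ 2 * K ^ 5 * (1 + K + 2 * n * K)) +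
      2 * (10 * n ^ 2 * K ^ 5 * (1 + K + 2 * n * K)) ^ 2 := ⟨_, rfl⟩
  obtain ⟨A, hA⟩ : ∃ A, A = 2 * K * (C + C ^ 2 + 1) := ⟨_, rfl⟩
  obtain ⟨N, hN⟩ : ∃ N : ℝ, N = n * (4 * K) := ⟨_, rfl⟩
  obtain ⟨E, hE⟩ : ∃ E, E = Real.exp (Real.exp (A * (2 * |B| + C₀))) := ⟨_, rfl⟩
  refine ⟨(N + n * K + 1) * E + n * K,
    fun χ ψ u v hψ2 hu hv hsol hsub hosc hvB hψc hχB hψB x => ?_⟩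
  have hfr := hK χ ψ u v hψ2 hu hv hsol hvB hψc hχB hψB
  have hψ0 : ∀ x, 0 < ψ x := fun x => hc.trans_le (hψc x)
  have hK1 : 1 ≤ K := by
    obtain ⟨U, z, l, F, -⟩ := hfr x
    exact F.one_le
  have hC0 : 0 ≤ C := by rw [hC]; positivity
  have hA0 : 0 ≤ A := by rw [hA]; positivity
  have hN0 : 0 ≤ N := by rw [hN]; positivity
  have hE1 : 1 ≤ E := by rw [hE]; exact Real.one_le_exp (Real.exp_pos _).le
  have hnK : 0 ≤ n * K := by positivity
  have hu2 : IsCk n 2 u := hu.of_le (by norm_num)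
  obtain ⟨b, hb⟩ := exists_normalized_difference hu.continuous hvB hosc
  have hlap := continuous_laplacian Ω hu2
  have hcont : Continuous (formTrace Ω χ u) := hlap.add (continuous_metricTrace Ω χ)
  have hnn : ∀ y, 0 ≤ formTrace Ω χ u y := fun y => by
    obtain ⟨U, z, l, F, -⟩ := hfr y
    rw [F.formTrace_eq_sum hu2 fun x => (hsol x).1]
    exact Finset.sum_nonneg fun i _ => (F.pos i).le
  have hmt : ∀ y, |metricTrace Ω χ y| ≤ n * K := fun y => by
    obtain ⟨U, z, l, F, -⟩ := hfr y
    exact F.abs_metricTrace_le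
  set S := sSup ((fun y => |laplacian Ω u y|) '' bdry n M) with hS
  have hS0 : 0 ≤ S := Real.sSup_nonneg (by
    rintro _ ⟨y, -, rfl⟩
    exact abs_nonneg _)
  have hmain := le_of_auxiliary_maximum (w := formTrace Ω χ u) (τ := fun x => v x - u x + b)
    (S := S + n * K)
    hcont ((hv.continuous.sub hu.continuous).add continuous_const) hnn hA0 (fun x => (hb x).2) hN0
    (by linarith) (fun y hy => by
      have h1 : |laplacian Ω u y| ≤ S := le_sSup_bdry hlap.abs hy
      exact add_le_add ((le_abs_self _).trans h1) ((le_abs_self _).trans (hmt y)))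
    (fun p hp hmax => by
      obtain ⟨U, z, l, F, h1, -⟩ := hfr p
      rw [hN]
      exact F.formTrace_le_of_isLocalMax hu hv hψ2 hψ0 hsol hsub rfl (hb p).1 h1 hC hA hp hmax) x
  rw [← hE] at hmain
  have h0 := hnn x
  have h1 := abs_le.1 (hmt x)
  have e : formTrace Ω χ u x = laplacian Ω u x + metricTrace Ω χ x := rfl
  rw [e] at hmain h0
  have h2 : (N + (S + n * K)) * E ≤ (N + n * K + 1) * E * (1 + S) := by
    have h3 : N + (S + n * K) ≤ (N + n * K + 1) * (1 + S) := by nlinarith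
    calc _ ≤ (N + n * K + 1) * (1 + S) * E := mul_le_mul_of_nonneg_right h3 (by linarith)
      _ = _ := by ring
  have h4 : n * K ≤ n * K * (1 + S) := le_mul_of_one_le_right hnK (by linarith)
  have h5 : 0 ≤ (N + n * K + 1) * E * (1 + S) := by positivity
  rw [add_mul]
  refine abs_le.2 ⟨?_, ?_⟩ <;> linarith [h1.1, h1.2]

end Global

end HermitianMA

end

theorem theorem1p1 (n : ℕ) [NeZero n] (hn : 2 ≤ n) {M : Type*} [TopologicalSpace M] [T2Space M]
    [CompactSpace M] [ChartedSpace (EuclideanHalfSpace (2 * n)) M]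
    [IsManifold (𝓡∂ (2 * n)) ∞ M] (𝒥 : ComplexStructure n M) (Ω : HermitianMetric 𝒥)
    (𝒜 : CoordCover 𝒥) (C₀ B ε c : ℝ) (hε : 0 < ε) (hc : 0 < c) :
    ∃ C₁ C₂ : ℝ, ∀ (χ : RealOneOneForm 𝒥) (ψ u v : M → ℝ),
      IsCk n 2 ψ → IsCk n 4 u → IsCk n 2 v →
      IsSolution Ω χ ψ u → IsSubsolution Ω χ ψ v →
      (⨆ x, u x) - (⨅ x, u x) ≤ C₀ →
      𝒜.C2Bound v B → LowerBound Ω χ v ε → (∀ x, c ≤ ψ x) →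
      𝒜.C2BoundForm χ B → 𝒜.C2Bound ψ B →
      (∀ x, gradNorm Ω u x ≤ C₁ * (1 + sSup (gradNorm Ω u '' bdry n M))) ∧
      (∀ x, |laplacian Ω u x| ≤ C₂ * (1 + sSup ((fun y => |laplacian Ω u y|) '' bdry n M))) := by
  obtain ⟨C₁, h₁⟩ := gradient_estimate Ω 𝒜 C₀ B hc
  obtain ⟨C₂, h₂⟩ := laplacian_estimate Ω 𝒜 C₀ B hc
  exact ⟨C₁, C₂, fun χ ψ u v hψ hu hv hsol hsub hosc hvB _ hψc hχB hψB =>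
    ⟨h₁ χ ψ u v hψ hu hv hsol hsub hosc hvB hψc hχB hψB,
      h₂ χ ψ u v hψ hu hv hsol hsub hosc hvB hψc hχB hψB⟩⟩
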